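/- Let $M$ be a smooth 3-manifold, $P=M\times SU(2)\to M$, and let $\mathbf w,\mathbf e$ be smooth $\mathfrak{su}(2)$-valued 1-forms on $M$ (with values in traceless anti-Hermitian $2\times2$ matrices) such that $\mathbf e$ is a frame and $\mathbf f:=d\mathbf w+\mathbf w\wedge\mathbf w=\mathbf e\wedge\mathbf e$. Put $v_{\mathbf f}:=-\tfrac23{\rm Tr}(\mathbf e\wedge\mathbf e\wedge\mathbf e)$, let $\omega$ be a smooth 3-form and $b$ a smooth 2-form on $M$, and let $\rho:=(\omega+db)/v_{\mathbf f}$, a function on $M$, also regarded as a function on $P$. On $P$, with $g\in SU(2)$ the fibre coordinate and $\mathbf m=g^{-1}dg$, put $W:=g^{-1}\mathbf w g+\mathbf m$ (a connection), $E:=g^{-1}\mathbf e g$, $F(W):=dW+W\wedge W$, $\nabla_W E:=dE+W\wedge E+E\wedge W$, $\nabla:=\nabla_W$, and $$\Omega:={\rm Tr}\left(-\tfrac13 W^3+E\wedge E\wedge W\right)-\tfrac{2\rho}{3}{\rm Tr}(E^3).$$ Fix an orientation of $P$ and a smooth volume form $v$ in it. For a 3-form $\Omega$ on $P$ let $K_\Omega$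 be the endomorphism of $T^*P$ given by $(K_\Omega\alpha)(\xi)=\alpha\wedge i_\xi\Omega\wedge\Omega/v$, and $\lambda(\Omega)=\frac16{\rm Tr}(K_\Omega^2)$. The form $\Omega$ is of negative type if $\lambda(\Omega)<0$ everywhere; then $J_\Omega:=K_\Omega/\sqrt{-\lambda(\Omega)}$ (acting on vectors by transposition) is an almost complex structure, and $\hat\Omega:=-J_\Omega(\Omega)$, with $J_\Omega$ acting on all three indices. Then $\Omega$ is of negative type if and only if $|\rho|<1$ everywhere on $M$. Suppose this is the case. Then $$d\hat\Omega=0\iff d\rho=0\ \text{ and }\ \nabla E=2\rho\,E\wedge E.$$ The connection determined by $J_\Omega$ (whose horizontal space is the $J_\Omega$-image of the vertical space $V$, which is a complement of $V$) is $W_J=W-\rho E$; it is the lift $g^{-1}\mathbf w_J g+\mathbf m$ of $\mathbf w_J:=\mathbf w-\rho\,\mathbf e$. The form $E_J:=\sqrt{1-\rho^2}\,E$ is a frame for the metric determined by $J_\Omega$: it vanishes on $V$, $J_\Omega$ maps horizontal vectors into $V$, and $(J_\Omega\xi,J_\Omega\eta)_{SU(2)}=-2{\rm Tr}(E_J(\xi)E_J(\eta))$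 for horizontal $\xi,\eta$, where $(\cdot,\cdot)_{SU(2)}=-2{\rm Tr}(\mathbf m\otimes\mathbf m)$ on $V$. Writing $\nabla_J:=\nabla_{W_J}$ and $F_J:=F(W_J)$, the following are equivalent: 1. $d\hat\Omega=0$; 2. $d\rho=0$ and $W_J$ is torsion-free, $\nabla_J E=0$; 3. $\nabla_J E=0$ and $F_J=(1-\rho^2)\,E\wedge E$; 4. $\nabla_J E_J=0$ and $F_J=E_J\wedge E_J$; 5. the equations of 3D gravity coupled to the 2-form field hold on $M$: $d\rho=0$, $d\mathbf e+\mathbf w_J\wedge\mathbf e+\mathbf e\wedge\mathbf w_J=0$ and $d\mathbf w_J+\mathbf w_J\wedge\mathbf w_J=(1-\rho^2)\,\mathbf e\wedge\mathbf e$. -/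

import Mathlib

open scoped Manifold ContDiff Matrix

attribute [local instance] Matrix.linftyOpNormedRing Matrix.linftyOpNormedAlgebra

/-! ### Pointwise exterior algebra -/

section Pointwise

/-- Product `α ⊗ β` of two continuous alternating maps with values in an algebra: the continuous
multilinear map `(v₁, …, v_{p+q}) ↦ α(v₁, …, v_p) * β(v_{p+1}, …, v_{p+q})`. -/
noncomputable def formTensor {V A : Type*} [AddCommGroup V] [Module ℝ V] [TopologicalSpace V]
    [NormedRing A] [NormedAlgebra ℝ A] {p q : ℕ}
    (α : V [⋀^Fin p]→L[ℝ] A) (β : V [⋀^Fin q]→L[ℝ] A) :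
    ContinuousMultilinearMap ℝ (fun _ : Fin (p + q) => V) A where
  toMultilinearMap :=
    ((LinearMap.mul' ℝ A).compMultilinearMap
      (MultilinearMap.domCoprod α.toAlternatingMap.toMultilinearMap
        β.toAlternatingMap.toMultilinearMap)).domDomCongr finSumFinEquiv
  cont := by
    change Continuous fun v : Fin (p + q) → V =>
      α (fun i => v (finSumFinEquiv (Sum.inl i))) * β (fun i => v (finSumFinEquiv (Sum.inr i)))
    exact (α.cont.comp (by fun_prop)).mul (β.cont.comp (by fun_prop))

theorem formTensor_apply {V A : Type*} [AddCommGroup V] [Module ℝ V] [TopologicalSpace V]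
    [NormedRing A] [NormedAlgebra ℝ A] {p q : ℕ}
    (α : V [⋀^Fin p]→L[ℝ] A) (β : V [⋀^Fin q]→L[ℝ] A) (v : Fin (p + q) → V) :
    formTensor α β v = α (fun i => v (Fin.castAdd q i)) * β (fun i => v (Fin.natAdd p i)) :=
  rfl

/-- Wedge product of forms with values in a (possibly noncommutative) algebra,
`(α ∧ β)(v) = 1 / (p! q!) ∑_σ sgn(σ) α(v_{σ 1}, …, v_{σ p}) β(v_{σ (p+1)}, …, v_{σ (p+q)})`. -/
noncomputable def wedge {V A : Type*} [AddCommGroup V] [Module ℝ V] [TopologicalSpace V]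
    [NormedRing A] [NormedAlgebra ℝ A] {p q : ℕ}
    (α : V [⋀^Fin p]→L[ℝ] A) (β : V [⋀^Fin q]→L[ℝ] A) : V [⋀^Fin (p + q)]→L[ℝ] A :=
  ((p.factorial * q.factorial : ℝ)⁻¹) •
    ContinuousMultilinearMap.alternatization (formTensor α β)

theorem wedge_apply {V A : Type*} [AddCommGroup V] [Module ℝ V] [TopologicalSpace V]
    [NormedRing A] [NormedAlgebra ℝ A] {p q : ℕ}
    (α : V [⋀^Fin p]→L[ℝ] A) (β : V [⋀^Fin q]→L[ℝ] A) (v : Fin (p + q) → V) :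
    wedge α β v = ((p.factorial * q.factorial : ℝ)⁻¹) • ∑ σ : Equiv.Perm (Fin (p + q)),
      Equiv.Perm.sign σ • (α (fun i => v (σ (Fin.castAdd q i))) *
        β (fun i => v (σ (Fin.natAdd p i)))) := by
  simp [wedge, ContinuousMultilinearMap.alternatization_apply_apply, formTensor_apply]

infixl:70 " ⋏ " => wedge

/-- Interior product `ι_ξ Ω = Ω(ξ, ·, …, ·)`. -/
def contract {V F : Type*} [AddCommGroup V] [Module ℝ V] [TopologicalSpace V]
    [NormedAddCommGroup F] [NormedSpace ℝ F] {n : ℕ}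
    (ξ : V) (Ω : V [⋀^Fin (n + 1)]→L[ℝ] F) : V [⋀^Fin n]→L[ℝ] F where
  toMultilinearMap := (Ω.toAlternatingMap.curryLeft ξ).toMultilinearMap
  cont := by
    change Continuous fun v : Fin n → V => Ω (Matrix.vecCons ξ v)
    exact Ω.cont.comp (continuous_const.matrixVecCons continuous_id)
  map_eq_zero_of_eq' := (Ω.toAlternatingMap.curryLeft ξ).map_eq_zero_of_eq'

theorem contract_apply {V F : Type*} [AddCommGroup V] [Module ℝ V] [TopologicalSpace V]
    [NormedAddCommGroup F] [NormedSpace ℝ F] {n : ℕ}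
    (ξ : V) (Ω : V [⋀^Fin (n + 1)]→L[ℝ] F) (v : Fin n → V) :
    contract ξ Ω v = Ω (Matrix.vecCons ξ v) :=
  rfl

/-- Quotient `μ / v` of a top degree form by a nonzero top degree form: both are evaluated on one
and the same tuple of vectors on which `v` does not vanish. On a space of dimension `n` this is the
unique real number `c` with `μ = c v`. -/
noncomputable def topQuot {V : Type*} [AddCommGroup V] [Module ℝ V] [TopologicalSpace V] {n : ℕ}
    (μ v : V [⋀^Fin n]→L[ℝ] ℝ) : ℝ :=
  μ (Classical.epsilon fun u => v u ≠ 0) / v (Classical.epsilon fun u => v u ≠ 0)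

/-- A linear functional on a finite-dimensional space as a `1`-form. -/
noncomputable def oneForm {V : Type*} [AddCommGroup V] [Module ℝ V] [TopologicalSpace V]
    [IsTopologicalAddGroup V] [ContinuousSMul ℝ V] [FiniteDimensional ℝ V] [T2Space V]
    (α : Module.Dual ℝ V) : V [⋀^Fin 1]→L[ℝ] ℝ :=
  ContinuousAlternatingMap.ofSubsingleton ℝ V ℝ (0 : Fin 1) (LinearMap.toContinuousLinearMap α)

variable {V : Type*} [AddCommGroup V] [Module ℝ V] [TopologicalSpace V]

theorem wedge_add_left {p q : ℕ} (α α' : V [⋀^Fin p]→L[ℝ] ℝ) (β : V [⋀^Fin q]→L[ℝ] ℝ) :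
    (α + α') ⋏ β = α ⋏ β + α' ⋏ β := by
  ext u
  simp [wedge_apply, add_mul, Finset.sum_add_distrib, mul_add]

theorem wedge_add_right {p q : ℕ} (α : V [⋀^Fin p]→L[ℝ] ℝ) (β β' : V [⋀^Fin q]→L[ℝ] ℝ) :
    α ⋏ (β + β') = α ⋏ β + α ⋏ β' := by
  ext u
  simp [wedge_apply, Finset.sum_add_distrib, mul_add]

theorem wedge_smul_left {p q : ℕ} (c : ℝ) (α : V [⋀^Fin p]→L[ℝ] ℝ) (β : V [⋀^Fin q]→L[ℝ] ℝ) :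
    (c • α) ⋏ β = c • (α ⋏ β) := by
  ext u
  simp only [wedge_apply, ContinuousAlternatingMap.smul_apply, smul_mul_assoc, Finset.smul_sum]
  refine Finset.sum_congr rfl fun σ _ => ?_
  rw [smul_comm _ c, smul_comm _ c]

theorem wedge_smul_right {p q : ℕ} (c : ℝ) (α : V [⋀^Fin p]→L[ℝ] ℝ) (β : V [⋀^Fin q]→L[ℝ] ℝ) :
    α ⋏ (c • β) = c • (α ⋏ β) := by
  ext u
  simp only [wedge_apply, ContinuousAlternatingMap.smul_apply, mul_smul_comm, Finset.smul_sum]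
  refine Finset.sum_congr rfl fun σ _ => ?_
  rw [smul_comm _ c, smul_comm _ c]

theorem contract_add {n : ℕ} (ξ η : V) (Ω : V [⋀^Fin (n + 1)]→L[ℝ] ℝ) :
    contract (ξ + η) Ω = contract ξ Ω + contract η Ω := by
  ext u
  exact Ω.toAlternatingMap.map_vecCons_add u ξ η

theorem contract_smul {n : ℕ} (c : ℝ) (ξ : V) (Ω : V [⋀^Fin (n + 1)]→L[ℝ] ℝ) :
    contract (c • ξ) Ω = c • contract ξ Ω := by
  ext u
  exact Ω.toAlternatingMap.map_vecCons_smul u c ξ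

variable [IsTopologicalAddGroup V] [ContinuousSMul ℝ V] [FiniteDimensional ℝ V] [T2Space V]

/-- The endomorphism `K_Ω` of the cotangent space determined by a `3`-form `Ω` and a volume form
`v` in six dimensions: `(K_Ω α)(ξ) = (α ∧ ι_ξ Ω ∧ Ω) / v`. -/
noncomputable def hitchinK (v : V [⋀^Fin 6]→L[ℝ] ℝ) (Ω : V [⋀^Fin 3]→L[ℝ] ℝ) :
    Module.Dual ℝ V →ₗ[ℝ] Module.Dual ℝ V where
  toFun α :=
    { toFun := fun ξ => topQuot (oneForm α ⋏ contract ξ Ω ⋏ Ω) v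
      map_add' := fun ξ η => by
        simp [contract_add, wedge_add_right, wedge_add_left, topQuot, add_div]
      map_smul' := fun c ξ => by
        simp [contract_smul, wedge_smul_right, wedge_smul_left, topQuot, mul_div_assoc] }
  map_add' α β := by
    have h : oneForm (α + β) = oneForm α + oneForm β := by ext; simp [oneForm]
    ext ξ
    simp [h, wedge_add_left, topQuot, add_div]
  map_smul' c α := by
    have h : oneForm (c • α) = c • oneForm α := by ext; simp [oneForm]
    ext ξ
    simp [h, wedge_smul_left, topQuot, mul_div_assoc]

/-- The invariant `λ(Ω) = (1/6) Tr(K_Ω²)`, relative to the volume form `v`. -/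
noncomputable def hitchinLambda (v : V [⋀^Fin 6]→L[ℝ] ℝ) (Ω : V [⋀^Fin 3]→L[ℝ] ℝ) : ℝ :=
  (1 / 6) * LinearMap.trace ℝ (Module.Dual ℝ V) (hitchinK v Ω ∘ₗ hitchinK v Ω)

/-- The `3`-form `Ω` is stable of negative type: `λ(Ω) < 0`. The sign of `λ(Ω)` does not depend on
the volume form. -/
def IsNegativeType (v : V [⋀^Fin 6]→L[ℝ] ℝ) (Ω : V [⋀^Fin 3]→L[ℝ] ℝ) : Prop :=
  hitchinLambda v Ω < 0

/-- The almost complex structure `J_Ω = K_Ω / √(-λ(Ω))` on covectors, for `Ω` of negative type.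
It depends on `v` only through the orientation. -/
noncomputable def hitchinJ (v : V [⋀^Fin 6]→L[ℝ] ℝ) (Ω : V [⋀^Fin 3]→L[ℝ] ℝ) :
    Module.Dual ℝ V →ₗ[ℝ] Module.Dual ℝ V :=
  (Real.sqrt (-hitchinLambda v Ω))⁻¹ • hitchinK v Ω

/-- The almost complex structure `J_Ω` on vectors: the transpose of `hitchinJ`, characterised by
`α (J_Ω ξ) = (J_Ω α) ξ`. -/
noncomputable def hitchinJVec (v : V [⋀^Fin 6]→L[ℝ] ℝ) (Ω : V [⋀^Fin 3]→L[ℝ] ℝ) : V →ₗ[ℝ] V :=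
  (Module.evalEquiv ℝ V).symm.toLinearMap ∘ₗ (hitchinJ v Ω).dualMap ∘ₗ
    (Module.evalEquiv ℝ V).toLinearMap

theorem apply_hitchinJVec (v : V [⋀^Fin 6]→L[ℝ] ℝ) (Ω : V [⋀^Fin 3]→L[ℝ] ℝ)
    (α : Module.Dual ℝ V) (ξ : V) : α (hitchinJVec v Ω ξ) = hitchinJ v Ω α ξ := by
  simp [hitchinJVec]

/-- The form `Ω̂ = - J_Ω(Ω)`, where `J_Ω` acts on all three indices of `Ω`. -/
noncomputable def hitchinHat (v : V [⋀^Fin 6]→L[ℝ] ℝ) (Ω : V [⋀^Fin 3]→L[ℝ] ℝ) :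
    V [⋀^Fin 3]→L[ℝ] ℝ :=
  -Ω.compContinuousLinearMap (LinearMap.toContinuousLinearMap (hitchinJVec v Ω))

end Pointwise

/-! ### Differential forms on manifolds -/

section Manifold

variable {E H N : Type*} [NormedAddCommGroup E] [NormedSpace ℝ E] [TopologicalSpace H]
  [TopologicalSpace N] [ChartedSpace H N] {E' H' N' : Type*} [NormedAddCommGroup E']
  [NormedSpace ℝ E'] [TopologicalSpace H'] [TopologicalSpace N'] [ChartedSpace H' N']

instance instT2SpaceTangentSpace (I : ModelWithCorners ℝ E H) (x : N) : T2Space (TangentSpace I x) :=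
  inferInstanceAs (T2Space E)

instance instFiniteDimensionalTangentSpace [FiniteDimensional ℝ E] (I : ModelWithCorners ℝ E H)
    (x : N) : FiniteDimensional ℝ (TangentSpace I x) :=
  inferInstanceAs (FiniteDimensional ℝ E)

/-- `F`-valued differential forms of degree `k` on the manifold `N` (no smoothness). -/
abbrev DiffForm (I : ModelWithCorners ℝ E H) (N : Type*) [TopologicalSpace N] [ChartedSpace H N]
    (k : ℕ) (F : Type*) [NormedAddCommGroup F] [NormedSpace ℝ F] : Type _ :=
  ∀ x : N, TangentSpace I x [⋀^Fin k]→L[ℝ] F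

variable {F : Type*} [NormedAddCommGroup F] [NormedSpace ℝ F] {k : ℕ}

/-- Pullback `φ^* α` of a differential form along a map of manifolds. -/
noncomputable def pullbackForm (I : ModelWithCorners ℝ E H) (I' : ModelWithCorners ℝ E' H')
    (φ : N → N') (α : DiffForm I' N' k F) : DiffForm I N k F :=
  fun x => (α (φ x)).compContinuousLinearMap (mfderiv I I' φ x)

/-- Coordinate expression of `α` in the preferred chart at `c`. -/
noncomputable def chartForm (I : ModelWithCorners ℝ E H) (α : DiffForm I N k F) (c : N) :
    E → E [⋀^Fin k]→L[ℝ] F :=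
  fun y => (pullbackForm 𝓘(ℝ, E) I (extChartAt I c).symm α y).compContinuousLinearMap
    (NormedSpace.fromTangentSpace (𝕜 := ℝ) y).symm.toContinuousLinearMap

/-- Smoothness of a differential form (on a manifold without boundary): its coordinate expressions
are smooth. -/
def IsSmoothForm (I : ModelWithCorners ℝ E H) (α : DiffForm I N k F) : Prop :=
  ∀ c : N, ContDiffOn ℝ ∞ (chartForm I α c) (extChartAt I c).target

/-- Exterior derivative `dα` of a differential form on a manifold without boundary, computed at `x`
in the preferred chart at `x`. -/
noncomputable def extD (I : ModelWithCorners ℝ E H) (α : DiffForm I N k F) :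
    DiffForm I N (k + 1) F :=
  fun x => pullbackForm I 𝓘(ℝ, E) (extChartAt I x)
    (fun y => (extDeriv (chartForm I α x) y).compContinuousLinearMap
      (NormedSpace.fromTangentSpace (𝕜 := ℝ) y).toContinuousLinearMap) x

end Manifold

/-! ### Matrix-valued forms -/

/-- Complex `2 × 2` matrices. -/
abbrev Mat2 : Type := Matrix (Fin 2) (Fin 2) ℂ

/-- The topology of the chosen operator norm (equal to the entrywise topology). -/
noncomputable instance (priority := 2000) instTopologicalSpaceMat2 : TopologicalSpace Mat2 :=
  PseudoMetricSpace.toUniformSpace.toTopologicalSpace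

/-- The real part of the trace, as a continuous real-linear functional. -/
noncomputable def reTr : Mat2 →L[ℝ] ℝ where
  toFun X := (Matrix.trace X).re
  map_add' X Y := by simp
  map_smul' c X := by simp
  cont := LinearMap.continuous_of_finiteDimensional
    (Complex.reLm ∘ₗ Matrix.traceLinearMap (Fin 2) ℝ ℂ)

/-- `Tr(α)` for a form built from products of `1`-forms with values in `su(2)`. All the traces taken
below are traces of products of three such forms, which are real. -/
noncomputable def trForm {V : Type*} [AddCommGroup V] [Module ℝ V] [TopologicalSpace V] {k : ℕ}
    (α : V [⋀^Fin k]→L[ℝ] Mat2) : V [⋀^Fin k]→L[ℝ] ℝ :=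
  reTr.compContinuousAlternatingMap α

section Gauge

variable {E H N : Type*} [NormedAddCommGroup E] [NormedSpace ℝ E] [TopologicalSpace H]
  [TopologicalSpace N] [ChartedSpace H N]

/-- The matrix-valued `1`-form `α` takes values in `su(2)`: traceless antihermitian matrices. -/
def IsSu2Valued (I : ModelWithCorners ℝ E H) (α : DiffForm I N 1 Mat2) : Prop :=
  ∀ (x : N) (ξ : TangentSpace I x), (α x ![ξ])ᴴ = -α x ![ξ] ∧ (α x ![ξ]).trace = 0

/-- Curvature `F(W) = dW + W ∧ W`. -/
noncomputable def curvature (I : ModelWithCorners ℝ E H) (W : DiffForm I N 1 Mat2) :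
    DiffForm I N 2 Mat2 :=
  fun x => extD I W x + W x ⋏ W x

/-- Covariant exterior derivative `∇_W E = dE + W ∧ E + E ∧ W` of a `1`-form. -/
noncomputable def covDeriv (I : ModelWithCorners ℝ E H) (W α : DiffForm I N 1 Mat2) :
    DiffForm I N 2 Mat2 :=
  fun x => extD I α x + W x ⋏ α x + α x ⋏ W x

end Gauge

/-- The volume form `-(2/3) Tr(e³)` of an `su(2)`-valued frame `e = ∑ eⁱ τ_i` in three dimensions,
equal to `e¹ ∧ e² ∧ e³`. -/
noncomputable def frameVolume {V : Type*} [AddCommGroup V] [Module ℝ V] [TopologicalSpace V]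
    (e : V [⋀^Fin 1]→L[ℝ] Mat2) : V [⋀^Fin 3]→L[ℝ] ℝ :=
  (-(2 / 3) : ℝ) • trForm (e ⋏ e ⋏ e)

/-! ### The group `SU(2)` and the bundle `M × SU(2)` -/

/-- The group manifold of `SU(2)`: the unit sphere in `ℝ⁴`. -/
abbrev S3 : Type := Metric.sphere (0 : EuclideanSpace ℝ (Fin 4)) 1

/-- The matrix with rows `(a, b)` and `(-b̄, ā)` for `a = q₀ + i q₁`, `b = q₂ + i q₃`. -/
def su2Matrix (q : EuclideanSpace ℝ (Fin 4)) : Mat2 :=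
  !![⟨q 0, q 1⟩, ⟨q 2, q 3⟩; ⟨-q 2, q 3⟩, ⟨q 0, -q 1⟩]

/-- The sphere parametrises `SU(2)` bijectively. -/
theorem su2Matrix_bijOn :
    Set.BijOn su2Matrix (Metric.sphere 0 1) (Matrix.specialUnitaryGroup (Fin 2) ℂ : Set Mat2) := by
  have key : ∀ q : EuclideanSpace ℝ (Fin 4),
      q ∈ Metric.sphere 0 1 ↔ q 0 ^ 2 + q 1 ^ 2 + q 2 ^ 2 + q 3 ^ 2 = 1 := by
    intro q
    rw [mem_sphere_zero_iff_norm, EuclideanSpace.norm_eq, Real.sqrt_eq_one]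
    simp [Fin.sum_univ_four]
  refine ⟨fun q hq => ?_, fun q _ q' _ h => ?_, fun X hX => ?_⟩
  · rw [key] at hq
    simp only [SetLike.mem_coe, Matrix.mem_specialUnitaryGroup_iff, Matrix.mem_unitaryGroup_iff]
    constructor
    · ext i j
      fin_cases i <;> fin_cases j <;>
        simp [su2Matrix, Matrix.mul_apply, Fin.sum_univ_two, Complex.ext_iff,
          Matrix.star_eq_conjTranspose] <;> constructor <;> linarith
    · simp [su2Matrix, Matrix.det_fin_two, Complex.ext_iff]
      constructor <;> linarith
  · have h0 := congrFun (congrFun h 0) 0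
    have h1 := congrFun (congrFun h 0) 1
    simp [su2Matrix] at h0 h1
    ext i
    fin_cases i
    · exact h0.1
    · exact h0.2
    · exact h1.1
    · exact h1.2
  · simp only [SetLike.mem_coe, Matrix.mem_specialUnitaryGroup_iff,
      Matrix.mem_unitaryGroup_iff'] at hX
    obtain ⟨hU, hd⟩ := hX
    have hadj : star X = X.adjugate := by
      have h1 : X * X.adjugate = 1 := by rw [Matrix.mul_adjugate, hd, one_smul]
      calc star X = star X * (X * X.adjugate) := by rw [h1, mul_one]
        _ = X.adjugate := by rw [← mul_assoc, hU, one_mul]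
    have h00 := congrFun (congrFun hadj 0) 0
    have h01 := congrFun (congrFun hadj 1) 0
    simp [Matrix.adjugate_fin_two, Complex.ext_iff] at h00 h01
    rw [Matrix.det_fin_two] at hd
    have hdr := congrArg Complex.re hd
    simp at hdr
    refine ⟨!₂[(X 0 0).re, (X 0 0).im, (X 0 1).re, (X 0 1).im], ?_, ?_⟩
    · rw [key]
      simp
      rw [← h00.1, ← h00.2, ← neg_eq_iff_eq_neg.mpr h01.1, ← h01.2] at hdr
      nlinarith
    · ext i j
      fin_cases i <;> fin_cases j <;> simp [su2Matrix, Complex.ext_iff] <;> constructor <;> linarith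

section Bundle

variable {M : Type*} [TopologicalSpace M] [ChartedSpace (EuclideanSpace ℝ (Fin 3)) M]

/-- The model of the six-dimensional total space `M × SU(2)`. -/
noncomputable abbrev bundleModel : ModelWithCorners ℝ
    (EuclideanSpace ℝ (Fin 3) × EuclideanSpace ℝ (Fin 3))
    (ModelProd (EuclideanSpace ℝ (Fin 3)) (EuclideanSpace ℝ (Fin 3))) :=
  (𝓡 3).prod (𝓡 3)

/-- The vertical subspace at `p`: the kernel of the differential of the projection to `M`. -/
noncomputable def verticalSpace (p : M × S3) : Submodule ℝ (TangentSpace bundleModel p) :=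
  LinearMap.ker (mfderiv bundleModel (𝓡 3) (Prod.fst : M × S3 → M) p).toLinearMap

/-- The Maurer-Cartan form `m = g⁻¹ dg` of the fibre; here `g⁻¹ = gᴴ`. -/
noncomputable def maurerCartan (M : Type*) [TopologicalSpace M]
    [ChartedSpace (EuclideanSpace ℝ (Fin 3)) M] : DiffForm bundleModel (M × S3) 1 Mat2 :=
  fun p => ContinuousAlternatingMap.ofSubsingleton ℝ (TangentSpace bundleModel p) Mat2 (0 : Fin 1)
    (ContinuousLinearMap.mul ℝ Mat2 (su2Matrix p.2)ᴴ ∘L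
      (NormedSpace.fromTangentSpace (𝕜 := ℝ) (su2Matrix p.2)).toContinuousLinearMap ∘L
      mfderiv bundleModel 𝓘(ℝ, Mat2) (fun q : M × S3 => su2Matrix q.2) p)

/-- The lift `g⁻¹ α g` to `M × SU(2)` of a matrix-valued form on `M`. -/
noncomputable def liftForm {k : ℕ} (α : DiffForm (𝓡 3) M k Mat2) :
    DiffForm bundleModel (M × S3) k Mat2 :=
  fun p => (ContinuousLinearMap.mul ℝ Mat2 (su2Matrix p.2)ᴴ ∘L
      (ContinuousLinearMap.mul ℝ Mat2).flip (su2Matrix p.2)).compContinuousAlternatingMap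
    (pullbackForm bundleModel (𝓡 3) (Prod.fst : M × S3 → M) α p)

/-- The connection `W = g⁻¹ w g + g⁻¹ dg` on `M × SU(2)` determined by `w` on `M`. -/
noncomputable def liftConnection (w : DiffForm (𝓡 3) M 1 Mat2) :
    DiffForm bundleModel (M × S3) 1 Mat2 :=
  fun p => liftForm w p + maurerCartan M p

/-- The function `(ω + db) / v_e` on `M`, for the `3`-form `ω = a`. -/
noncomputable def fieldStrength (e : DiffForm (𝓡 3) M 1 Mat2) (a : DiffForm (𝓡 3) M 3 ℝ)
    (b : DiffForm (𝓡 3) M 2 ℝ) (x : M) : ℝ :=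
  topQuot (a x + extD (𝓡 3) b x) (frameVolume (e x))

/-- The `3`-form `Ω = Tr(-W³/3 + E ∧ E ∧ W) - (2ρ/3) Tr(E³)` on `M × SU(2)`. -/
noncomputable def reducedForm (W E : DiffForm bundleModel (M × S3) 1 Mat2) (ρ : M → ℝ) :
    DiffForm bundleModel (M × S3) 3 ℝ :=
  fun p => trForm ((-(1 / 3) : ℝ) • (W p ⋏ W p ⋏ W p) + E p ⋏ E p ⋏ W p)
    - (2 * ρ p.1 / 3) • trForm (E p ⋏ E p ⋏ E p)

/-- The connection determined by an almost complex structure `J` on `M × SU(2)` is `W`: the `J`-image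
of the vertical space is a complement of the vertical space, it is the kernel of `W`, and `W`
reproduces the generators of the fibres. -/
def DeterminesConnection
    (J : ∀ p : M × S3, TangentSpace bundleModel p →ₗ[ℝ] TangentSpace bundleModel p)
    (W : DiffForm bundleModel (M × S3) 1 Mat2) : Prop :=
  ∀ p : M × S3, IsCompl (verticalSpace p) ((verticalSpace p).map (J p)) ∧
    (∀ ξ, W p ![ξ] = 0 ↔ ξ ∈ (verticalSpace p).map (J p)) ∧
    ∀ ξ ∈ verticalSpace p, W p ![ξ] = maurerCartan M p ![ξ]

/-- `E` is a frame for the metric determined by `J`: it vanishes on vertical vectors, `J` maps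
horizontal vectors (the `J`-images of the vertical ones) to vertical vectors, and
`(J ξ, J η)_{SU(2)} = -2 Tr(E(ξ) E(η))` for horizontal `ξ, η`, where the invariant metric on the
fibres is `-2 Tr(m ⊗ m)`. -/
def DeterminesFrame
    (J : ∀ p : M × S3, TangentSpace bundleModel p →ₗ[ℝ] TangentSpace bundleModel p)
    (E : DiffForm bundleModel (M × S3) 1 Mat2) : Prop :=
  ∀ p : M × S3, (∀ ξ ∈ verticalSpace p, E p ![ξ] = 0) ∧
    (∀ ξ ∈ (verticalSpace p).map (J p), J p ξ ∈ verticalSpace p) ∧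
    ∀ ξ ∈ (verticalSpace p).map (J p), ∀ η ∈ (verticalSpace p).map (J p),
      -2 * reTr (maurerCartan M p ![J p ξ] * maurerCartan M p ![J p η]) =
        -2 * reTr (E p ![ξ] * E p ![η])

end Bundle

/-! ### Wedge products of forms as explicit alternating sums. -/

section WedgeFormulas

variable {V A : Type*} [AddCommGroup V] [Module ℝ V] [TopologicalSpace V]
  [NormedRing A] [NormedAlgebra ℝ A]

/-! When |ρ| < 1, everything is governed by one complex form. Put s = √(1 - ρ²), ζ = ρ + i s
(`unitRoot`), κ = ζ̄ / s (`hatCoeff`) and A = W - ζ E. Expanding the cube of A, with Tr(X[Y,Z]) real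
on su(2), gives Ω = Im(κ Tr(A[A,A])) (`pointForm_eq_im`). The almost complex structure satisfies A ∘
J = iε A, where the sign ε = ±1 depends on the orientations, so Ω̂ = ε Re(κ Tr(A[A,A]))
(`hitchinHat_apply`).

To find J, the components x of W and y of E are used as coordinates. In them Ω is a combination of
four determinants built on linear factors p x + q y, and the products entering K become 6 × 6
determinants (`tripleAlt_cubes`). The outcome is that K is a nonzero multiple of the transpose of L
: (x, y) ↦ (y - ρ x, ρ y - x), and L² = ρ² - 1. This decides the sign of λ for every ρ. It also
shows that J exchanges W - ρ E and E up to factors (`IsAdapted`), which identifies the connection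
and the frame.

For the differential, dΩ̂ = ε Re(dκ ∧ Tr(A[A,A]) + κ Tr(F(A) ∧ [A,A])) up to combinatorial factors
(`extDeriv_cubic`). Since A is the lift of the connection w - ζ e, its curvature is the lift of a
form on M and kills vertical vectors. Three vertical arguments therefore isolate dρ. Once dρ = 0,
the equations f = e ∧ e and 1 + ζ² = 2ρζ give F(w - ζ e) = -ζ (∇e - 2ρ e ∧ e). As κζ = 1/s is real,
taking real parts loses nothing, and two vertical arguments isolate ∇e - 2ρ e ∧ e.

The remaining equivalences are linear algebra in the torsion T = ∇_J e and in D = dρ ∧ e, by F_J =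
(1 - ρ²) e ∧ e - ρ T - D and s ∇_J(s e) = (1 - ρ²) T - ρ D (`gravity_identities`). A frame in
dimension three turns D = 0 into dρ = 0. -/

theorem sum_perm_fin_two {B : Type*} [AddCommMonoid B] (f : Equiv.Perm (Fin 2) → B) :
    ∑ σ, f σ = f 1 + f (Equiv.swap 0 1) := by
  rw [show (Finset.univ : Finset (Equiv.Perm (Fin 2))) = {1, Equiv.swap 0 1} by decide]
  rw [Finset.sum_pair (by decide)]

theorem sum_perm_fin_three {B : Type*} [AddCommMonoid B] (f : Equiv.Perm (Fin 3) → B) :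
    ∑ σ, f σ = f 1 + (f (Equiv.swap 0 1) + (f (Equiv.swap 0 2) + (f (Equiv.swap 1 2) +
      (f (Equiv.swap 0 1 * Equiv.swap 1 2) + f (Equiv.swap 1 2 * Equiv.swap 0 1))))) := by
  rw [show (Finset.univ : Finset (Equiv.Perm (Fin 3))) =
    {1, Equiv.swap 0 1, Equiv.swap 0 2, Equiv.swap 1 2, Equiv.swap 0 1 * Equiv.swap 1 2,
      Equiv.swap 1 2 * Equiv.swap 0 1} by decide]
  rw [Finset.sum_insert (by decide), Finset.sum_insert (by decide), Finset.sum_insert (by decide),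
    Finset.sum_insert (by decide), Finset.sum_pair (by decide)]

theorem wedge_one_one_apply (α β : V [⋀^Fin 1]→L[ℝ] A) (u : Fin 2 → V) :
    (α ⋏ β) u = α ![u 0] * β ![u 1] - α ![u 1] * β ![u 0] := by
  have h1 : ∀ f : Fin 1 → Fin 2, (fun i => u (f i)) = ![u (f 0)] := fun f => by
    ext i; fin_cases i; rfl
  rw [wedge_apply, sum_perm_fin_two]
  simp only [Nat.reduceAdd, h1]
  have e0 : (Fin.castAdd 1 (0 : Fin 1)) = (0 : Fin 2) := rfl
  have e1 : (Fin.natAdd 1 (0 : Fin 1)) = (1 : Fin 2) := rfl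
  simp [e0, sub_eq_add_neg]

theorem wedge_one_one_one_apply (α β γ : V [⋀^Fin 1]→L[ℝ] A) (u : Fin 3 → V) :
    (α ⋏ β ⋏ γ) u =
      (α ![u 0] * β ![u 1] - α ![u 1] * β ![u 0]) * γ ![u 2] +
      (α ![u 1] * β ![u 2] - α ![u 2] * β ![u 1]) * γ ![u 0] +
      (α ![u 2] * β ![u 0] - α ![u 0] * β ![u 2]) * γ ![u 1] := by
  have h1 : ∀ f : Fin 1 → Fin 3, (fun i => u (f i)) = ![u (f 0)] := fun f => by
    ext i; fin_cases i; rfl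
  rw [wedge_apply, sum_perm_fin_three]
  simp only [Nat.reduceAdd, h1, wedge_one_one_apply]
  have e0 : (Fin.castAdd 1 (0 : Fin (1 + 1))) = (0 : Fin 3) := rfl
  have e1 : (Fin.castAdd 1 (1 : Fin (1 + 1))) = (1 : Fin 3) := rfl
  have e2 : (Fin.natAdd (1 + 1) (0 : Fin 1)) = (2 : Fin 3) := rfl
  have s1 : (Equiv.swap 1 2 : Equiv.Perm (Fin 3)) 0 = 0 := by decide
  have s2 : (Equiv.swap 0 1 : Equiv.Perm (Fin 3)) 2 = 2 := by decide
  have s3 : (Equiv.swap 0 2 : Equiv.Perm (Fin 3)) 1 = 1 := by decide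
  have s4 : Equiv.Perm.sign (Equiv.swap 0 1 : Equiv.Perm (Fin 3)) = -1 := by decide
  have s5 : Equiv.Perm.sign (Equiv.swap 0 2 : Equiv.Perm (Fin 3)) = -1 := by decide
  have s6 : Equiv.Perm.sign (Equiv.swap 1 2 : Equiv.Perm (Fin 3)) = -1 := by decide
  simp only [e0, e1, e2, Equiv.Perm.mul_apply, Equiv.Perm.one_apply, Equiv.swap_apply_left,
    Equiv.swap_apply_right, s1, s2, s3, map_mul, s4, s5, s6, map_one, mul_neg, mul_one, neg_neg,
    one_smul, Units.neg_smul]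
  simp only [Nat.factorial, sub_mul, neg_sub, Nat.cast_one, mul_one]
  module

/-- Double alternating sums collapse: the wedge product of three factors as a single sum. -/
theorem wedge_wedge_apply {p q r : ℕ} (α : V [⋀^Fin p]→L[ℝ] A) (β : V [⋀^Fin q]→L[ℝ] A)
    (γ : V [⋀^Fin r]→L[ℝ] A) (u : Fin (p + q + r) → V) :
    (α ⋏ β ⋏ γ) u = ((p.factorial * q.factorial * r.factorial : ℝ)⁻¹) •
      ∑ σ : Equiv.Perm (Fin (p + q + r)), Equiv.Perm.sign σ •
        (α (fun i => u (σ (Fin.castAdd r (Fin.castAdd q i)))) *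
          β (fun i => u (σ (Fin.castAdd r (Fin.natAdd p i)))) *
          γ (fun i => u (σ (Fin.natAdd (p + q) i)))) := by
  -- A permutation of the first `p + q` slots, extended by the identity. Right translation by `ext'
  -- τ` permutes the outer sum, so every `τ` contributes the same amount and their number `(p + q)!`
  -- cancels.
  let ext' : Equiv.Perm (Fin (p + q)) → Equiv.Perm (Fin (p + q + r)) := fun τ =>
    finSumFinEquiv.permCongr (Equiv.sumCongr τ (1 : Equiv.Perm (Fin r)))
  have hl : ∀ τ i, ext' τ (Fin.castAdd r i) = Fin.castAdd r (τ i) := fun τ i => by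
    simp [ext', Equiv.permCongr_apply]
  have hr : ∀ τ i, ext' τ (Fin.natAdd (p + q) i) = Fin.natAdd (p + q) i := fun τ i => by
    simp [ext', Equiv.permCongr_apply]
  have hs : ∀ τ, Equiv.Perm.sign (ext' τ) = Equiv.Perm.sign τ := fun τ => by
    simp [ext', Equiv.Perm.sign_permCongr]
  rw [wedge_apply]
  set g : Equiv.Perm (Fin (p + q + r)) → A := fun σ => Equiv.Perm.sign σ •
        (α (fun i => u (σ (Fin.castAdd r (Fin.castAdd q i)))) *
          β (fun i => u (σ (Fin.castAdd r (Fin.natAdd p i)))) *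
          γ (fun i => u (σ (Fin.natAdd (p + q) i)))) with hg
  have key : ∀ σ : Equiv.Perm (Fin (p + q + r)), Equiv.Perm.sign σ •
      ((α ⋏ β) (fun i => u (σ (Fin.castAdd r i))) * γ (fun i => u (σ (Fin.natAdd (p + q) i)))) =
      ((p.factorial * q.factorial : ℝ)⁻¹) • ∑ τ : Equiv.Perm (Fin (p + q)), g (σ * ext' τ) := by
    intro σ
    rw [wedge_apply, smul_mul_assoc, smul_comm, Finset.sum_mul, Finset.smul_sum]
    congr 1
    refine Finset.sum_congr rfl fun τ _ => ?_
    simp only [hg, Equiv.Perm.mul_apply, hl, hr, map_mul, hs, smul_mul_assoc, mul_smul]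
  simp_rw [key]
  rw [← Finset.smul_sum, Finset.sum_comm]
  have h2 : ∀ τ, ∑ σ, g (σ * ext' τ) = ∑ σ, g σ := fun τ =>
    Equiv.sum_comp (Equiv.mulRight (ext' τ)) g
  simp_rw [h2]
  rw [Finset.sum_const, Finset.card_univ, Fintype.card_perm, Fintype.card_fin,
    ← Nat.cast_smul_eq_nsmul ℝ, smul_smul, smul_smul]
  congr 1
  have := Nat.factorial_pos (p + q)
  field_simp

end WedgeFormulas

/-! ### The Lie algebra su(2) in coordinates. -/

section Su2

/-- Traceless antihermitian matrices. -/
def IsSu2 (X : Mat2) : Prop := Xᴴ = -X ∧ X.trace = 0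

/-- Components of a matrix in the basis `-i σ_k / 2` of `su(2)`. -/
def su2Coord : Mat2 →ₗ[ℝ] (Fin 3 → ℝ) where
  toFun X := ![-2 * (X 0 1).im, -2 * (X 0 1).re, -2 * (X 0 0).im]
  map_add' X Y := by ext i; fin_cases i <;> simp <;> ring
  map_smul' c X := by ext i; fin_cases i <;> simp <;> ring

/-- The inverse of `su2Coord`. -/
noncomputable def su2OfCoord (x : Fin 3 → ℝ) : Mat2 :=
  !![⟨0, -x 2 / 2⟩, ⟨-x 1 / 2, -x 0 / 2⟩; ⟨x 1 / 2, -x 0 / 2⟩, ⟨0, x 2 / 2⟩]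

theorem isSu2_su2OfCoord (x : Fin 3 → ℝ) : IsSu2 (su2OfCoord x) := by
  constructor
  · ext i j
    fin_cases i <;> fin_cases j <;> simp [su2OfCoord, Complex.ext_iff] <;> ring
  · simp [su2OfCoord, Matrix.trace_fin_two, Complex.ext_iff]; ring

theorem su2Coord_su2OfCoord (x : Fin 3 → ℝ) : su2Coord (su2OfCoord x) = x := by
  ext i
  fin_cases i <;> simp [su2OfCoord, su2Coord] <;> ring

theorem IsSu2.eq_su2OfCoord {X : Mat2} (h : IsSu2 X) : X = su2OfCoord (su2Coord X) := by
  obtain ⟨h1, h2⟩ := h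
  have h00 := congrFun (congrFun h1 0) 0
  have h01 := congrFun (congrFun h1 1) 0
  rw [Matrix.trace_fin_two] at h2
  simp [Complex.ext_iff] at h00 h01 h2
  ext i j
  fin_cases i <;> fin_cases j <;> simp [su2OfCoord, su2Coord, Complex.ext_iff] <;>
    (try constructor) <;> linarith

theorem IsSu2.eq_iff {X Y : Mat2} (hX : IsSu2 X) (hY : IsSu2 Y) :
    X = Y ↔ su2Coord X = su2Coord Y :=
  ⟨fun h => h ▸ rfl, fun h => by rw [hX.eq_su2OfCoord, hY.eq_su2OfCoord, h]⟩

theorem IsSu2.add {X Y : Mat2} (hX : IsSu2 X) (hY : IsSu2 Y) : IsSu2 (X + Y) := by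
  refine ⟨?_, by rw [Matrix.trace_add, hX.2, hY.2, add_zero]⟩
  rw [Matrix.conjTranspose_add, hX.1, hY.1]; abel

theorem IsSu2.smul {X : Mat2} (c : ℝ) (hX : IsSu2 X) : IsSu2 (c • X) := by
  refine ⟨?_, by rw [Matrix.trace_smul, hX.2, smul_zero]⟩
  rw [Matrix.conjTranspose_smul, hX.1]; simp

theorem IsSu2.sub {X Y : Mat2} (hX : IsSu2 X) (hY : IsSu2 Y) : IsSu2 (X - Y) := by
  rw [sub_eq_add_neg, ← neg_one_smul ℝ]
  exact hX.add (hY.smul _)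

theorem isSu2_zero : IsSu2 0 := ⟨by simp, by simp⟩

/-- The alternating trilinear form `Tr(X [Y, Z])`. -/
noncomputable def trBracket (X Y Z : Mat2) : ℂ := (X * (Y * Z - Z * Y)).trace

/-- In the basis `-i σ_k / 2` the bracket is the cross product and `Tr(X Y) = -½ x·y`, so the trace
is `-½` times a triple product. In particular it is real. -/
theorem trBracket_su2 {X Y Z : Mat2} (hX : IsSu2 X) (hY : IsSu2 Y) (hZ : IsSu2 Z) :
    trBracket X Y Z = ((-(1 / 2) *
      (Matrix.of ![su2Coord X, su2Coord Y, su2Coord Z]).det : ℝ) : ℂ) := by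
  rw [hX.eq_su2OfCoord, hY.eq_su2OfCoord, hZ.eq_su2OfCoord]
  simp only [su2Coord_su2OfCoord]
  generalize su2Coord X = x
  generalize su2Coord Y = y
  generalize su2Coord Z = z
  rw [Matrix.det_fin_three]
  simp [trBracket, Matrix.trace_fin_two, su2OfCoord, Complex.ext_iff]
  constructor <;> ring

end Su2

/-! ### Products `α ∧ ι_ξ θ³ ∧ η³` as 6 × 6 determinants. -/

section TripleWedge

variable {V : Type*}

/-- The determinant of six functions evaluated on six vectors. -/
noncomputable def det6 (r : Fin 6 → V → ℝ) (b : Fin 6 → V) : ℝ :=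
  (Matrix.of fun i j => r i (b j)).det

/-- The determinant of three functions evaluated on three vectors. -/
noncomputable def det3 (r : Fin 3 → V → ℝ) (b : Fin 3 → V) : ℝ :=
  (Matrix.of fun i j => r i (b j)).det

/-- Alternating sum over six vectors of a product of functions of one, two and three of them. -/
noncomputable def tripleAlt (α : V → ℝ) (β : V → V → ℝ) (γ : V → V → V → ℝ) (b : Fin 6 → V) : ℝ :=
  ∑ σ : Equiv.Perm (Fin 6), Equiv.Perm.sign σ •
    (α (b (σ 0)) * β (b (σ 1)) (b (σ 2)) * γ (b (σ 3)) (b (σ 4)) (b (σ 5)))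

theorem det6_eq_sum (r : Fin 6 → V → ℝ) (b : Fin 6 → V) :
    det6 r b = ∑ σ : Equiv.Perm (Fin 6), Equiv.Perm.sign σ • ∏ i, r i (b (σ i)) := by
  rw [det6, ← Matrix.det_transpose, Matrix.det_apply]
  rfl

theorem det6_swap (r : Fin 6 → V → ℝ) (b : Fin 6 → V) {i j : Fin 6} (hij : i ≠ j) :
    det6 (r ∘ Equiv.swap i j) b = -det6 r b := by
  have := Matrix.det_permute (Equiv.swap i j) (Matrix.of fun i j => r i (b j))
  rw [Equiv.Perm.sign_swap hij] at this
  rw [Units.val_neg, Units.val_one, Int.cast_neg, Int.cast_one, neg_one_mul] at this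
  exact this

theorem det6_linear_comb (C : Matrix (Fin 6) (Fin 6) ℝ) (r : Fin 6 → V → ℝ) (b : Fin 6 → V) :
    det6 (fun i ξ => ∑ k, C i k * r k ξ) b = C.det * det6 r b := by
  rw [det6, det6, ← Matrix.det_mul]
  rfl

/-- Contraction of `θ₀ ∧ θ₁ ∧ θ₂` with `ξ` is the cyclic sum of `θ₀(ξ) θ₁ ∧ θ₂`. The factor `12 = 2!
· 3!` counts the orderings inside the second and third factors. -/
theorem tripleAlt_det3 (α : V → ℝ) (θ η : Fin 3 → V → ℝ) (ξ : V) (b : Fin 6 → V) :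
    tripleAlt α (fun x y => det3 θ ![ξ, x, y]) (fun x y z => det3 η ![x, y, z]) b =
      12 * (θ 0 ξ * det6 ![α, θ 1, θ 2, η 0, η 1, η 2] b +
        θ 1 ξ * det6 ![α, θ 2, θ 0, η 0, η 1, η 2] b +
        θ 2 ξ * det6 ![α, θ 0, θ 1, η 0, η 1, η 2] b) := by
  have s12 : ∀ a p q r s t, det6 ![a, q, p, r, s, t] b = -det6 ![a, p, q, r, s, t] b := by
    intro a p q r s t
    rw [← det6_swap _ b (show (1 : Fin 6) ≠ 2 by decide)]
    congr 1; ext i; fin_cases i <;> rfl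
  have s34 : ∀ a p q r s t, det6 ![a, p, q, s, r, t] b = -det6 ![a, p, q, r, s, t] b := by
    intro a p q r s t
    rw [← det6_swap _ b (show (3 : Fin 6) ≠ 4 by decide)]
    congr 1; ext i; fin_cases i <;> rfl
  have s45 : ∀ a p q r s t, det6 ![a, p, q, r, t, s] b = -det6 ![a, p, q, r, s, t] b := by
    intro a p q r s t
    rw [← det6_swap _ b (show (4 : Fin 6) ≠ 5 by decide)]
    congr 1; ext i; fin_cases i <;> rfl
  have h1 : ∀ p q, det6 ![α, p, q, η 1, η 2, η 0] b = det6 ![α, p, q, η 0, η 1, η 2] b :=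
    fun p q => by rw [s45, s34, neg_neg]
  have h2 : ∀ p q, det6 ![α, p, q, η 2, η 0, η 1] b = det6 ![α, p, q, η 0, η 1, η 2] b :=
    fun p q => by rw [s34, s45, neg_neg]
  have h3 : ∀ p q, det6 ![α, p, q, η 2, η 1, η 0] b = -det6 ![α, p, q, η 0, η 1, η 2] b :=
    fun p q => by rw [s34, h1]
  set g : (Fin 6 → V → ℝ) → Equiv.Perm (Fin 6) → ℝ :=
    fun r σ => Equiv.Perm.sign σ • ∏ i, r i (b (σ i)) with hg
  have hsum : ∀ r, ∑ σ, g r σ = det6 r b := fun r => (det6_eq_sum r b).symm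
  -- The six terms of the 3 × 3 determinant give six determinants of size six, which agree up to the
  -- signs `s34`, `s45`, `h1`, `h2`, `h3`. This is the factor `6` in `key2`.
  have key : ∀ p q, ∀ σ : Equiv.Perm (Fin 6),
      Equiv.Perm.sign σ • (α (b (σ 0)) * (p (b (σ 1)) * q (b (σ 2))) *
        det3 η ![b (σ 3), b (σ 4), b (σ 5)]) =
      g ![α, p, q, η 0, η 1, η 2] σ - g ![α, p, q, η 0, η 2, η 1] σ
        - g ![α, p, q, η 1, η 0, η 2] σ + g ![α, p, q, η 2, η 0, η 1] σ
        + g ![α, p, q, η 1, η 2, η 0] σ - g ![α, p, q, η 2, η 1, η 0] σ := by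
    intro p q σ
    simp only [hg, det3, Matrix.det_fin_three, Fin.prod_univ_six, ← smul_sub, ← smul_add]
    congr 1
    simp
    ring
  have key2 : ∀ p q, ∑ σ : Equiv.Perm (Fin 6),
      Equiv.Perm.sign σ • (α (b (σ 0)) * (p (b (σ 1)) * q (b (σ 2))) *
        det3 η ![b (σ 3), b (σ 4), b (σ 5)]) = 6 * det6 ![α, p, q, η 0, η 1, η 2] b := by
    intro p q
    simp only [key, Finset.sum_add_distrib, Finset.sum_sub_distrib, hsum]
    rw [s45 α p q (η 0) (η 1) (η 2), s34 α p q (η 0) (η 1) (η 2), h1, h2, h3]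
    ring
  have expand : ∀ σ : Equiv.Perm (Fin 6), Equiv.Perm.sign σ •
      (α (b (σ 0)) * det3 θ ![ξ, b (σ 1), b (σ 2)] * det3 η ![b (σ 3), b (σ 4), b (σ 5)]) =
      θ 0 ξ * (Equiv.Perm.sign σ • (α (b (σ 0)) * (θ 1 (b (σ 1)) * θ 2 (b (σ 2))) *
        det3 η ![b (σ 3), b (σ 4), b (σ 5)])) -
      θ 0 ξ * (Equiv.Perm.sign σ • (α (b (σ 0)) * (θ 2 (b (σ 1)) * θ 1 (b (σ 2))) *
        det3 η ![b (σ 3), b (σ 4), b (σ 5)])) +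
      θ 1 ξ * (Equiv.Perm.sign σ • (α (b (σ 0)) * (θ 2 (b (σ 1)) * θ 0 (b (σ 2))) *
        det3 η ![b (σ 3), b (σ 4), b (σ 5)])) -
      θ 1 ξ * (Equiv.Perm.sign σ • (α (b (σ 0)) * (θ 0 (b (σ 1)) * θ 2 (b (σ 2))) *
        det3 η ![b (σ 3), b (σ 4), b (σ 5)])) +
      θ 2 ξ * (Equiv.Perm.sign σ • (α (b (σ 0)) * (θ 0 (b (σ 1)) * θ 1 (b (σ 2))) *
        det3 η ![b (σ 3), b (σ 4), b (σ 5)])) -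
      θ 2 ξ * (Equiv.Perm.sign σ • (α (b (σ 0)) * (θ 1 (b (σ 1)) * θ 0 (b (σ 2))) *
        det3 η ![b (σ 3), b (σ 4), b (σ 5)])) := by
    intro σ
    generalize det3 η ![b (σ 3), b (σ 4), b (σ 5)] = d
    simp only [mul_smul_comm, ← smul_sub, ← smul_add]
    congr 1
    simp [det3, Matrix.det_fin_three]
    ring
  simp only [tripleAlt, expand, Finset.sum_add_distrib, Finset.sum_sub_distrib, ← Finset.mul_sum,
    key2]
  rw [s12 α (θ 1) (θ 2), s12 α (θ 2) (θ 0), s12 α (θ 0) (θ 1)]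
  ring

/-- Below the first row, columns `k` and `k + 3` mix only with each other. After reordering, the
matrix is block triangular with 2 × 2 blocks: two have determinant `p t - q s`, the third contains
the row `a`. -/
theorem det_cubes_zero (a : Fin 6 → ℝ) (p q s t : ℝ) :
    (!![a 0, a 1, a 2, a 3, a 4, a 5; 0, p, 0, 0, q, 0; 0, 0, p, 0, 0, q;
      s, 0, 0, t, 0, 0; 0, s, 0, 0, t, 0; 0, 0, s, 0, 0, t] : Matrix (Fin 6) (Fin 6) ℝ).det =
      (p * t - q * s) ^ 2 * (a 0 * t - a 3 * s) := by
  generalize a 0 = a0, a 1 = a1, a 2 = a2, a 3 = a3, a 4 = a4, a 5 = a5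
  simp [Matrix.det_succ_row_zero, Fin.sum_univ_succ, Fin.succAbove]
  ring

theorem det_cubes_one (a : Fin 6 → ℝ) (p q s t : ℝ) :
    (!![a 0, a 1, a 2, a 3, a 4, a 5; 0, 0, p, 0, 0, q; p, 0, 0, q, 0, 0;
      s, 0, 0, t, 0, 0; 0, s, 0, 0, t, 0; 0, 0, s, 0, 0, t] : Matrix (Fin 6) (Fin 6) ℝ).det =
      (p * t - q * s) ^ 2 * (a 1 * t - a 4 * s) := by
  generalize a 0 = a0, a 1 = a1, a 2 = a2, a 3 = a3, a 4 = a4, a 5 = a5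
  simp [Matrix.det_succ_row_zero, Fin.sum_univ_succ, Fin.succAbove]
  ring

theorem det_cubes_two (a : Fin 6 → ℝ) (p q s t : ℝ) :
    (!![a 0, a 1, a 2, a 3, a 4, a 5; p, 0, 0, q, 0, 0; 0, p, 0, 0, q, 0;
      s, 0, 0, t, 0, 0; 0, s, 0, 0, t, 0; 0, 0, s, 0, 0, t] : Matrix (Fin 6) (Fin 6) ℝ).det =
      (p * t - q * s) ^ 2 * (a 2 * t - a 5 * s) := by
  generalize a 0 = a0, a 1 = a1, a 2 = a2, a 3 = a3, a 4 = a4, a 5 = a5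
  simp [Matrix.det_succ_row_zero, Fin.sum_univ_succ, Fin.succAbove]
  ring

/-- The factor `(p t - q s)²` vanishes when the two linear factors are proportional, so only pairs
of different cubes contribute to K. -/
theorem tripleAlt_cubes (r : Fin 6 → V → ℝ) (a : Fin 6 → ℝ) (p q s t : ℝ) (ξ : V)
    (b : Fin 6 → V) :
    tripleAlt (fun x => ∑ k, a k * r k x)
      (fun x y => det3 (fun (i : Fin 3) z => p * r (Fin.castAdd 3 i) z + q * r (Fin.natAdd 3 i) z)
        ![ξ, x, y])
      (fun x y z => det3 (fun (i : Fin 3) z => s * r (Fin.castAdd 3 i) z + t * r (Fin.natAdd 3 i) z)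
        ![x, y, z]) b =
      12 * (p * t - q * s) ^ 2 * ((p * r 0 ξ + q * r 3 ξ) * (a 0 * t - a 3 * s) +
        (p * r 1 ξ + q * r 4 ξ) * (a 1 * t - a 4 * s) +
        (p * r 2 ξ + q * r 5 ξ) * (a 2 * t - a 5 * s)) * det6 r b := by
  rw [tripleAlt_det3]
  have h0 := det6_linear_comb !![a 0, a 1, a 2, a 3, a 4, a 5; 0, p, 0, 0, q, 0; 0, 0, p, 0, 0, q;
    s, 0, 0, t, 0, 0; 0, s, 0, 0, t, 0; 0, 0, s, 0, 0, t] r b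
  have h1 := det6_linear_comb !![a 0, a 1, a 2, a 3, a 4, a 5; 0, 0, p, 0, 0, q; p, 0, 0, q, 0, 0;
    s, 0, 0, t, 0, 0; 0, s, 0, 0, t, 0; 0, 0, s, 0, 0, t] r b
  have h2 := det6_linear_comb !![a 0, a 1, a 2, a 3, a 4, a 5; p, 0, 0, q, 0, 0; 0, p, 0, 0, q, 0;
    s, 0, 0, t, 0, 0; 0, s, 0, 0, t, 0; 0, 0, s, 0, 0, t] r b
  rw [det_cubes_zero] at h0
  rw [det_cubes_one] at h1
  rw [det_cubes_two] at h2
  have e0 : ∀ f g : Fin 6 → V → ℝ, (∀ i ξ, f i ξ = g i ξ) → det6 f b = det6 g b := fun f g h => by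
    rw [show f = g from funext fun i => funext (h i)]
  rw [e0 ![_, _, _, _, _, _] _ fun i ξ => ?_, h0, e0 ![_, _, _, _, _, _] _ fun i ξ => ?_, h1,
    e0 ![_, _, _, _, _, _] _ fun i ξ => ?_, h2]
  · have f0 : Fin.castAdd 3 (0 : Fin 3) = (0 : Fin 6) := rfl
    have f1 : Fin.castAdd 3 (1 : Fin 3) = (1 : Fin 6) := rfl
    have f2 : Fin.castAdd 3 (2 : Fin 3) = (2 : Fin 6) := rfl
    have f3 : Fin.natAdd 3 (0 : Fin 3) = (3 : Fin 6) := rfl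
    have f4 : Fin.natAdd 3 (1 : Fin 3) = (4 : Fin 6) := rfl
    have f5 : Fin.natAdd 3 (2 : Fin 3) = (5 : Fin 6) := rfl
    rw [f0, f1, f2, f3, f4, f5]
    ring
  all_goals fin_cases i <;> simp [Fin.sum_univ_six]

end TripleWedge

/-! ### Coframes with values in su(2) ⊕ su(2), and the form Ω in their coordinates. -/

section Coframe

variable {V : Type*} [AddCommGroup V] [Module ℝ V] [TopologicalSpace V]

/-- The `3`-form `Tr(-W³/3 + E ∧ E ∧ W) - (2r/3) Tr(E³)` at a point. -/
noncomputable def pointForm (W E : V [⋀^Fin 1]→L[ℝ] Mat2) (r : ℝ) : V [⋀^Fin 3]→L[ℝ] ℝ :=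
  trForm ((-(1 / 3) : ℝ) • (W ⋏ W ⋏ W) + E ⋏ E ⋏ W) - (2 * r / 3) • trForm (E ⋏ E ⋏ E)

/-- Two `su(2)`-valued `1`-forms whose components are a basis of the dual of a six-dimensional
space. -/
structure IsCoframe (W E : V [⋀^Fin 1]→L[ℝ] Mat2) : Prop where
  su2_left : ∀ ξ, IsSu2 (W ![ξ])
  su2_right : ∀ ξ, IsSu2 (E ![ξ])
  eq_zero : ∀ ξ, W ![ξ] = 0 → E ![ξ] = 0 → ξ = 0
  finrank_eq : Module.finrank ℝ V = 6

theorem oneForm_map_add {A : Type*} [NormedAddCommGroup A] [NormedSpace ℝ A]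
    (α : V [⋀^Fin 1]→L[ℝ] A) (ξ η : V) : α ![ξ + η] = α ![ξ] + α ![η] := by
  exact α.toAlternatingMap.map_vecCons_add ![] ξ η

theorem oneForm_map_smul {A : Type*} [NormedAddCommGroup A] [NormedSpace ℝ A]
    (α : V [⋀^Fin 1]→L[ℝ] A) (c : ℝ) (ξ : V) : α ![c • ξ] = c • α ![ξ] := by
  exact α.toAlternatingMap.map_vecCons_smul ![] c ξ

/-- A `1`-form as a linear map. -/
def oneFormLin {A : Type*} [NormedAddCommGroup A] [NormedSpace ℝ A]
    (α : V [⋀^Fin 1]→L[ℝ] A) : V →ₗ[ℝ] A where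
  toFun ξ := α ![ξ]
  map_add' := oneForm_map_add α
  map_smul' := oneForm_map_smul α

/-- The six components of a pair of `su(2)`-valued `1`-forms. -/
noncomputable def coframeCoord (W E : V [⋀^Fin 1]→L[ℝ] Mat2) : V →ₗ[ℝ] (Fin 6 → ℝ) where
  toFun ξ := Fin.append (m := 3) (n := 3) (su2Coord (W ![ξ])) (su2Coord (E ![ξ]))
  map_add' ξ η := by
    ext i
    refine Fin.addCases (m := 3) (n := 3) (fun i => ?_) (fun i => ?_) i <;>
      simp only [Pi.add_apply, Fin.append_left, Fin.append_right, oneForm_map_add, map_add]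
  map_smul' c ξ := by
    ext i
    refine Fin.addCases (m := 3) (n := 3) (fun i => ?_) (fun i => ?_) i <;>
      simp only [Pi.smul_apply, Fin.append_left, Fin.append_right, oneForm_map_smul, map_smul,
        RingHom.id_apply]

theorem coframeCoord_castAdd (W E : V [⋀^Fin 1]→L[ℝ] Mat2) (ξ : V) (i : Fin 3) :
    coframeCoord W E ξ (Fin.castAdd 3 i) = su2Coord (W ![ξ]) i :=
  Fin.append_left _ _ i

theorem coframeCoord_natAdd (W E : V [⋀^Fin 1]→L[ℝ] Mat2) (ξ : V) (i : Fin 3) :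
    coframeCoord W E ξ (Fin.natAdd 3 i) = su2Coord (E ![ξ]) i :=
  Fin.append_right _ _ i

theorem trBracket_alternating_sum (X Y Z : Mat2) :
    ((X * Y - Y * X) * Z + (Y * Z - Z * Y) * X + (Z * X - X * Z) * Y).trace =
      3 * trBracket X Y Z := by
  simp [trBracket, Matrix.trace_fin_two, Matrix.mul_apply, Fin.sum_univ_two]
  ring

theorem trForm_cube_apply (A : V [⋀^Fin 1]→L[ℝ] Mat2) (u : Fin 3 → V) :
    trForm (A ⋏ A ⋏ A) u = 3 * (trBracket (A ![u 0]) (A ![u 1]) (A ![u 2])).re := by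
  have : trForm (A ⋏ A ⋏ A) u = ((A ⋏ A ⋏ A) u).trace.re := rfl
  rw [this, wedge_one_one_one_apply, trBracket_alternating_sum]
  simp

theorem trForm_sq_mul_apply (E W : V [⋀^Fin 1]→L[ℝ] Mat2) (u : Fin 3 → V) :
    trForm (E ⋏ E ⋏ W) u = (trBracket (E ![u 0]) (E ![u 1]) (W ![u 2])).re +
      (trBracket (E ![u 0]) (W ![u 1]) (E ![u 2])).re +
      (trBracket (W ![u 0]) (E ![u 1]) (E ![u 2])).re := by
  have : trForm (E ⋏ E ⋏ W) u = ((E ⋏ E ⋏ W) u).trace.re := rfl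
  rw [this, wedge_one_one_one_apply, ← Complex.add_re, ← Complex.add_re]
  congr 1
  simp [trBracket, Matrix.trace_fin_two, Matrix.mul_apply, Fin.sum_univ_two]
  ring

theorem pointForm_apply (W E : V [⋀^Fin 1]→L[ℝ] Mat2) (r : ℝ) (u : Fin 3 → V) :
    pointForm W E r u = -(trBracket (W ![u 0]) (W ![u 1]) (W ![u 2])).re +
      ((trBracket (E ![u 0]) (E ![u 1]) (W ![u 2])).re +
      (trBracket (E ![u 0]) (W ![u 1]) (E ![u 2])).re +
      (trBracket (W ![u 0]) (E ![u 1]) (E ![u 2])).re) -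
      2 * r * (trBracket (E ![u 0]) (E ![u 1]) (E ![u 2])).re := by
  have : pointForm W E r u = -(1 / 3) * trForm (W ⋏ W ⋏ W) u + trForm (E ⋏ E ⋏ W) u
      - (2 * r / 3) * trForm (E ⋏ E ⋏ E) u := by
    simp [pointForm, trForm]
  rw [this, trForm_cube_apply, trForm_cube_apply, trForm_sq_mul_apply]
  ring

/-- The coefficients in the decomposition of the `3`-form into cubes. -/
noncomputable def cubeCoeff (r : ℝ) : Fin 4 → ℝ := ![1, -(1 / 4), -(1 / 4), r]

/-- The linear factors `p x + q y` of the cubes. -/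
def cubeLeft : Fin 4 → ℝ := ![1, 1, 1, 0]

/-- The linear factors `p x + q y` of the cubes. -/
def cubeRight : Fin 4 → ℝ := ![0, 1, -1, 1]

/-- By `trBracket_su2`, Ω is `½ det x - ½ (mixed terms linear in x and quadratic in y) + r det y`.
The sum `det(x + y) + det(x - y)` is twice `det x` plus twice these mixed terms, which explains the
coefficients `-1/4`. Only determinants of linear factors are left, as `tripleAlt_cubes` requires. -/
theorem pointForm_eq_sum_cubes {W E : V [⋀^Fin 1]→L[ℝ] Mat2} (hWE : IsCoframe W E) (r : ℝ)
    (u : Fin 3 → V) :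
    pointForm W E r u = ∑ a, cubeCoeff r a *
      det3 (fun (i : Fin 3) z => cubeLeft a * coframeCoord W E z (Fin.castAdd 3 i) +
        cubeRight a * coframeCoord W E z (Fin.natAdd 3 i)) u := by
  rw [pointForm_apply]
  simp only [trBracket_su2, hWE.su2_left, hWE.su2_right, Complex.ofReal_re, coframeCoord_castAdd,
    coframeCoord_natAdd, det3, Matrix.det_fin_three]
  simp [Fin.sum_univ_four, cubeCoeff, cubeLeft, cubeRight]
  ring

namespace IsCoframe

variable {W E : V [⋀^Fin 1]→L[ℝ] Mat2}

theorem coord_injective (hWE : IsCoframe W E) : Function.Injective (coframeCoord W E) := by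
  rw [injective_iff_map_eq_zero]
  intro ξ h
  apply hWE.eq_zero
  · rw [(hWE.su2_left ξ).eq_iff isSu2_zero, map_zero]
    ext i
    rw [← coframeCoord_castAdd W E, h]; rfl
  · rw [(hWE.su2_right ξ).eq_iff isSu2_zero, map_zero]
    ext i
    rw [← coframeCoord_natAdd W E, h]; rfl

theorem ext (hWE : IsCoframe W E) {ξ η : V} (h1 : W ![ξ] = W ![η]) (h2 : E ![ξ] = E ![η]) :
    ξ = η := by
  apply hWE.coord_injective
  ext i
  refine Fin.addCases (m := 3) (n := 3) (fun i => ?_) (fun i => ?_) i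
  · rw [coframeCoord_castAdd, coframeCoord_castAdd, h1]
  · rw [coframeCoord_natAdd, coframeCoord_natAdd, h2]

/-- The linear coordinates given by a coframe. -/
noncomputable def equiv (hWE : IsCoframe W E) : V ≃ₗ[ℝ] (Fin 6 → ℝ) :=
  LinearEquiv.ofInjectiveOfFinrankEq (coframeCoord W E) hWE.coord_injective
    (by simp [hWE.finrank_eq])

theorem equiv_apply (hWE : IsCoframe W E) (ξ : V) : hWE.equiv ξ = coframeCoord W E ξ := rfl

/-- The basis dual to a coframe. -/
noncomputable def basis (hWE : IsCoframe W E) : Module.Basis (Fin 6) ℝ V :=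
  Module.Basis.ofEquivFun hWE.equiv

theorem basis_det (hWE : IsCoframe W E) (b : Fin 6 → V) :
    hWE.basis.det b = det6 (fun i ξ => coframeCoord W E ξ i) b := by
  rw [Module.Basis.det_apply, det6]
  congr 1

theorem exists_apply_eq (hWE : IsCoframe W E) {X Y : Mat2} (hX : IsSu2 X) (hY : IsSu2 Y) :
    ∃ ξ, W ![ξ] = X ∧ E ![ξ] = Y := by
  refine ⟨hWE.equiv.symm (Fin.append (m := 3) (n := 3) (su2Coord X) (su2Coord Y)), ?_, ?_⟩
  · rw [(hWE.su2_left _).eq_iff hX]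
    ext i
    rw [← coframeCoord_castAdd W E, ← hWE.equiv_apply, LinearEquiv.apply_symm_apply]
    exact Fin.append_left _ _ i
  · rw [(hWE.su2_right _).eq_iff hY]
    ext i
    rw [← coframeCoord_natAdd W E, ← hWE.equiv_apply, LinearEquiv.apply_symm_apply]
    exact Fin.append_right _ _ i

theorem top_form_apply (hWE : IsCoframe W E) (v : V [⋀^Fin 6]→L[ℝ] ℝ) (b : Fin 6 → V) :
    v b = v hWE.basis * det6 (fun i ξ => coframeCoord W E ξ i) b := by
  have := congrArg (fun f => f b) (v.toAlternatingMap.eq_smul_basis_det hWE.basis)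
  rw [← hWE.basis_det]
  exact this

/-- This endomorphism squares to `r² - 1`. `exists_hitchinK_eq` shows that its transpose is K up to
a scalar. -/
theorem exists_endomorphism (hWE : IsCoframe W E) (r : ℝ) : ∃ L : V →ₗ[ℝ] V,
    ∀ ξ, W ![L ξ] = E ![ξ] - r • W ![ξ] ∧ E ![L ξ] = r • E ![ξ] - W ![ξ] := by
  choose L hL using fun ξ => hWE.exists_apply_eq
    ((hWE.su2_right ξ).sub ((hWE.su2_left ξ).smul r))
    (((hWE.su2_right ξ).smul r).sub (hWE.su2_left ξ))
  refine ⟨⟨⟨L, fun ξ η => hWE.ext ?_ ?_⟩, fun c ξ => hWE.ext ?_ ?_⟩, hL⟩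
  · rw [oneForm_map_add, (hL _).1, (hL _).1, (hL _).1, oneForm_map_add, oneForm_map_add]; module
  · rw [oneForm_map_add, (hL _).2, (hL _).2, (hL _).2, oneForm_map_add, oneForm_map_add]; module
  · simp only [RingHom.id_apply]
    rw [oneForm_map_smul, (hL _).1, (hL _).1, oneForm_map_smul, oneForm_map_smul]; module
  · simp only [RingHom.id_apply]
    rw [oneForm_map_smul, (hL _).2, (hL _).2, oneForm_map_smul, oneForm_map_smul]; module

end IsCoframe

/-- The factor by which `hitchinK` differs from the transpose of the endomorphism
`(x, y) ↦ (y - r x, r y - x)`; its sign compares the orientation of the coframe with that of `v`. -/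
noncomputable def coframeRatio (v : V [⋀^Fin 6]→L[ℝ] ℝ) (W E : V [⋀^Fin 1]→L[ℝ] Mat2)
    (b : Fin 6 → V) : ℝ :=
  -(1 / 2) * (det6 (fun i ξ => coframeCoord W E ξ i) b / v b)

/-- Top forms are proportional, so the ratio does not depend on the tuple `b`. On the dual basis of
the coframe the determinant is 1. -/
theorem IsCoframe.coframeRatio_eq {W E : V [⋀^Fin 1]→L[ℝ] Mat2} (hWE : IsCoframe W E)
    (v : V [⋀^Fin 6]→L[ℝ] ℝ) {b : Fin 6 → V} (hb : v b ≠ 0) :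
    coframeRatio v W E b = -(1 / 2) * (v hWE.basis)⁻¹ ∧ v hWE.basis ≠ 0 := by
  have h := hWE.top_form_apply v b
  have h1 : v hWE.basis ≠ 0 := fun h0 => hb (by rw [h, h0, zero_mul])
  refine ⟨?_, h1⟩
  have h2 : det6 (fun i ξ => coframeCoord W E ξ i) b ≠ 0 := fun h0 => hb (by rw [h, h0, mul_zero])
  rw [coframeRatio, h]
  field_simp

theorem exists_apply_ne_zero {v : V [⋀^Fin 6]→L[ℝ] ℝ} (hv : v ≠ 0) : ∃ b, v b ≠ 0 := by
  by_contra! h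
  exact hv (ContinuousAlternatingMap.ext h)

theorem IsCoframe.coframeRatio_ne_zero {W E : V [⋀^Fin 1]→L[ℝ] Mat2} (hWE : IsCoframe W E)
    {v : V [⋀^Fin 6]→L[ℝ] ℝ} {b : Fin 6 → V} (hb : v b ≠ 0) : coframeRatio v W E b ≠ 0 := by
  obtain ⟨h1, h2⟩ := hWE.coframeRatio_eq v hb
  rw [h1]
  exact mul_ne_zero (by norm_num) (inv_ne_zero h2)

end Coframe

/-! ### Computation of K. -/

section HitchinEndomorphism

variable {V : Type*} [AddCommGroup V] [Module ℝ V] [TopologicalSpace V]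
  [IsTopologicalAddGroup V] [ContinuousSMul ℝ V] [FiniteDimensional ℝ V] [T2Space V]

theorem oneForm_wedge_contract_wedge_apply (α : Module.Dual ℝ V) (ξ : V) (Ω : V [⋀^Fin 3]→L[ℝ] ℝ)
    (b : Fin 6 → V) :
    (oneForm α ⋏ contract ξ Ω ⋏ Ω) b = (1 / 12) *
      tripleAlt (fun x => α x) (fun x y => Ω ![ξ, x, y]) (fun x y z => Ω ![x, y, z]) b := by
  rw [wedge_wedge_apply, tripleAlt]
  congr 1
  · simp [Nat.factorial]; norm_num
  · refine Finset.sum_congr rfl fun σ _ => ?_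
    congr 1
    congr 1
    · congr 1
      rw [contract_apply]
      congr 1
      ext i; fin_cases i <;> rfl
    · congr 1
      ext i; fin_cases i <;> rfl

theorem tripleAlt_sum {U : Type*} {ι : Type*} [Fintype ι] (α : U → ℝ) (c : ι → ℝ)
    (β : ι → U → U → ℝ) (γ : ι → U → U → U → ℝ) (b : Fin 6 → U) :
    tripleAlt α (fun x y => ∑ i, c i * β i x y) (fun x y z => ∑ j, c j * γ j x y z) b =
      ∑ i, ∑ j, c i * c j * tripleAlt α (β i) (γ j) b := by
  have h : ∀ σ : Equiv.Perm (Fin 6), Equiv.Perm.sign σ • (α (b (σ 0)) *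
      (∑ i, c i * β i (b (σ 1)) (b (σ 2))) * ∑ j, c j * γ j (b (σ 3)) (b (σ 4)) (b (σ 5))) =
      ∑ i, ∑ j, c i * c j * (Equiv.Perm.sign σ • (α (b (σ 0)) * β i (b (σ 1)) (b (σ 2)) *
        γ j (b (σ 3)) (b (σ 4)) (b (σ 5)))) := by
    intro σ
    rw [Finset.mul_sum (a := α (b (σ 0))), Finset.sum_mul_sum, Finset.smul_sum]
    refine Finset.sum_congr rfl fun i _ => ?_
    rw [Finset.smul_sum]
    refine Finset.sum_congr rfl fun j _ => ?_
    rw [mul_smul_comm]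
    congr 1
    ring
  simp only [tripleAlt, h]
  rw [Finset.sum_comm]
  refine Finset.sum_congr rfl fun i _ => ?_
  rw [Finset.sum_comm]
  simp only [Finset.mul_sum]

/-- Each copy of Ω is a sum of four cubes, so sixteen instances of `tripleAlt_cubes` occur. Their
sum is the pairing of `α` with the vector of coordinates `(y - r x, r y - x)`. -/
theorem IsCoframe.wedge_apply {W E : V [⋀^Fin 1]→L[ℝ] Mat2} (hWE : IsCoframe W E) (r : ℝ)
    (α : Module.Dual ℝ V) (ξ : V) (b : Fin 6 → V) :
    (oneForm α ⋏ contract ξ (pointForm W E r) ⋏ pointForm W E r) b =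
      -(1 / 2) * det6 (fun i ξ => coframeCoord W E ξ i) b *
        ∑ k : Fin 3, (α (hWE.basis (Fin.castAdd 3 k)) *
            (su2Coord (E ![ξ]) k - r * su2Coord (W ![ξ]) k) +
          α (hWE.basis (Fin.natAdd 3 k)) *
            (r * su2Coord (E ![ξ]) k - su2Coord (W ![ξ]) k)) := by
  have hα : (fun x => α x) = fun x => ∑ k, α (hWE.basis k) * (coframeCoord W E x k) := by
    ext x
    conv_lhs => rw [← hWE.basis.sum_repr x, map_sum]
    refine Finset.sum_congr rfl fun k _ => ?_
    rw [map_smul, smul_eq_mul, mul_comm]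
    rfl
  rw [oneForm_wedge_contract_wedge_apply, hα]
  simp only [pointForm_eq_sum_cubes hWE]
  rw [tripleAlt_sum]
  simp only [tripleAlt_cubes (fun i ξ => coframeCoord W E ξ i)]
  simp only [Fin.sum_univ_four, Fin.sum_univ_three, ← coframeCoord_castAdd W E,
    ← coframeCoord_natAdd W E]
  have f0 : Fin.castAdd 3 (0 : Fin 3) = (0 : Fin 6) := rfl
  have f1 : Fin.castAdd 3 (1 : Fin 3) = (1 : Fin 6) := rfl
  have f2 : Fin.castAdd 3 (2 : Fin 3) = (2 : Fin 6) := rfl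
  have f3 : Fin.natAdd 3 (0 : Fin 3) = (3 : Fin 6) := rfl
  have f4 : Fin.natAdd 3 (1 : Fin 3) = (4 : Fin 6) := rfl
  have f5 : Fin.natAdd 3 (2 : Fin 3) = (5 : Fin 6) := rfl
  simp only [f0, f1, f2, f3, f4, f5]
  generalize coframeCoord W E ξ = x
  generalize hWE.basis = B
  generalize det6 _ _ = D
  generalize α (B 0) = a0, α (B 1) = a1, α (B 2) = a2, α (B 3) = a3, α (B 4) = a4, α (B 5) = a5
  simp [cubeCoeff, cubeLeft, cubeRight]
  ring

theorem IsCoframe.exists_hitchinK_eq {W E : V [⋀^Fin 1]→L[ℝ] Mat2} (hWE : IsCoframe W E)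
    (r : ℝ) {v : V [⋀^Fin 6]→L[ℝ] ℝ} {b : Fin 6 → V} (hb : v b ≠ 0) :
    ∃ L : V →ₗ[ℝ] V, (∀ ξ, W ![L ξ] = E ![ξ] - r • W ![ξ] ∧ E ![L ξ] = r • E ![ξ] - W ![ξ]) ∧
      ∀ α ξ, hitchinK v (pointForm W E r) α ξ = coframeRatio v W E b * α (L ξ) := by
  obtain ⟨L, hL⟩ := hWE.exists_endomorphism r
  refine ⟨L, hL, fun α ξ => ?_⟩
  -- `topQuot` evaluates on a tuple of its own choice. By `coframeRatio_eq` the ratio there equals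
  -- the ratio at `b`.
  have hv : v (Classical.epsilon fun u => v u ≠ 0) ≠ 0 :=
    Classical.epsilon_spec (p := fun u => v u ≠ 0) ⟨b, hb⟩
  have h1 : hitchinK v (pointForm W E r) α ξ =
    topQuot (oneForm α ⋏ contract ξ (pointForm W E r) ⋏ pointForm W E r) v := rfl
  have h2 := (hWE.coframeRatio_eq v hv).1
  rw [h1, topQuot, hWE.wedge_apply, (hWE.coframeRatio_eq v hb).1, ← h2, coframeRatio]
  have h3 : α (L ξ) = ∑ k : Fin 3, (α (hWE.basis (Fin.castAdd 3 k)) *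
            (su2Coord (E ![ξ]) k - r * su2Coord (W ![ξ]) k) +
          α (hWE.basis (Fin.natAdd 3 k)) *
            (r * su2Coord (E ![ξ]) k - su2Coord (W ![ξ]) k)) := by
    conv_lhs => rw [← hWE.basis.sum_repr (L ξ), map_sum]
    have h4 : ∀ k, hWE.basis.repr (L ξ) k = coframeCoord W E (L ξ) k := fun k => rfl
    simp only [h4, map_smul]
    rw [Fin.sum_univ_add (a := 3) (b := 3), ← Finset.sum_add_distrib]
    refine Finset.sum_congr rfl fun k _ => ?_
    rw [coframeCoord_castAdd, coframeCoord_natAdd, (hL ξ).1, (hL ξ).2]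
    simp only [map_sub, map_smul, Pi.sub_apply, Pi.smul_apply, smul_eq_mul]
    ring
  rw [h3]
  ring

end HitchinEndomorphism

/-! ### The complex form W - ζ E, and the type, J and Ω̂ at a point. -/

theorem trBracket_smul (c : ℂ) (X Y Z : Mat2) :
    trBracket (c • X) (c • Y) (c • Z) = c ^ 3 * trBracket X Y Z := by
  simp [trBracket, Matrix.trace_fin_two, Matrix.mul_apply, Fin.sum_univ_two]
  ring

theorem trBracket_sub_smul (c : ℂ) (X X' Y Y' Z Z' : Mat2) :
    trBracket (X - c • X') (Y - c • Y') (Z - c • Z') = trBracket X Y Z -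
      c * (trBracket X Y Z' + trBracket X Y' Z + trBracket X' Y Z) +
      c ^ 2 * (trBracket X' Y' Z + trBracket X' Y Z' + trBracket X Y' Z') -
      c ^ 3 * trBracket X' Y' Z' := by
  simp [trBracket, Matrix.trace_fin_two, Matrix.mul_apply, Fin.sum_univ_two]
  ring

/-- The complex number `r + i √(1 - r²)`. -/
noncomputable def unitRoot (r : ℝ) : ℂ := ⟨r, Real.sqrt (1 - r ^ 2)⟩

/-- The coefficient `r / √(1 - r²) - i`. -/
noncomputable def hatCoeff (r : ℝ) : ℂ := ⟨r / Real.sqrt (1 - r ^ 2), -1⟩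

theorem sqrt_one_sub_sq_pos {r : ℝ} (hr : |r| < 1) : 0 < Real.sqrt (1 - r ^ 2) := by
  rw [Real.sqrt_pos]
  have := (sq_lt_one_iff_abs_lt_one r).2 hr
  linarith

theorem sq_sqrt_one_sub_sq {r : ℝ} (hr : |r| < 1) : Real.sqrt (1 - r ^ 2) ^ 2 = 1 - r ^ 2 := by
  have := (sq_lt_one_iff_abs_lt_one r).2 hr
  exact Real.sq_sqrt (by linarith)

section PointwiseHitchin

variable {V : Type*} [AddCommGroup V] [Module ℝ V] [TopologicalSpace V]

/-- With `ζ = unitRoot r` of modulus one and `s = √(1 - r²)`, `hatCoeff r = ζ̄ / s`. Let `t_j` be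
the part of the cube of degree `j` in E, which is real. Then `s` times the product is `ζ̄ t₀ - t₁ +
ζ t₂ - ζ² t₃`, and its imaginary part is `s (-t₀ + t₂ - 2 r t₃)`. -/
theorem IsCoframe.pointForm_eq_im {W E : V [⋀^Fin 1]→L[ℝ] Mat2} (hWE : IsCoframe W E) {r : ℝ}
    (hr : |r| < 1) (u : Fin 3 → V) :
    pointForm W E r u = (hatCoeff r * trBracket (W ![u 0] - unitRoot r • E ![u 0])
      (W ![u 1] - unitRoot r • E ![u 1]) (W ![u 2] - unitRoot r • E ![u 2])).im := by
  rw [pointForm_apply, trBracket_sub_smul]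
  simp only [trBracket_su2, hWE.su2_left, hWE.su2_right]
  have hs := sqrt_one_sub_sq_pos hr
  have hs2 := sq_sqrt_one_sub_sq hr
  simp only [unitRoot, hatCoeff]
  generalize Real.sqrt (1 - r ^ 2) = s at hs hs2
  have h1 : (⟨r / s, -1⟩ : ℂ) = ((s : ℂ)⁻¹) * ⟨r, -s⟩ := by
    rw [← Complex.ofReal_inv]
    apply Complex.ext <;> simp <;> field_simp
  have h2 : (⟨r, -s⟩ : ℂ) * ⟨r, s⟩ = 1 := by
    apply Complex.ext <;> simp <;> nlinarith
  have h4 : (⟨r, s⟩ : ℂ) * ⟨r, s⟩ = ⟨2 * r ^ 2 - 1, 2 * r * s⟩ := by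
    apply Complex.ext <;> simp <;> nlinarith
  rw [h1]
  have h5 : ∀ t0 t1 t2 t3 : ℂ, (s : ℂ)⁻¹ * ⟨r, -s⟩ * (t0 - ⟨r, s⟩ * t1 + ⟨r, s⟩ ^ 2 * t2 -
      ⟨r, s⟩ ^ 3 * t3) = (s : ℂ)⁻¹ * (⟨r, -s⟩ * t0 - t1 + ⟨r, s⟩ * t2 -
      ⟨2 * r ^ 2 - 1, 2 * r * s⟩ * t3) := by
    intro t0 t1 t2 t3
    rw [← h4]
    linear_combination ((s : ℂ)⁻¹ * (-t1 + ⟨r, s⟩ * t2 - ⟨r, s⟩ ^ 2 * t3)) * h2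
  rw [h5, ← Complex.ofReal_inv]
  simp
  field_simp

variable [IsTopologicalAddGroup V] [ContinuousSMul ℝ V] [FiniteDimensional ℝ V] [T2Space V]

/-- K² is the scalar `coframeRatio² (r² - 1)` because `L² = r² - 1`. The trace of the identity in
dimension six cancels the factor 1/6. -/
theorem IsCoframe.hitchinLambda_eq {W E : V [⋀^Fin 1]→L[ℝ] Mat2} (hWE : IsCoframe W E)
    (r : ℝ) {v : V [⋀^Fin 6]→L[ℝ] ℝ} {b : Fin 6 → V} (hb : v b ≠ 0) :
    hitchinLambda v (pointForm W E r) = coframeRatio v W E b ^ 2 * (r ^ 2 - 1) := by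
  obtain ⟨L, hL, hK⟩ := hWE.exists_hitchinK_eq r hb
  have hLL : ∀ ξ, L (L ξ) = (r ^ 2 - 1) • ξ := fun ξ => hWE.ext
    (by rw [(hL _).1, (hL _).1, (hL _).2, oneForm_map_smul]; module)
    (by rw [(hL _).2, (hL _).1, (hL _).2, oneForm_map_smul]; module)
  have hKK : hitchinK v (pointForm W E r) ∘ₗ hitchinK v (pointForm W E r) =
      (coframeRatio v W E b ^ 2 * (r ^ 2 - 1)) • LinearMap.id := by
    ext α ξ
    simp only [LinearMap.comp_apply, hK, hLL, map_smul, smul_eq_mul, LinearMap.smul_apply,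
      LinearMap.id_apply]
    ring
  rw [hitchinLambda, hKK, map_smul, LinearMap.trace_id, Subspace.dual_finrank_eq, hWE.finrank_eq]
  simp only [smul_eq_mul]
  push_cast
  ring

theorem IsCoframe.isNegativeType_iff {W E : V [⋀^Fin 1]→L[ℝ] Mat2} (hWE : IsCoframe W E)
    (r : ℝ) {v : V [⋀^Fin 6]→L[ℝ] ℝ} (hv : v ≠ 0) :
    IsNegativeType v (pointForm W E r) ↔ |r| < 1 := by
  obtain ⟨b, hb⟩ := exists_apply_ne_zero hv
  rw [IsNegativeType, hWE.hitchinLambda_eq r hb, ← sq_lt_one_iff_abs_lt_one]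
  have := sq_pos_of_ne_zero (hWE.coframeRatio_ne_zero hb)
  constructor
  · intro h
    by_contra! h'
    nlinarith
  · intro h
    nlinarith

/-- Here `ε` is the sign of `coframeRatio`, so `√(-λ) = ε coframeRatio √(1 - r²)`. The size of the
ratio cancels in J and only its sign survives. -/
theorem IsCoframe.hitchinJVec_apply {W E : V [⋀^Fin 1]→L[ℝ] Mat2} (hWE : IsCoframe W E)
    {r : ℝ} (hr : |r| < 1) {v : V [⋀^Fin 6]→L[ℝ] ℝ} {b : Fin 6 → V} (hb : v b ≠ 0) {ε : ℝ}
    (hε : ε ^ 2 = 1) (hpos : 0 < ε * coframeRatio v W E b) (ξ : V) :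
    W ![hitchinJVec v (pointForm W E r) ξ] =
        (ε / Real.sqrt (1 - r ^ 2)) • (E ![ξ] - r • W ![ξ]) ∧
      E ![hitchinJVec v (pointForm W E r) ξ] =
        (ε / Real.sqrt (1 - r ^ 2)) • (r • E ![ξ] - W ![ξ]) := by
  obtain ⟨L, hL, hK⟩ := hWE.exists_hitchinK_eq r hb
  have hs := sqrt_one_sub_sq_pos hr
  have hJ : hitchinJVec v (pointForm W E r) ξ = (ε / Real.sqrt (1 - r ^ 2)) • L ξ := by
    rw [← sub_eq_zero, ← Module.forall_dual_apply_eq_zero_iff ℝ]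
    intro α
    rw [map_sub, map_smul, apply_hitchinJVec, hitchinJ, LinearMap.smul_apply, LinearMap.smul_apply,
      hK, hWE.hitchinLambda_eq r hb, smul_eq_mul, smul_eq_mul]
    set κ := coframeRatio v W E b
    have h1 : -(κ ^ 2 * (r ^ 2 - 1)) = (ε * κ) ^ 2 * (1 - r ^ 2) := by
      rw [mul_pow, hε]; ring
    rw [h1, Real.sqrt_mul (sq_nonneg _), Real.sqrt_sq hpos.le]
    have hκ : κ ≠ 0 := right_ne_zero_of_mul hpos.ne'
    have hε0 : ε ≠ 0 := left_ne_zero_of_mul hpos.ne'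
    field_simp
    linear_combination (-α (L ξ)) * hε
  rw [hJ, oneForm_map_smul, oneForm_map_smul, (hL ξ).1, (hL ξ).2]
  exact ⟨rfl, rfl⟩

/-- The form `A = W - ζ E` satisfies `A ∘ J = iε A`. Its cube is multiplied by `(iε)³ = -iε`, and
together with the minus sign in Ω̂ this turns the imaginary part into `ε` times the real part. -/
theorem IsCoframe.hitchinHat_apply {W E : V [⋀^Fin 1]→L[ℝ] Mat2} (hWE : IsCoframe W E)
    {r : ℝ} (hr : |r| < 1) {v : V [⋀^Fin 6]→L[ℝ] ℝ} {b : Fin 6 → V} (hb : v b ≠ 0) {ε : ℝ}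
    (hε : ε ^ 2 = 1) (hpos : 0 < ε * coframeRatio v W E b) (u : Fin 3 → V) :
    hitchinHat v (pointForm W E r) u =
      ε * (hatCoeff r * trBracket (W ![u 0] - unitRoot r • E ![u 0])
        (W ![u 1] - unitRoot r • E ![u 1]) (W ![u 2] - unitRoot r • E ![u 2])).re := by
  have h0 : hitchinHat v (pointForm W E r) u =
    -pointForm W E r (fun i => hitchinJVec v (pointForm W E r) (u i)) := rfl
  have hs := sqrt_one_sub_sq_pos hr
  have hs2 := sq_sqrt_one_sub_sq hr
  have hJ : ∀ ξ, W ![hitchinJVec v (pointForm W E r) ξ] -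
      unitRoot r • E ![hitchinJVec v (pointForm W E r) ξ] =
      (Complex.I * ε) • (W ![ξ] - unitRoot r • E ![ξ]) := by
    intro ξ
    obtain ⟨h1, h2⟩ := hWE.hitchinJVec_apply hr hb hε hpos ξ
    rw [h1, h2, unitRoot]
    generalize Real.sqrt (1 - r ^ 2) = s at hs hs2
    ext i j
    apply Complex.ext <;> simp <;> field_simp
    · linear_combination (-(ε * (E ![ξ] i j).re)) * hs2
    · linear_combination (-(ε * (E ![ξ] i j).im)) * hs2
  rw [h0, hWE.pointForm_eq_im hr]
  simp only [hJ, trBracket_smul]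
  have h3 : (Complex.I * (ε : ℂ)) ^ 3 = -(Complex.I * ε) := by
    have h4 : (ε : ℂ) ^ 2 = 1 := by exact_mod_cast hε
    linear_combination (Complex.I ^ 3 * ε) * h4 + Complex.I * ε * Complex.I_sq
  rw [h3]
  generalize trBracket _ _ _ = t
  generalize hatCoeff r = κ
  simp
  ring

end PointwiseHitchin

/-! ### Forms and functions in the preferred charts. -/

section ChartCalculus

variable {E H N : Type*} [NormedAddCommGroup E] [NormedSpace ℝ E] [TopologicalSpace H]
  [TopologicalSpace N] [ChartedSpace H N] {F : Type*} [NormedAddCommGroup F] [NormedSpace ℝ F]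
  {k : ℕ}

open Filter Topology

theorem mdifferentiableAt_extChartAt_symm_of_boundaryless (I : ModelWithCorners ℝ E H)
    [I.Boundaryless] [IsManifold I 1 N] {c : N} {y : E} (hy : y ∈ (extChartAt I c).target) :
    MDifferentiableAt 𝓘(ℝ, E) I (extChartAt I c).symm y := by
  have := mdifferentiableWithinAt_extChartAt_symm (I := I) hy
  rwa [I.range_eq_univ, mdifferentiableWithinAt_univ] at this

/-- The identification of a tangent space with the model vector space. -/
def tangentModel (I : ModelWithCorners ℝ E H) (x : N) : TangentSpace I x ≃ₗ[ℝ] E :=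
  show E ≃ₗ[ℝ] E from LinearEquiv.refl ℝ E

theorem mfderiv_extChartAt_symm_self (I : ModelWithCorners ℝ E H) [I.Boundaryless]
    [IsManifold I 1 N] (x : N) (u : E) :
    (show E →L[ℝ] E from mfderiv 𝓘(ℝ, E) I (extChartAt I x).symm (extChartAt I x x)) u = u := by
  have h := mfderiv_extChartAt_comp_mfderivWithin_extChartAt_symm' (I := I)
    (mem_extChartAt_source (I := I) x)
  rw [I.range_eq_univ, mfderivWithin_univ, mfderiv_extChartAt_self] at h
  exact congrArg (fun f : E →L[ℝ] E => f u) h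

theorem chartForm_apply (I : ModelWithCorners ℝ E H) (α : DiffForm I N k F) (c : N) (y : E)
    (u : Fin k → E) : chartForm I α c y u = α ((extChartAt I c).symm y)
      (fun i => mfderiv 𝓘(ℝ, E) I (extChartAt I c).symm y (u i)) := rfl

theorem diffForm_apply_congr (I : ModelWithCorners ℝ E H) (α : DiffForm I N k F) {x x' : N}
    (h : x = x') {u u' : Fin k → E} (hu : u = u') :
    (α x : E [⋀^Fin k]→L[ℝ] F) u = (α x' : E [⋀^Fin k]→L[ℝ] F) u' := by
  subst h hu; rfl

/-- A tangent space is the model space read in the preferred chart at its base point, so this chart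
has the identity as derivative there. -/
theorem chartForm_self (I : ModelWithCorners ℝ E H) [I.Boundaryless] [IsManifold I 1 N]
    (α : DiffForm I N k F) (x : N) (u : Fin k → TangentSpace I x) :
    chartForm I α x (extChartAt I x x) (fun i => tangentModel I x (u i)) = α x u := by
  rw [chartForm_apply]
  exact diffForm_apply_congr I α (extChartAt_to_inv (I := I) x)
    (funext fun i => mfderiv_extChartAt_symm_self I x (u i))

theorem extD_apply (I : ModelWithCorners ℝ E H) [I.Boundaryless] [IsManifold I 1 N]
    (α : DiffForm I N k F) (x : N) (u : Fin (k + 1) → TangentSpace I x) :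
    extD I α x u = extDeriv (chartForm I α x) (extChartAt I x x)
      (fun i => tangentModel I x (u i)) := by
  have h1 : extD I α x u = extDeriv (chartForm I α x) (extChartAt I x x)
    (fun i => (show E →L[ℝ] E from mfderiv I 𝓘(ℝ, E) (extChartAt I x) x)
      (tangentModel I x (u i))) := rfl
  have h2 : (show E →L[ℝ] E from mfderiv I 𝓘(ℝ, E) (extChartAt I x) x) =
    ContinuousLinearMap.id ℝ E := mfderiv_extChartAt_self
  rw [h1, h2]
  rfl

theorem mfderiv_eq_fderiv_chart (I : ModelWithCorners ℝ E H) [I.Boundaryless] [IsManifold I 1 N]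
    {f : N → F} {x : N} (hf : DifferentiableAt ℝ (f ∘ (extChartAt I x).symm) (extChartAt I x x)) :
    MDifferentiableAt I 𝓘(ℝ, F) f x ∧ (show E →L[ℝ] F from mfderiv I 𝓘(ℝ, F) f x) =
      fderiv ℝ (f ∘ (extChartAt I x).symm) (extChartAt I x x) := by
  have h1 : MDifferentiableAt I 𝓘(ℝ, F) f x := by
    rw [mdifferentiableAt_iff]
    refine ⟨?_, ?_⟩
    · have h2 : ContinuousAt ((f ∘ (extChartAt I x).symm) ∘ extChartAt I x) x :=
        hf.continuousAt.comp (continuousAt_extChartAt x)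
      refine h2.congr ?_
      filter_upwards [extChartAt_source_mem_nhds (I := I) x] with z hz
      exact congrArg f ((extChartAt I x).left_inv hz)
    · rw [I.range_eq_univ]
      exact hf.differentiableWithinAt
  refine ⟨h1, ?_⟩
  have h2 : (show E →L[ℝ] F from mfderiv I 𝓘(ℝ, F) f x) =
      fderivWithin ℝ (writtenInExtChartAt I 𝓘(ℝ, F) x f) (Set.range I) (extChartAt I x x) :=
    if_pos h1
  rw [h2, I.range_eq_univ, fderivWithin_univ]
  rfl

section FiniteDimensional

variable {G : Type*} [NormedAddCommGroup G] [NormedSpace ℝ G]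

/-- Evaluation on tuples of basis vectors is injective, and its linear left inverse is continuous in
finite dimension. Differentiability of a family of forms can thus be checked on fixed vectors. -/
theorem exists_leftInverse_eval [FiniteDimensional ℝ E] [FiniteDimensional ℝ F] :
    ∃ (ι : Type) (_ : Fintype ι) (b : ι → Fin k → E) (L : (ι → F) →L[ℝ] E [⋀^Fin k]→L[ℝ] F),
      ∀ η, L (fun i => η (b i)) = η := by
  let B := Module.finBasis ℝ E
  let ι := Fin k → Fin (Module.finrank ℝ E)
  let ev : (E [⋀^Fin k]→L[ℝ] F) →ₗ[ℝ] (ι → F) :=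
    { toFun := fun η s => η (fun i => B (s i))
      map_add' := fun _ _ => rfl
      map_smul' := fun _ _ => rfl }
  have hinj : Function.Injective ev := by
    intro η η' h
    have : η.toAlternatingMap = η'.toAlternatingMap :=
      Module.Basis.ext_alternating B fun s _ => congrFun h s
    exact ContinuousAlternatingMap.toAlternatingMap_injective this
  obtain ⟨L, hL⟩ := ev.exists_leftInverse_of_injective (LinearMap.ker_eq_bot.2 hinj)
  exact ⟨ι, inferInstance, fun s i => B (s i), LinearMap.toContinuousLinearMap L,
    fun η => congrArg (fun f => f η) hL⟩

theorem differentiableAt_form_iff [FiniteDimensional ℝ E] [FiniteDimensional ℝ F]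
    {f : G → E [⋀^Fin k]→L[ℝ] F} {y : G} :
    DifferentiableAt ℝ f y ↔ ∀ u, DifferentiableAt ℝ (fun z => f z u) y := by
  constructor
  · intro h u
    exact ((ContinuousAlternatingMap.apply ℝ E F u).differentiableAt).comp y h
  · intro h
    obtain ⟨ι, _, b, L, hL⟩ := exists_leftInverse_eval (k := k) (E := E) (F := F)
    have : f = fun z => L (fun i => f z (b i)) := funext fun z => (hL (f z)).symm
    rw [this]
    exact L.differentiableAt.comp y (differentiableAt_pi.2 fun i => h (b i))

end FiniteDimensional

end ChartCalculus

/-! ### Independence of the exterior derivative from the chart. -/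

section ChartTransition

variable {E H N : Type*} [NormedAddCommGroup E] [NormedSpace ℝ E] [TopologicalSpace H]
  [TopologicalSpace N] [ChartedSpace H N] {F : Type*} [NormedAddCommGroup F] [NormedSpace ℝ F]
  {k : ℕ}

open Filter Topology

theorem contDiffAt_transition (I : ModelWithCorners ℝ E H) [I.Boundaryless] [IsManifold I ∞ N]
    {c x : N} {y : E} (hy : y ∈ (extChartAt I c).target)
    (hx : (extChartAt I c).symm y ∈ (extChartAt I x).source) :
    ContDiffAt ℝ ∞ (extChartAt I x ∘ (extChartAt I c).symm) y := by
  rw [← contMDiffAt_iff_contDiffAt]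
  have h1 : ContMDiffAt 𝓘(ℝ, E) I ∞ (extChartAt I c).symm y :=
    (contMDiffOn_extChartAt_symm c).contMDiffAt ((isOpen_extChartAt_target c).mem_nhds hy)
  have h2 : ContMDiffAt I 𝓘(ℝ, E) ∞ (extChartAt I x) ((extChartAt I c).symm y) :=
    contMDiffAt_extChartAt' (by rwa [extChartAt_source] at hx)
  exact h2.comp y h1

theorem eventually_transition_mem (I : ModelWithCorners ℝ E H) [I.Boundaryless]
    {c x : N} {y : E} (hy : y ∈ (extChartAt I c).target)
    (hx : (extChartAt I c).symm y ∈ (extChartAt I x).source) :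
    ∀ᶠ z in 𝓝 y, z ∈ (extChartAt I c).target ∧
      (extChartAt I c).symm z ∈ (extChartAt I x).source := by
  refine Filter.Eventually.and ((isOpen_extChartAt_target c).mem_nhds hy) ?_
  have h1 : ContinuousAt (extChartAt I c).symm y :=
    (continuousOn_extChartAt_symm c).continuousAt ((isOpen_extChartAt_target c).mem_nhds hy)
  exact h1.eventually ((isOpen_extChartAt_source x).mem_nhds hx)

theorem mfderiv_symm_transition (I : ModelWithCorners ℝ E H) [I.Boundaryless] [IsManifold I ∞ N]
    {c x : N} {y : E} (hy : y ∈ (extChartAt I c).target)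
    (hx : (extChartAt I c).symm y ∈ (extChartAt I x).source) :
    (show E →L[ℝ] E from mfderiv 𝓘(ℝ, E) I (extChartAt I c).symm y) =
      (show E →L[ℝ] E from mfderiv 𝓘(ℝ, E) I (extChartAt I x).symm
        ((extChartAt I x ∘ (extChartAt I c).symm) y)) ∘L
        fderiv ℝ (extChartAt I x ∘ (extChartAt I c).symm) y := by
  have : IsManifold I 1 N := IsManifold.of_le (n := ∞) (by simp)
  have h1 : (extChartAt I c).symm =ᶠ[𝓝 y]
      (extChartAt I x).symm ∘ (extChartAt I x ∘ (extChartAt I c).symm) := by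
    filter_upwards [eventually_transition_mem I hy hx] with z hz
    exact ((extChartAt I x).left_inv hz.2).symm
  have h2 : MDifferentiableAt 𝓘(ℝ, E) 𝓘(ℝ, E) (extChartAt I x ∘ (extChartAt I c).symm) y :=
    ((contDiffAt_transition I hy hx).differentiableAt (by simp)).mdifferentiableAt
  have h3 : MDifferentiableAt 𝓘(ℝ, E) I (extChartAt I x).symm
      ((extChartAt I x ∘ (extChartAt I c).symm) y) :=
    mdifferentiableAt_extChartAt_symm_of_boundaryless I ((extChartAt I x).map_source hx)
  have h4 := mfderiv_comp y h3 h2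
  rw [mfderiv_eq_fderiv] at h4
  have h5 : (show E →L[ℝ] E from mfderiv 𝓘(ℝ, E) I (extChartAt I c).symm y) =
    (show E →L[ℝ] E from mfderiv 𝓘(ℝ, E) I
      ((extChartAt I x).symm ∘ (extChartAt I x ∘ (extChartAt I c).symm)) y) := h1.mfderiv_eq
  rw [h5]
  exact h4

theorem chartForm_transition (I : ModelWithCorners ℝ E H) [I.Boundaryless] [IsManifold I ∞ N]
    (α : DiffForm I N k F) {c x : N} {y : E} (hy : y ∈ (extChartAt I c).target)
    (hx : (extChartAt I c).symm y ∈ (extChartAt I x).source) :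
    chartForm I α c y =
      (chartForm I α x ((extChartAt I x ∘ (extChartAt I c).symm) y)).compContinuousLinearMap
        (fderiv ℝ (extChartAt I x ∘ (extChartAt I c).symm) y) := by
  ext u
  have h := mfderiv_symm_transition I hy hx
  have h' : ∀ i, (show E →L[ℝ] E from mfderiv 𝓘(ℝ, E) I (extChartAt I c).symm y) (u i) =
      (show E →L[ℝ] E from mfderiv 𝓘(ℝ, E) I (extChartAt I x).symm
        ((extChartAt I x ∘ (extChartAt I c).symm) y))
        (fderiv ℝ (extChartAt I x ∘ (extChartAt I c).symm) y (u i)) := fun i => by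
    rw [h]; rfl
  exact diffForm_apply_congr I α ((extChartAt I x).left_inv hx).symm (funext h')

/-- `extD` uses a different chart at each point. Since `extDeriv` commutes with pullback along
transition maps, a single chart computes it on its whole target; the differentiability of ρ needs
this. -/
theorem chartForm_extD (I : ModelWithCorners ℝ E H) [I.Boundaryless] [IsManifold I ∞ N]
    {α : DiffForm I N k F} (hα : IsSmoothForm I α) {c : N} {y : E}
    (hy : y ∈ (extChartAt I c).target) :
    chartForm I (extD I α) c y = extDeriv (chartForm I α c) y := by
  have : IsManifold I 1 N := IsManifold.of_le (n := ∞) (by simp)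
  set x := (extChartAt I c).symm y with hxdef
  have hx : (extChartAt I c).symm y ∈ (extChartAt I x).source := mem_extChartAt_source x
  have hd : DifferentiableAt ℝ (chartForm I α x) ((extChartAt I x ∘ (extChartAt I c).symm) y) :=
    ((hα x).contDiffAt (extChartAt_target_mem_nhds' ((extChartAt I x).map_source hx))).differentiableAt
      (by simp)
  have h1 : chartForm I α c =ᶠ[𝓝 y] fun z =>
      (chartForm I α x ((extChartAt I x ∘ (extChartAt I c).symm) z)).compContinuousLinearMap
        (fderiv ℝ (extChartAt I x ∘ (extChartAt I c).symm) z) := by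
    filter_upwards [eventually_transition_mem I hy hx] with z hz
    exact chartForm_transition I α hz.1 hz.2
  rw [h1.extDeriv_eq, extDeriv_pullback hd (contDiffAt_transition I hy hx)
      (by rw [minSmoothness_of_isRCLikeNormedField]; exact WithTop.coe_le_coe.2 le_top),
    chartForm_transition I (extD I α) hy hx]
  congr 1
  ext u
  have h2 := chartForm_self I (extD I α) x (fun i => (tangentModel I x).symm (u i))
  rw [extD_apply] at h2
  exact h2

end ChartTransition

/-! ### Leibniz rule for Tr(X[Y,Z]). -/

section TraceDerivative

variable {G : Type*} [NormedAddCommGroup G] [NormedSpace ℝ G]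

/-- The trace as a continuous real-linear map. -/
noncomputable def traceCLM : Mat2 →L[ℝ] ℂ :=
  LinearMap.toContinuousLinearMap (Matrix.traceLinearMap (Fin 2) ℝ ℂ)

theorem traceCLM_apply (X : Mat2) : traceCLM X = X.trace := rfl

theorem hasFDerivAt_trBracket {a b c : G → Mat2} {a' b' c' : G →L[ℝ] Mat2} {y : G}
    (ha : HasFDerivAt a a' y) (hb : HasFDerivAt b b' y) (hc : HasFDerivAt c c' y) :
    ∃ T : G →L[ℝ] ℂ, HasFDerivAt (fun z => trBracket (a z) (b z) (c z)) T y ∧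
      ∀ t, T t = trBracket (a' t) (b y) (c y) + trBracket (a y) (b' t) (c y) +
        trBracket (a y) (b y) (c' t) := by
  have h1 := ha.mul' ((hb.mul' hc).sub (hc.mul' hb))
  have h2 := traceCLM.hasFDerivAt.comp y h1
  refine ⟨_, h2, fun t => ?_⟩
  simp only [trBracket, ContinuousLinearMap.comp_apply, traceCLM_apply,
    ← Matrix.trace_add]
  congr 1
  simp
  noncomm_ring

end TraceDerivative

/-- In dimension `n` both forms are multiples of one determinant, so any tuple with `v b ≠ 0` may
replace the chosen one. -/
theorem topQuot_eq_div {V : Type*} [AddCommGroup V] [Module ℝ V] [TopologicalSpace V]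
    [FiniteDimensional ℝ V] {n : ℕ} (hn : Module.finrank ℝ V = n) (μ v : V [⋀^Fin n]→L[ℝ] ℝ)
    {b : Fin n → V} (hb : v b ≠ 0) : topQuot μ v = μ b / v b := by
  have hv := Classical.epsilon_spec (p := fun u => v u ≠ 0) ⟨b, hb⟩
  rw [topQuot]
  set u := Classical.epsilon fun u => v u ≠ 0
  have hli : LinearIndependent ℝ b := by
    by_contra h
    exact hb (v.toAlternatingMap.map_linearDependent b h)
  have hB : Fintype.card (Fin n) = Module.finrank ℝ V := by simp [hn]
  rcases Nat.eq_zero_or_pos n with h0 | h0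
  · subst h0
    rw [Subsingleton.elim u b]
  have : Nonempty (Fin n) := ⟨⟨0, h0⟩⟩
  let B := basisOfLinearIndependentOfCardEqFinrank hli hB
  have hBb : ⇑B = b := coe_basisOfLinearIndependentOfCardEqFinrank hli hB
  have key : ∀ η : V [⋀^Fin n]→L[ℝ] ℝ, η u = η b * B.det u := fun η => by
    have := congrArg (fun f => f u) (η.toAlternatingMap.eq_smul_basis_det B)
    rw [hBb] at this
    exact this
  rw [key v] at hv
  rw [key μ, key v]
  have h1 := right_ne_zero_of_mul hv
  field_simp

/-! ### Differentiability of ρ. -/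

section FieldStrength

open Filter Topology

variable {M : Type*} [TopologicalSpace M] [ChartedSpace (EuclideanSpace ℝ (Fin 3)) M]

theorem frameVolume_apply {V : Type*} [AddCommGroup V] [Module ℝ V] [TopologicalSpace V]
    (e : V [⋀^Fin 1]→L[ℝ] Mat2) (u : Fin 3 → V) :
    frameVolume e u = -2 * (trBracket (e ![u 0]) (e ![u 1]) (e ![u 2])).re := by
  have : frameVolume e u = -(2 / 3) * trForm (e ⋏ e ⋏ e) u := rfl
  rw [this, trForm_cube_apply]
  ring

theorem vec_one_map {V V' : Type*} (f : V → V') (u : V) : (fun i => f (![u] i)) = ![f u] := by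
  ext i; fin_cases i; rfl

theorem chartForm_apply_one {E H N : Type*} [NormedAddCommGroup E]
    [NormedSpace ℝ E] [TopologicalSpace H] [TopologicalSpace N] [ChartedSpace H N] {F : Type*}
    [NormedAddCommGroup F] [NormedSpace ℝ F] (I : ModelWithCorners ℝ E H) (α : DiffForm I N 1 F)
    (c : N) (y u : E) : chartForm I α c y ![u] =
      α ((extChartAt I c).symm y) ![mfderiv 𝓘(ℝ, E) I (extChartAt I c).symm y u] :=
  congrArg (α ((extChartAt I c).symm y)) (vec_one_map _ u)

theorem IsSmoothForm.differentiableAt_apply {E H N : Type*} [NormedAddCommGroup E]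
    [NormedSpace ℝ E] [TopologicalSpace H] [TopologicalSpace N] [ChartedSpace H N] {F : Type*}
    [NormedAddCommGroup F] [NormedSpace ℝ F] {k : ℕ} {I : ModelWithCorners ℝ E H}
    [I.Boundaryless] {α : DiffForm I N k F} (hα : IsSmoothForm I α) (x : N) :
    DifferentiableAt ℝ (chartForm I α x) (extChartAt I x x) :=
  ((hα x).contDiffAt (extChartAt_target_mem_nhds x)).differentiableAt (by simp)

theorem finrank_tangentSpace_three (x : M) : Module.finrank ℝ (TangentSpace (𝓡 3) x) = 3 :=
  (tangentModel (𝓡 3) x).finrank_eq.trans (by simp)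

/-- A tuple of constant vectors on which the frame volume is nonzero at `x` stays admissible near
`x`. By `topQuot_eq_div`, ρ is there a quotient of two differentiable coordinate functions. -/
theorem differentiableAt_fieldStrength [IsManifold (𝓡 3) ∞ M] {e : DiffForm (𝓡 3) M 1 Mat2}
    (he : IsSmoothForm (𝓡 3) e) (hframe : ∀ x : M, frameVolume (e x) ≠ 0)
    {h : DiffForm (𝓡 3) M 3 ℝ} (hh : IsSmoothForm (𝓡 3) h)
    {b : DiffForm (𝓡 3) M 2 ℝ} (hb : IsSmoothForm (𝓡 3) b) (x : M) :
    DifferentiableAt ℝ (fieldStrength e h b ∘ (extChartAt (𝓡 3) x).symm)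
      (extChartAt (𝓡 3) x x) := by
  have : IsManifold (𝓡 3) 1 M := IsManifold.of_le (n := ∞) (by simp)
  set y₀ := extChartAt (𝓡 3) x x
  obtain ⟨u, hu⟩ : ∃ u, frameVolume (e x) u ≠ 0 := by
    by_contra! h
    exact hframe x (ContinuousAlternatingMap.ext h)
  set B : Fin 3 → EuclideanSpace ℝ (Fin 3) := fun i => tangentModel (𝓡 3) x (u i)
  set D : EuclideanSpace ℝ (Fin 3) → ℝ := fun y => frameVolume (chartForm (𝓡 3) e x y) B with hD
  have hD0 : D y₀ ≠ 0 := by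
    have h1 : ∀ i, chartForm (𝓡 3) e x y₀ ![B i] = e x ![u i] := fun i => by
      rw [← chartForm_self, vec_one_map]
    rw [hD]
    simp only [frameVolume_apply, h1]
    rwa [← frameVolume_apply]
  have hDd : DifferentiableAt ℝ D y₀ := by
    have h1 : ∀ i, DifferentiableAt ℝ (fun y => chartForm (𝓡 3) e x y ![B i]) y₀ := fun i =>
      differentiableAt_form_iff.1 (he.differentiableAt_apply x) ![B i]
    simp only [hD, frameVolume_apply]
    obtain ⟨T, hT, -⟩ := hasFDerivAt_trBracket (h1 0).hasFDerivAt (h1 1).hasFDerivAt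
      (h1 2).hasFDerivAt
    exact (Complex.reCLM.differentiableAt.comp y₀ hT.differentiableAt).const_mul _
  have hN : DifferentiableAt ℝ
      (fun y => chartForm (𝓡 3) h x y B + extDeriv (chartForm (𝓡 3) b x) y B) y₀ := by
    refine DifferentiableAt.add ?_ ?_
    · exact differentiableAt_form_iff.1 (hh.differentiableAt_apply x) B
    · have h2 : ContDiffAt ℝ ∞ (chartForm (𝓡 3) b x) y₀ :=
        (hb x).contDiffAt (extChartAt_target_mem_nhds x)
      have h3 : DifferentiableAt ℝ (fderiv ℝ (chartForm (𝓡 3) b x)) y₀ :=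
        (h2.fderiv_right (m := 1) (WithTop.coe_le_coe.2 le_top)).differentiableAt (by simp)
      exact ((ContinuousAlternatingMap.apply ℝ _ ℝ B).differentiableAt).comp y₀
        ((ContinuousAlternatingMap.alternatizeUncurryFinCLM ℝ _ ℝ).differentiableAt.comp y₀ h3)
  refine (hN.mul (hDd.inv hD0)).congr_of_eventuallyEq ?_
  filter_upwards [extChartAt_target_mem_nhds (I := 𝓡 3) x,
    hDd.continuousAt.eventually_ne hD0] with y hy hy0
  have h4 : frameVolume (e ((extChartAt (𝓡 3) x).symm y))
      (fun i => mfderiv 𝓘(ℝ, _) (𝓡 3) (extChartAt (𝓡 3) x).symm y (B i)) = D y := by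
    simp only [hD, frameVolume_apply, chartForm_apply_one]
  have h5 := topQuot_eq_div (finrank_tangentSpace_three ((extChartAt (𝓡 3) x).symm y))
    (h ((extChartAt (𝓡 3) x).symm y) + extD (𝓡 3) b ((extChartAt (𝓡 3) x).symm y)) _
    (h4.trans_ne hy0)
  rw [Function.comp_apply, fieldStrength, h5, h4]
  rw [Pi.mul_apply, Pi.inv_apply, ← div_eq_mul_inv, ← chartForm_extD (𝓡 3) hb hy]
  rfl

end FieldStrength

/-! ### The product charts of M × SU(2), the lifts and the Maurer-Cartan form in them. -/

section BundleCharts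

open Filter Topology

variable {M : Type*} [TopologicalSpace M] [ChartedSpace (EuclideanSpace ℝ (Fin 3)) M]

/-- `su2Matrix` as a continuous linear map. -/
noncomputable def su2MatrixCLM : EuclideanSpace ℝ (Fin 4) →L[ℝ] Mat2 :=
  LinearMap.toContinuousLinearMap
    { toFun := su2Matrix
      map_add' := fun q q' => by
        ext i j
        fin_cases i <;> fin_cases j <;> simp [su2Matrix, Complex.ext_iff] <;> ring
      map_smul' := fun c q => by
        ext i j
        fin_cases i <;> fin_cases j <;> simp [su2Matrix, Complex.ext_iff] }

theorem su2MatrixCLM_apply (q : EuclideanSpace ℝ (Fin 4)) : su2MatrixCLM q = su2Matrix q := rfl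

theorem su2Matrix_injective : Function.Injective su2Matrix := by
  intro q q' h
  have h0 := congrFun (congrFun h 0) 0
  have h1 := congrFun (congrFun h 0) 1
  simp [su2Matrix] at h0 h1
  ext i
  fin_cases i
  · exact h0.1
  · exact h0.2
  · exact h1.1
  · exact h1.2

theorem conjTranspose_mul_su2Matrix (g : S3) : (su2Matrix g)ᴴ * su2Matrix g = 1 := by
  have := su2Matrix_bijOn.mapsTo g.2
  rw [SetLike.mem_coe, Matrix.mem_specialUnitaryGroup_iff, Matrix.mem_unitaryGroup_iff'] at this
  exact this.1

theorem su2Matrix_mul_conjTranspose (g : S3) : su2Matrix g * (su2Matrix g)ᴴ = 1 :=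
  mul_eq_one_comm.1 (conjTranspose_mul_su2Matrix g)

/-- The fibre coordinate `g` in the preferred chart at `c`. -/
noncomputable def groupChart (c : S3) (z : EuclideanSpace ℝ (Fin 3)) : Mat2 :=
  su2Matrix ((extChartAt (𝓡 3) c).symm z : S3)

theorem finrank_euclidean_four_fact :
    Fact (Module.finrank ℝ (EuclideanSpace ℝ (Fin 4)) = 3 + 1) := ⟨by simp⟩

theorem contDiffAt_coe_chart {c : S3} {z : EuclideanSpace ℝ (Fin 3)}
    (hz : z ∈ (extChartAt (𝓡 3) c).target) :
    ContDiffAt ℝ ∞ (fun z => ((extChartAt (𝓡 3) c).symm z : EuclideanSpace ℝ (Fin 4))) z := by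
  rw [← contMDiffAt_iff_contDiffAt]
  have h1 : ContMDiffAt 𝓘(ℝ, EuclideanSpace ℝ (Fin 3)) (𝓡 3) ∞ (extChartAt (𝓡 3) c).symm z :=
    (contMDiffOn_extChartAt_symm c).contMDiffAt ((isOpen_extChartAt_target c).mem_nhds hz)
  have := finrank_euclidean_four_fact
  exact (contMDiff_coe_sphere (E := EuclideanSpace ℝ (Fin 4)) (n := 3)).contMDiffAt.comp z h1

theorem contDiffAt_groupChart {c : S3} {z : EuclideanSpace ℝ (Fin 3)}
    (hz : z ∈ (extChartAt (𝓡 3) c).target) : ContDiffAt ℝ ∞ (groupChart c) z :=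
  su2MatrixCLM.contDiff.contDiffAt.comp z (contDiffAt_coe_chart hz)

theorem extChartAt_bundle_symm_apply (p : M × S3)
    (y : EuclideanSpace ℝ (Fin 3) × EuclideanSpace ℝ (Fin 3)) :
    (extChartAt bundleModel p).symm y =
      ((extChartAt (𝓡 3) p.1).symm y.1, (extChartAt (𝓡 3) p.2).symm y.2) := by
  rw [bundleModel, extChartAt_prod]; rfl

theorem extChartAt_bundle_apply (p q : M × S3) :
    extChartAt bundleModel p q = (extChartAt (𝓡 3) p.1 q.1, extChartAt (𝓡 3) p.2 q.2) := by
  rw [bundleModel, extChartAt_prod]; rfl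

theorem mem_extChartAt_bundle_target (p : M × S3)
    {y : EuclideanSpace ℝ (Fin 3) × EuclideanSpace ℝ (Fin 3)} :
    y ∈ (extChartAt bundleModel p).target ↔
      y.1 ∈ (extChartAt (𝓡 3) p.1).target ∧ y.2 ∈ (extChartAt (𝓡 3) p.2).target := by
  rw [bundleModel, extChartAt_prod]; rfl

theorem mfderiv_fst_chart [IsManifold (𝓡 3) ∞ M] (p : M × S3)
    {y : EuclideanSpace ℝ (Fin 3) × EuclideanSpace ℝ (Fin 3)}
    (hy : y ∈ (extChartAt bundleModel p).target) :
    (show EuclideanSpace ℝ (Fin 3) × EuclideanSpace ℝ (Fin 3) →L[ℝ] EuclideanSpace ℝ (Fin 3) from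
      mfderiv bundleModel (𝓡 3) (Prod.fst : M × S3 → M) ((extChartAt bundleModel p).symm y) ∘L
        mfderiv 𝓘(ℝ, EuclideanSpace ℝ (Fin 3) × EuclideanSpace ℝ (Fin 3)) bundleModel
          (extChartAt bundleModel p).symm y) =
      (show EuclideanSpace ℝ (Fin 3) →L[ℝ] EuclideanSpace ℝ (Fin 3) from
        mfderiv 𝓘(ℝ, EuclideanSpace ℝ (Fin 3)) (𝓡 3) (extChartAt (𝓡 3) p.1).symm y.1) ∘L
      ContinuousLinearMap.fst ℝ _ _ := by
  have : IsManifold (𝓡 3) 1 M := IsManifold.of_le (n := ∞) (by simp)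
  have h1 : MDifferentiableAt 𝓘(ℝ, EuclideanSpace ℝ (Fin 3) × EuclideanSpace ℝ (Fin 3)) bundleModel
      (extChartAt bundleModel p).symm y :=
    mdifferentiableAt_extChartAt_symm_of_boundaryless bundleModel hy
  have h2 : MDifferentiableAt bundleModel (𝓡 3) (Prod.fst : M × S3 → M)
    ((extChartAt bundleModel p).symm y) := mdifferentiableAt_fst
  have h3 : MDifferentiableAt 𝓘(ℝ, EuclideanSpace ℝ (Fin 3)) (𝓡 3) (extChartAt (𝓡 3) p.1).symm y.1 :=
    mdifferentiableAt_extChartAt_symm_of_boundaryless (𝓡 3)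
      ((mem_extChartAt_bundle_target p).1 hy).1
  have h4 : MDifferentiableAt 𝓘(ℝ, EuclideanSpace ℝ (Fin 3) × EuclideanSpace ℝ (Fin 3))
      𝓘(ℝ, EuclideanSpace ℝ (Fin 3))
      (Prod.fst : EuclideanSpace ℝ (Fin 3) × EuclideanSpace ℝ (Fin 3) → _) y :=
    differentiableAt_fst.mdifferentiableAt
  have h5 := mfderiv_comp y h2 h1
  have h6 := mfderiv_comp y h3 h4
  have h7 : (Prod.fst : M × S3 → M) ∘ (extChartAt bundleModel p).symm =
      (extChartAt (𝓡 3) p.1).symm ∘ Prod.fst := by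
    funext z
    rw [Function.comp_apply, extChartAt_bundle_symm_apply]; rfl
  rw [mfderiv_eq_fderiv, fderiv_fst, ← h7] at h6
  exact h5.symm.trans h6

theorem mdifferentiable_su2Matrix_snd :
    MDifferentiable bundleModel 𝓘(ℝ, Mat2) (fun q : M × S3 => su2Matrix q.2) := by
  intro q
  have := finrank_euclidean_four_fact
  have h1 : MDifferentiableAt bundleModel (𝓡 3) (Prod.snd : M × S3 → S3) q := mdifferentiableAt_snd
  have h2 : MDifferentiableAt (𝓡 3) 𝓘(ℝ, EuclideanSpace ℝ (Fin 4))
      (fun g : S3 => (g : EuclideanSpace ℝ (Fin 4))) q.2 :=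
    (contMDiff_coe_sphere (E := EuclideanSpace ℝ (Fin 4)) (n := 3) (m := 1)).mdifferentiable
      (by simp) q.2
  have h3 : MDifferentiableAt 𝓘(ℝ, EuclideanSpace ℝ (Fin 4)) 𝓘(ℝ, Mat2) su2MatrixCLM
      (q.2 : EuclideanSpace ℝ (Fin 4)) := su2MatrixCLM.differentiableAt.mdifferentiableAt
  exact (h3.comp q.2 h2).comp q h1

theorem mfderiv_su2Matrix_snd_chart [IsManifold (𝓡 3) ∞ M] (p : M × S3)
    {y : EuclideanSpace ℝ (Fin 3) × EuclideanSpace ℝ (Fin 3)}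
    (hy : y ∈ (extChartAt bundleModel p).target) :
    (show EuclideanSpace ℝ (Fin 3) × EuclideanSpace ℝ (Fin 3) →L[ℝ] Mat2 from
      mfderiv bundleModel 𝓘(ℝ, Mat2) (fun q : M × S3 => su2Matrix q.2)
          ((extChartAt bundleModel p).symm y) ∘L
        mfderiv 𝓘(ℝ, EuclideanSpace ℝ (Fin 3) × EuclideanSpace ℝ (Fin 3)) bundleModel
          (extChartAt bundleModel p).symm y) =
      fderiv ℝ (groupChart p.2) y.2 ∘L ContinuousLinearMap.snd ℝ _ _ := by
  have : IsManifold (𝓡 3) 1 M := IsManifold.of_le (n := ∞) (by simp)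
  have h1 : MDifferentiableAt 𝓘(ℝ, EuclideanSpace ℝ (Fin 3) × EuclideanSpace ℝ (Fin 3)) bundleModel
      (extChartAt bundleModel p).symm y :=
    mdifferentiableAt_extChartAt_symm_of_boundaryless bundleModel hy
  have h5 := mfderiv_comp y (mdifferentiable_su2Matrix_snd _) h1
  have h7 : (fun q : M × S3 => su2Matrix q.2) ∘ (extChartAt bundleModel p).symm =
      groupChart p.2 ∘ Prod.snd := by
    funext z
    rw [Function.comp_apply, extChartAt_bundle_symm_apply]; rfl
  have h8 : DifferentiableAt ℝ (groupChart p.2) y.2 :=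
    (contDiffAt_groupChart ((mem_extChartAt_bundle_target p).1 hy).2).differentiableAt (by simp)
  rw [h7, mfderiv_eq_fderiv, fderiv_comp y h8 differentiableAt_snd, fderiv_snd] at h5
  exact h5.symm

theorem liftForm_apply {k : ℕ} (α : DiffForm (𝓡 3) M k Mat2) (p : M × S3)
    (u : Fin k → TangentSpace bundleModel p) :
    liftForm α p u = (su2Matrix p.2)ᴴ * (α p.1 (fun i =>
      mfderiv bundleModel (𝓡 3) (Prod.fst : M × S3 → M) p (u i)) * su2Matrix p.2) := rfl

theorem chartForm_liftForm [IsManifold (𝓡 3) ∞ M] {k : ℕ} (α : DiffForm (𝓡 3) M k Mat2)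
    (p : M × S3) {y : EuclideanSpace ℝ (Fin 3) × EuclideanSpace ℝ (Fin 3)}
    (hy : y ∈ (extChartAt bundleModel p).target)
    (u : Fin k → EuclideanSpace ℝ (Fin 3) × EuclideanSpace ℝ (Fin 3)) :
    chartForm bundleModel (liftForm α) p y u = (groupChart p.2 y.2)ᴴ *
      (chartForm (𝓡 3) α p.1 y.1 (fun i => (u i).1) * groupChart p.2 y.2) := by
  rw [chartForm_apply, liftForm_apply]
  have h1 : ((extChartAt bundleModel p).symm y).2 = (extChartAt (𝓡 3) p.2).symm y.2 := by
    rw [extChartAt_bundle_symm_apply]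
  have h2 : ((extChartAt bundleModel p).symm y).1 = (extChartAt (𝓡 3) p.1).symm y.1 := by
    rw [extChartAt_bundle_symm_apply]
  have h3 := mfderiv_fst_chart p hy
  rw [h1, groupChart]
  congr 2
  exact diffForm_apply_congr (𝓡 3) α h2
    (funext fun i => congrArg (fun f : EuclideanSpace ℝ (Fin 3) × EuclideanSpace ℝ (Fin 3) →L[ℝ]
      EuclideanSpace ℝ (Fin 3) => f (u i)) h3)

theorem chartForm_maurerCartan [IsManifold (𝓡 3) ∞ M] (p : M × S3)
    {y : EuclideanSpace ℝ (Fin 3) × EuclideanSpace ℝ (Fin 3)}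
    (hy : y ∈ (extChartAt bundleModel p).target)
    (u : EuclideanSpace ℝ (Fin 3) × EuclideanSpace ℝ (Fin 3)) :
    chartForm bundleModel (maurerCartan M) p y ![u] = (groupChart p.2 y.2)ᴴ *
      fderiv ℝ (groupChart p.2) y.2 u.2 := by
  have h1 : ((extChartAt bundleModel p).symm y).2 = (extChartAt (𝓡 3) p.2).symm y.2 := by
    rw [extChartAt_bundle_symm_apply]
  have h3 := congrArg (fun f : EuclideanSpace ℝ (Fin 3) × EuclideanSpace ℝ (Fin 3) →L[ℝ]
      Mat2 => f u) (mfderiv_su2Matrix_snd_chart p hy)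
  rw [groupChart, ← h1]
  exact congrArg (fun X => (su2Matrix ((extChartAt bundleModel p).symm y).2)ᴴ * X) h3

end BundleCharts

/-! ### Vertical vectors, and the coframe (W, E) on the bundle. -/

section BundleGeometry

open Filter Topology

local notation "E3" => EuclideanSpace ℝ (Fin 3)
local notation "E4" => EuclideanSpace ℝ (Fin 4)

variable {M : Type*} [TopologicalSpace M] [ChartedSpace (EuclideanSpace ℝ (Fin 3)) M]

/-- The differential of the inclusion of the unit sphere. -/
noncomputable def sphereDiff (g : S3) : E3 →L[ℝ] E4 :=
  mvfderiv (𝓡 3) (fun g : S3 => (g : E4)) g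

theorem sphereDiff_injective (g : S3) : Function.Injective (sphereDiff g) := by
  have := finrank_euclidean_four_fact
  exact injective_mvfderiv_subtypeVal_sphere g

theorem inner_sphereDiff (g : S3) (t : E3) : inner ℝ (g : E4) (sphereDiff g t) = 0 := by
  have := finrank_euclidean_four_fact
  have h := range_mvfderiv_subtypeVal (n := 3) g
  rw [← Submodule.mem_orthogonal_singleton_iff_inner_right, ← h]
  exact LinearMap.mem_range_self _ t

/-- In terms of quaternions, the inner product is the real part of `q̄ t`. Its vanishing makes the
product purely imaginary, hence an element of su(2). -/
theorem isSu2_conjTranspose_mul_su2Matrix {q t : E4} (h : inner ℝ q t = 0) :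
    IsSu2 ((su2Matrix q)ᴴ * su2Matrix t) := by
  have h' : q 0 * t 0 + q 1 * t 1 + q 2 * t 2 + q 3 * t 3 = 0 := by
    rw [← h, PiLp.inner_apply]
    simp [Fin.sum_univ_four, mul_comm]
  constructor
  · ext i j
    fin_cases i <;> fin_cases j <;>
      simp [su2Matrix, Matrix.mul_apply, Fin.sum_univ_two, Complex.ext_iff] <;>
      constructor <;> linarith
  · simp [su2Matrix, Matrix.trace_fin_two, Matrix.mul_apply, Fin.sum_univ_two, Complex.ext_iff]
    constructor <;> linarith

theorem IsSu2.conj {X : Mat2} (hX : IsSu2 X) (g : S3) :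
    IsSu2 ((su2Matrix g)ᴴ * (X * su2Matrix g)) := by
  constructor
  · simp only [Matrix.conjTranspose_mul, Matrix.conjTranspose_conjTranspose, hX.1]
    noncomm_ring
  · rw [Matrix.trace_mul_comm, mul_assoc, su2Matrix_mul_conjTranspose, mul_one, hX.2]

theorem conj_su2Matrix_eq_zero_iff {X : Mat2} (g : S3) :
    (su2Matrix g)ᴴ * (X * su2Matrix g) = 0 ↔ X = 0 := by
  refine ⟨fun h => ?_, fun h => by simp [h]⟩
  have : X = su2Matrix g * ((su2Matrix g)ᴴ * (X * su2Matrix g)) * (su2Matrix g)ᴴ := by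
    simp only [← mul_assoc, su2Matrix_mul_conjTranspose, one_mul]
    rw [mul_assoc, su2Matrix_mul_conjTranspose, mul_one]
  rw [this, h]; simp

theorem mfderiv_fst_apply (p : M × S3) (ξ : TangentSpace bundleModel p) :
    (mfderiv bundleModel (𝓡 3) (Prod.fst : M × S3 → M) p ξ : TangentSpace (𝓡 3) p.1) =
      (tangentModel (𝓡 3) p.1).symm (tangentModel bundleModel p ξ).1 := by
  rw [bundleModel, mfderiv_fst]; rfl

theorem maurerCartan_apply (p : M × S3) (ξ : TangentSpace bundleModel p) :
    maurerCartan M p ![ξ] = (su2Matrix p.2)ᴴ *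
      su2Matrix (sphereDiff p.2 (tangentModel bundleModel p ξ).2) := by
  have := finrank_euclidean_four_fact
  have h1 : MDifferentiableAt bundleModel (𝓡 3) (Prod.snd : M × S3 → S3) p := mdifferentiableAt_snd
  have h2 : MDifferentiableAt (𝓡 3) 𝓘(ℝ, E4) (fun g : S3 => (g : E4)) p.2 :=
    (contMDiff_coe_sphere (E := E4) (n := 3) (m := 1)).mdifferentiable (by simp) p.2
  have h3 : MDifferentiableAt 𝓘(ℝ, E4) 𝓘(ℝ, Mat2) su2MatrixCLM (p.2 : E4) :=
    su2MatrixCLM.differentiableAt.mdifferentiableAt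
  have h4 := mfderiv_comp p (h3.comp p.2 h2) h1
  have h5 := mfderiv_comp p.2 h3 h2
  rw [mfderiv_eq_fderiv, ContinuousLinearMap.fderiv] at h5
  rw [h5, bundleModel, mfderiv_snd] at h4
  exact congrArg (fun f : E3 × E3 →L[ℝ] Mat2 => (su2Matrix p.2)ᴴ * f (tangentModel bundleModel p ξ))
    h4

theorem mem_verticalSpace_iff (p : M × S3) (ξ : TangentSpace bundleModel p) :
    ξ ∈ verticalSpace p ↔ (tangentModel bundleModel p ξ).1 = 0 := by
  have h : ξ ∈ verticalSpace p ↔ (mfderiv bundleModel (𝓡 3) (Prod.fst : M × S3 → M) p ξ :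
    TangentSpace (𝓡 3) p.1) = 0 := Iff.rfl
  rw [h, mfderiv_fst_apply, LinearEquiv.map_eq_zero_iff]

theorem isSu2_maurerCartan (p : M × S3) (ξ : TangentSpace bundleModel p) :
    IsSu2 (maurerCartan M p ![ξ]) := by
  rw [maurerCartan_apply]
  exact isSu2_conjTranspose_mul_su2Matrix (inner_sphereDiff _ _)

theorem maurerCartan_eq_zero_iff (p : M × S3) (ξ : TangentSpace bundleModel p) :
    maurerCartan M p ![ξ] = 0 ↔ (tangentModel bundleModel p ξ).2 = 0 := by
  rw [maurerCartan_apply]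
  have h2 : su2Matrix 0 = 0 := by rw [← su2MatrixCLM_apply, map_zero]
  refine ⟨fun h => ?_, fun h => by rw [h, map_zero, h2, mul_zero]⟩
  have h1 := congrArg (su2Matrix p.2 * ·) h
  simp only [← mul_assoc, su2Matrix_mul_conjTranspose, one_mul, mul_zero] at h1
  exact sphereDiff_injective p.2 (by rw [su2Matrix_injective (h1.trans h2.symm), map_zero])

theorem liftForm_apply_one (α : DiffForm (𝓡 3) M 1 Mat2) (p : M × S3)
    (ξ : TangentSpace bundleModel p) :
    liftForm α p ![ξ] = (su2Matrix p.2)ᴴ * (α p.1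
      ![(tangentModel (𝓡 3) p.1).symm (tangentModel bundleModel p ξ).1] * su2Matrix p.2) := by
  rw [liftForm_apply, ← mfderiv_fst_apply]
  congr 3
  exact vec_one_map (mfderiv bundleModel (𝓡 3) (Prod.fst : M × S3 → M) p) ξ

theorem liftForm_apply_of_mem_verticalSpace (α : DiffForm (𝓡 3) M 1 Mat2) {p : M × S3}
    {ξ : TangentSpace bundleModel p} (hξ : ξ ∈ verticalSpace p) : liftForm α p ![ξ] = 0 := by
  rw [liftForm_apply_one, (mem_verticalSpace_iff p ξ).1 hξ, map_zero,
    conj_su2Matrix_eq_zero_iff]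
  exact (oneFormLin (α p.1)).map_zero

/-- The frame volume is a multiple of the determinant of the components of `e`. Where it is nonzero,
`e` maps onto su(2), and both spaces have dimension three. -/
theorem frame_injective {e : DiffForm (𝓡 3) M 1 Mat2} (hesu : IsSu2Valued (𝓡 3) e) {x : M}
    (hx : frameVolume (e x) ≠ 0) {ξ : TangentSpace (𝓡 3) x} (hξ : e x ![ξ] = 0) : ξ = 0 := by
  obtain ⟨u, hu⟩ : ∃ u, frameVolume (e x) u ≠ 0 := by
    by_contra! h
    exact hx (ContinuousAlternatingMap.ext h)
  rw [frameVolume_apply, trBracket_su2 (hesu x _) (hesu x _) (hesu x _)] at hu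
  let f : TangentSpace (𝓡 3) x →ₗ[ℝ] (Fin 3 → ℝ) := su2Coord ∘ₗ oneFormLin (e x)
  have hli : LinearIndependent ℝ (fun i => f (u i)) := by
    have h1 : IsUnit (Matrix.of ![f (u 0), f (u 1), f (u 2)]) := by
      rw [Matrix.isUnit_iff_isUnit_det, isUnit_iff_ne_zero]
      intro h0
      apply hu
      have h0' : (Matrix.of ![su2Coord (e x ![u 0]), su2Coord (e x ![u 1]),
        su2Coord (e x ![u 2])]).det = 0 := h0
      rw [h0']; simp
    convert Matrix.linearIndependent_rows_of_isUnit h1 using 1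
    ext i j
    fin_cases i <;> rfl
  have hsurj : Function.Surjective f := by
    rw [← LinearMap.range_eq_top, ← top_le_iff,
      ← hli.span_eq_top_of_card_eq_finrank (by simp), Submodule.span_le]
    rintro _ ⟨i, rfl⟩
    exact LinearMap.mem_range_self f (u i)
  have hinj := (LinearMap.injective_iff_surjective_of_finrank_eq_finrank
    (by rw [finrank_tangentSpace_three]; simp)).2 hsurj
  apply hinj
  have : f ξ = su2Coord (e x ![ξ]) := rfl
  rw [this, hξ, map_zero, map_zero]

theorem finrank_tangentSpace_bundle (p : M × S3) :
    Module.finrank ℝ (TangentSpace bundleModel p) = 6 :=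
  (tangentModel bundleModel p).finrank_eq.trans (by simp)

theorem liftConnection_apply (w : DiffForm (𝓡 3) M 1 Mat2) (p : M × S3)
    (u : Fin 1 → TangentSpace bundleModel p) :
    liftConnection w p u = liftForm w p u + maurerCartan M p u := rfl

/-- A vector killed by E is vertical since `e` is injective. On vertical vectors W is the
Maurer-Cartan form, which is injective there. -/
theorem isCoframe_lift {w e : DiffForm (𝓡 3) M 1 Mat2} (hwsu : IsSu2Valued (𝓡 3) w)
    (hesu : IsSu2Valued (𝓡 3) e) (hframe : ∀ x : M, frameVolume (e x) ≠ 0) (p : M × S3) :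
    IsCoframe (liftConnection w p) (liftForm e p) where
  su2_left ξ := by
    rw [liftConnection_apply, liftForm_apply_one]
    exact (IsSu2.conj (hwsu _ _) _).add (isSu2_maurerCartan p ξ)
  su2_right ξ := by
    rw [liftForm_apply_one]
    exact IsSu2.conj (hesu _ _) _
  eq_zero ξ h1 h2 := by
    rw [liftForm_apply_one, conj_su2Matrix_eq_zero_iff] at h2
    have h3 := frame_injective hesu (hframe p.1) h2
    rw [LinearEquiv.map_eq_zero_iff] at h3
    rw [liftConnection_apply,
      liftForm_apply_of_mem_verticalSpace w ((mem_verticalSpace_iff p ξ).2 h3), zero_add,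
      maurerCartan_eq_zero_iff] at h1
    exact (tangentModel bundleModel p).map_eq_zero_iff.1 (Prod.ext h3 h1)
  finrank_eq := finrank_tangentSpace_bundle p

theorem liftForm_eq_zero_iff {e : DiffForm (𝓡 3) M 1 Mat2} (hesu : IsSu2Valued (𝓡 3) e)
    (hframe : ∀ x : M, frameVolume (e x) ≠ 0) (p : M × S3) (ξ : TangentSpace bundleModel p) :
    liftForm e p ![ξ] = 0 ↔ ξ ∈ verticalSpace p := by
  refine ⟨fun h2 => ?_, liftForm_apply_of_mem_verticalSpace e⟩
  rw [liftForm_apply_one, conj_su2Matrix_eq_zero_iff] at h2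
  have h3 := frame_injective hesu (hframe p.1) h2
  rwa [LinearEquiv.map_eq_zero_iff, ← mem_verticalSpace_iff] at h3

end BundleGeometry

/-! ### Linear algebra of an endomorphism that exchanges W - r E and E. -/

section AlmostComplexStructure

variable {V : Type*} [AddCommGroup V] [Module ℝ V] [TopologicalSpace V]

/-- The endomorphism `J` exchanges the connection `W - r E` and the frame `E`, up to factors. -/
structure IsAdapted (W E : V [⋀^Fin 1]→L[ℝ] Mat2) (r c : ℝ) (J : V →ₗ[ℝ] V) : Prop where
  coframe : IsCoframe W E
  coeff : c ^ 2 * (1 - r ^ 2) = 1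
  left : ∀ ξ, W ![J ξ] - r • E ![J ξ] = (c * (1 - r ^ 2)) • E ![ξ]
  right : ∀ ξ, E ![J ξ] = -c • (W ![ξ] - r • E ![ξ])

/-- The sign is absorbed in `c = ε / √(1 - r²)`. The connection and the frame only use `c² (1 - r²)
= 1`, so they do not depend on the orientation. -/
theorem IsCoframe.exists_isAdapted_hitchinJVec [IsTopologicalAddGroup V] [ContinuousSMul ℝ V]
    [FiniteDimensional ℝ V] [T2Space V] {W E : V [⋀^Fin 1]→L[ℝ] Mat2} (hWE : IsCoframe W E)
    {r : ℝ} (hr : |r| < 1) {v : V [⋀^Fin 6]→L[ℝ] ℝ} (hv : v ≠ 0) :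
    ∃ c : ℝ, IsAdapted W E r c (hitchinJVec v (pointForm W E r)) := by
  obtain ⟨b, hb⟩ := exists_apply_ne_zero hv
  have h0 := hWE.coframeRatio_ne_zero hb
  obtain ⟨ε, hε, hpos⟩ : ∃ ε : ℝ, ε ^ 2 = 1 ∧ 0 < ε * coframeRatio v W E b := by
    rcases lt_or_gt_of_ne h0 with h | h
    · exact ⟨-1, by norm_num, by linarith⟩
    · exact ⟨1, by norm_num, by linarith⟩
  have hs := sqrt_one_sub_sq_pos hr
  have hs2 := sq_sqrt_one_sub_sq hr
  refine ⟨ε / Real.sqrt (1 - r ^ 2), hWE, ?_, fun ξ => ?_, fun ξ => ?_⟩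
  · rw [div_pow, hs2, hε, one_div_mul_cancel (by rw [← hs2]; positivity)]
  · obtain ⟨h1, h2⟩ := hWE.hitchinJVec_apply hr hb hε hpos ξ
    rw [h1, h2]
    module
  · obtain ⟨h1, h2⟩ := hWE.hitchinJVec_apply hr hb hε hpos ξ
    rw [h2]
    module

namespace IsAdapted

variable {W E : V [⋀^Fin 1]→L[ℝ] Mat2} {r c : ℝ} {J : V →ₗ[ℝ] V}

theorem ext (hA : IsAdapted W E r c J) {ξ η : V}
    (h1 : W ![ξ] - r • E ![ξ] = W ![η] - r • E ![η]) (h2 : E ![ξ] = E ![η]) : ξ = η :=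
  hA.coframe.ext (by rw [h2] at h1; exact sub_left_injective h1) h2

theorem apply_apply (hA : IsAdapted W E r c J) (ξ : V) : J (J ξ) = -ξ := by
  have hc := hA.coeff
  have hn : ∀ α : V [⋀^Fin 1]→L[ℝ] Mat2, α ![-ξ] = -α ![ξ] := fun α => by
    rw [← neg_one_smul ℝ ξ, oneForm_map_smul, neg_one_smul]
  apply hA.ext
  · rw [hA.left, hA.right, hn, hn, smul_smul,
      show c * (1 - r ^ 2) * -c = -(c ^ 2 * (1 - r ^ 2)) by ring, hc]
    module
  · rw [hA.right, hA.left, hn, smul_smul,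
      show -c * (c * (1 - r ^ 2)) = -(c ^ 2 * (1 - r ^ 2)) by ring, hc]
    module

/-- J carries the kernel of E into the kernel of `W - r E`, and conversely; `J² = -1` supplies the
preimage. -/
theorem mem_map_iff (hA : IsAdapted W E r c J) {S : Submodule ℝ V}
    (hS : ∀ ξ, E ![ξ] = 0 ↔ ξ ∈ S) (ξ : V) : ξ ∈ S.map J ↔ W ![ξ] - r • E ![ξ] = 0 := by
  constructor
  · rintro ⟨η, hη, rfl⟩
    rw [hA.left, (hS η).2 hη, smul_zero]
  · intro h
    refine ⟨-J ξ, S.neg_mem ((hS _).1 ?_), by rw [map_neg, hA.apply_apply, neg_neg]⟩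
    rw [hA.right, h, smul_zero]

theorem map_mem (hA : IsAdapted W E r c J) {S : Submodule ℝ V}
    (hS : ∀ ξ, E ![ξ] = 0 ↔ ξ ∈ S) {ξ : V} (hξ : ξ ∈ S.map J) : J ξ ∈ S := by
  rw [← hS, hA.right, (hA.mem_map_iff hS ξ).1 hξ, smul_zero]

theorem isCompl (hA : IsAdapted W E r c J) {S : Submodule ℝ V}
    (hS : ∀ ξ, E ![ξ] = 0 ↔ ξ ∈ S) : IsCompl S (S.map J) := by
  have hz : ∀ α : V [⋀^Fin 1]→L[ℝ] Mat2, α ![0] = 0 := fun α => (oneFormLin α).map_zero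
  constructor
  · rw [Submodule.disjoint_def]
    intro ξ h1 h2
    rw [hA.mem_map_iff hS] at h2
    rw [← hS] at h1
    exact hA.ext (by rw [h2, hz, hz, smul_zero, sub_zero]) (by rw [h1, hz])
  · rw [codisjoint_iff, Submodule.eq_top_iff']
    intro ξ
    -- The vertical part of `ξ`: it has the same value of `W - r E` and no E-component, so `ξ - a`
    -- lies in the image of `S`.
    obtain ⟨a, ha, ha'⟩ := hA.coframe.exists_apply_eq
      ((hA.coframe.su2_left ξ).sub ((hA.coframe.su2_right ξ).smul r)) isSu2_zero
    refine Submodule.mem_sup.2 ⟨a, (hS a).1 ha', ξ - a, ?_, by abel⟩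
    rw [hA.mem_map_iff hS]
    have hsub : ∀ α : V [⋀^Fin 1]→L[ℝ] Mat2, α ![ξ - a] = α ![ξ] - α ![a] := fun α =>
      (oneFormLin α).map_sub ξ a
    rw [hsub, hsub, ha, ha']
    module

/-- On horizontal vectors `W ∘ J = c (1 - r²) E`, and `c² (1 - r²)² = 1 - r²`. This is the square of
the factor in E_J. -/
theorem frame_mul (hA : IsAdapted W E r c J) {S : Submodule ℝ V}
    (hS : ∀ ξ, E ![ξ] = 0 ↔ ξ ∈ S) {ξ η : V} (hξ : ξ ∈ S.map J) (hη : η ∈ S.map J) :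
    W ![J ξ] * W ![J η] = (1 - r ^ 2) • (E ![ξ] * E ![η]) := by
  have h : ∀ ζ ∈ S.map J, W ![J ζ] = (c * (1 - r ^ 2)) • E ![ζ] := fun ζ hζ => by
    rw [← hA.left, (hS _).2 (hA.map_mem hS hζ), smul_zero, sub_zero]
  rw [h ξ hξ, h η hη, smul_mul_smul_comm]
  congr 1
  linear_combination (1 - r ^ 2) * hA.coeff

end IsAdapted

end AlmostComplexStructure

/-! ### The connection and the frame determined by J. -/

section Determined

variable {M : Type*} [TopologicalSpace M] [ChartedSpace (EuclideanSpace ℝ (Fin 3)) M]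

theorem liftForm_smul {K : Type*} [NormedField K] [NormedAlgebra ℝ K] [NormedAlgebra K Mat2]
    [IsScalarTower ℝ K Mat2] {k : ℕ} (f : M → K) (e : DiffForm (𝓡 3) M k Mat2) :
    liftForm (fun x => f x • e x) = fun p => f p.1 • liftForm e p := by
  funext p
  ext1 u
  rw [liftForm_apply, ContinuousAlternatingMap.smul_apply, ContinuousAlternatingMap.smul_apply,
    liftForm_apply, smul_mul_assoc, mul_smul_comm]

/-- The scalar field `K` is ℝ for `w - ρ e` and ℂ for the connection `w - ζ e`. -/
theorem liftConnection_sub_smul {K : Type*} [NormedField K] [NormedAlgebra ℝ K]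
    [NormedAlgebra K Mat2] [IsScalarTower ℝ K Mat2] (w e : DiffForm (𝓡 3) M 1 Mat2) (f : M → K) :
    liftConnection (fun x => w x - f x • e x) =
      fun p => liftConnection w p - f p.1 • liftForm e p := by
  funext p
  ext1 u
  have h1 : liftForm (fun x => w x - f x • e x) p u =
      liftForm w p u - f p.1 • liftForm e p u := by
    rw [liftForm_apply, liftForm_apply, liftForm_apply, ContinuousAlternatingMap.sub_apply,
      ContinuousAlternatingMap.smul_apply, sub_mul, mul_sub, smul_mul_assoc, mul_smul_comm]
  rw [ContinuousAlternatingMap.sub_apply, ContinuousAlternatingMap.smul_apply,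
    liftConnection_apply, liftConnection_apply, h1]
  abel

variable {w e : DiffForm (𝓡 3) M 1 Mat2} {ρ : M → ℝ}
  {v : DiffForm bundleModel (M × S3) 6 ℝ}

theorem determinesConnection_lift (hwsu : IsSu2Valued (𝓡 3) w) (hesu : IsSu2Valued (𝓡 3) e)
    (hframe : ∀ x : M, frameVolume (e x) ≠ 0) (hv0 : ∀ p : M × S3, v p ≠ 0)
    (hρ : ∀ x, |ρ x| < 1) :
    DeterminesConnection
      (fun p => hitchinJVec (v p) (reducedForm (liftConnection w) (liftForm e) ρ p))
      (fun p => liftConnection w p - ρ p.1 • liftForm e p) := by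
  intro p
  obtain ⟨c, hA⟩ := (isCoframe_lift hwsu hesu hframe p).exists_isAdapted_hitchinJVec
    (hρ p.1) (hv0 p)
  have hS := liftForm_eq_zero_iff hesu hframe p
  refine ⟨hA.isCompl hS, fun ξ => (hA.mem_map_iff hS ξ).symm, fun ξ hξ => ?_⟩
  rw [ContinuousAlternatingMap.sub_apply, ContinuousAlternatingMap.smul_apply, (hS ξ).2 hξ,
    smul_zero, sub_zero, liftConnection_apply, liftForm_apply_of_mem_verticalSpace w hξ, zero_add]

theorem determinesFrame_lift (hwsu : IsSu2Valued (𝓡 3) w) (hesu : IsSu2Valued (𝓡 3) e)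
    (hframe : ∀ x : M, frameVolume (e x) ≠ 0) (hv0 : ∀ p : M × S3, v p ≠ 0)
    (hρ : ∀ x, |ρ x| < 1) :
    DeterminesFrame
      (fun p => hitchinJVec (v p) (reducedForm (liftConnection w) (liftForm e) ρ p))
      (fun p => Real.sqrt (1 - ρ p.1 ^ 2) • liftForm e p) := by
  intro p
  obtain ⟨c, hA⟩ := (isCoframe_lift hwsu hesu hframe p).exists_isAdapted_hitchinJVec
    (hρ p.1) (hv0 p)
  have hS := liftForm_eq_zero_iff hesu hframe p
  have hm : ∀ ξ ∈ verticalSpace p, maurerCartan M p ![ξ] = liftConnection w p ![ξ] := fun ξ hξ => by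
    rw [liftConnection_apply, liftForm_apply_of_mem_verticalSpace w hξ, zero_add]
  refine ⟨fun ξ hξ => ?_, fun ξ hξ => hA.map_mem hS hξ, fun ξ hξ η hη => ?_⟩
  · rw [ContinuousAlternatingMap.smul_apply, (hS ξ).2 hξ, smul_zero]
  · have h1 := hA.frame_mul hS hξ hη
    rw [← hm _ (hA.map_mem hS hξ), ← hm _ (hA.map_mem hS hη)] at h1
    refine (congrArg (fun X => -2 * reTr X) h1).trans ?_
    simp only [ContinuousAlternatingMap.smul_apply, smul_mul_smul_comm, ← pow_two,
      sq_sqrt_one_sub_sq (hρ p.1)]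

end Determined

/-! ### Exterior derivatives of one-forms and sums. -/

section FormCalculus

open Filter Topology

variable {E H N : Type*} [NormedAddCommGroup E] [NormedSpace ℝ E] [TopologicalSpace H]
  [TopologicalSpace N] [ChartedSpace H N] {F : Type*} [NormedAddCommGroup F] [NormedSpace ℝ F]
  {k : ℕ}

/-- Differentiability at `x` of the coordinate expression of a form in the chart at `x`. -/
def FormDiffAt (I : ModelWithCorners ℝ E H) (α : DiffForm I N k F) (x : N) : Prop :=
  DifferentiableAt ℝ (chartForm I α x) (extChartAt I x x)

theorem IsSmoothForm.formDiffAt {I : ModelWithCorners ℝ E H} [I.Boundaryless]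
    {α : DiffForm I N k F} (hα : IsSmoothForm I α) (x : N) : FormDiffAt I α x :=
  hα.differentiableAt_apply x

theorem extDeriv_one_apply {f : E → E [⋀^Fin 1]→L[ℝ] F} {y : E} (hf : DifferentiableAt ℝ f y)
    (u : Fin 2 → E) : extDeriv f y u =
      fderiv ℝ (fun z => f z ![u 1]) y (u 0) - fderiv ℝ (fun z => f z ![u 0]) y (u 1) := by
  have h0 : (Fin.removeNth 0 u : Fin 1 → E) = ![u 1] := by ext i; fin_cases i; rfl
  have h1 : (Fin.removeNth 1 u : Fin 1 → E) = ![u 0] := by ext i; fin_cases i; rfl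
  rw [extDeriv_apply hf, Fin.sum_univ_two, h0, h1]
  simp [sub_eq_add_neg]

theorem extD_one_apply {I : ModelWithCorners ℝ E H} [I.Boundaryless] [IsManifold I 1 N]
    {α : DiffForm I N 1 F} {x : N} (hα : FormDiffAt I α x) (u : Fin 2 → TangentSpace I x) :
    extD I α x u =
      fderiv ℝ (fun z => chartForm I α x z ![tangentModel I x (u 1)]) (extChartAt I x x)
        (tangentModel I x (u 0)) -
      fderiv ℝ (fun z => chartForm I α x z ![tangentModel I x (u 0)]) (extChartAt I x x)
        (tangentModel I x (u 1)) := by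
  rw [extD_apply, extDeriv_one_apply hα]

theorem chartForm_self_one (I : ModelWithCorners ℝ E H) [I.Boundaryless] [IsManifold I 1 N]
    (α : DiffForm I N 1 F) (x : N) (ξ : TangentSpace I x) :
    chartForm I α x (extChartAt I x x) ![tangentModel I x ξ] = α x ![ξ] := by
  rw [← chartForm_self, vec_one_map]

theorem FormDiffAt.add {I : ModelWithCorners ℝ E H} {α β : DiffForm I N k F} {x : N}
    (hα : FormDiffAt I α x) (hβ : FormDiffAt I β x) : FormDiffAt I (fun x => α x + β x) x :=
  DifferentiableAt.add hα hβ

theorem extD_add {I : ModelWithCorners ℝ E H} [I.Boundaryless] [IsManifold I 1 N]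
    {α β : DiffForm I N k F} {x : N}
    (hα : FormDiffAt I α x) (hβ : FormDiffAt I β x) :
    extD I (fun x => α x + β x) x = extD I α x + extD I β x := by
  ext u
  rw [ContinuousAlternatingMap.add_apply, extD_apply, extD_apply, extD_apply]
  have : chartForm I (fun x => α x + β x) x = chartForm I α x + chartForm I β x := rfl
  rw [this, extDeriv_add hα hβ, ContinuousAlternatingMap.add_apply]

end FormCalculus

/-! ### Covariant derivative and curvature of lifts. -/

section LiftCalculus

open Filter Topology

variable {M : Type*} [TopologicalSpace M] [ChartedSpace (EuclideanSpace ℝ (Fin 3)) M]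

/-- The conjugate transpose as a continuous real-linear map. -/
noncomputable def conjTransposeCLM : Mat2 →L[ℝ] Mat2 :=
  LinearMap.toContinuousLinearMap
    { toFun := fun X => Xᴴ
      map_add' := fun X Y => Matrix.conjTranspose_add X Y
      map_smul' := fun c X => by simp [Matrix.conjTranspose_smul] }

theorem conjTransposeCLM_apply (X : Mat2) : conjTransposeCLM X = Xᴴ := rfl

theorem groupChart_self (g : S3) : groupChart g (extChartAt (𝓡 3) g g) = su2Matrix g := by
  rw [groupChart, extChartAt_to_inv]

theorem extChartAt_bundle_self (p : M × S3) : extChartAt bundleModel p p =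
    (extChartAt (𝓡 3) p.1 p.1, extChartAt (𝓡 3) p.2 p.2) := extChartAt_bundle_apply p p

theorem liftForm_mul_liftForm (X Y : Mat2) (g : S3) :
    (su2Matrix g)ᴴ * (X * su2Matrix g) * ((su2Matrix g)ᴴ * (Y * su2Matrix g)) =
      (su2Matrix g)ᴴ * (X * Y * su2Matrix g) := by
  have hg := su2Matrix_mul_conjTranspose g
  calc _ = (su2Matrix g)ᴴ * X * (su2Matrix g * (su2Matrix g)ᴴ) * Y * su2Matrix g := by
        noncomm_ring
    _ = _ := by rw [hg]; noncomm_ring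

theorem liftForm_wedge (α β : DiffForm (𝓡 3) M 1 Mat2) (p : M × S3) :
    liftForm (fun x => α x ⋏ β x) p = liftForm α p ⋏ liftForm β p := by
  ext1 u
  rw [liftForm_apply, wedge_one_one_apply, wedge_one_one_apply]
  simp only [liftForm_apply_one, liftForm_mul_liftForm, ← mfderiv_fst_apply]
  rw [sub_mul, mul_sub]

theorem liftForm_add {k : ℕ} (α β : DiffForm (𝓡 3) M k Mat2) (p : M × S3) :
    liftForm (fun x => α x + β x) p = liftForm α p + liftForm β p := by
  ext1 u
  rw [ContinuousAlternatingMap.add_apply, liftForm_apply, liftForm_apply, liftForm_apply,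
    ContinuousAlternatingMap.add_apply, add_mul, mul_add]

theorem hasFDerivAt_groupChart_comp (p : M × S3) :
    HasFDerivAt (fun y : EuclideanSpace ℝ (Fin 3) × EuclideanSpace ℝ (Fin 3) =>
      groupChart p.2 y.2) (fderiv ℝ (groupChart p.2) (extChartAt (𝓡 3) p.2 p.2) ∘L
        ContinuousLinearMap.snd ℝ _ _) (extChartAt bundleModel p p) := by
  rw [extChartAt_bundle_self]
  have h1 : DifferentiableAt ℝ (groupChart p.2) (extChartAt (𝓡 3) p.2 p.2) :=
    (contDiffAt_groupChart (mem_extChartAt_target p.2)).differentiableAt (by simp)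
  exact HasFDerivAt.comp (g := groupChart p.2) (f := Prod.snd)
    (extChartAt (𝓡 3) p.1 p.1, extChartAt (𝓡 3) p.2 p.2) h1.hasFDerivAt hasFDerivAt_snd

variable [IsManifold (𝓡 3) ∞ M]

theorem fderiv_groupChart_self (p : M × S3) (ξ : TangentSpace bundleModel p) :
    fderiv ℝ (groupChart p.2) (extChartAt (𝓡 3) p.2 p.2) (tangentModel bundleModel p ξ).2 =
      su2Matrix p.2 * maurerCartan M p ![ξ] := by
  have : IsManifold (𝓡 3) 1 M := IsManifold.of_le (n := ∞) (by simp)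
  have h1 := chartForm_maurerCartan p (mem_extChartAt_target (I := bundleModel) p)
    (tangentModel bundleModel p ξ)
  rw [chartForm_self_one, extChartAt_bundle_self, groupChart_self] at h1
  rw [h1, ← mul_assoc, su2Matrix_mul_conjTranspose, one_mul]

theorem hasFDerivAt_chartForm_liftForm {α : DiffForm (𝓡 3) M 1 Mat2} {p : M × S3}
    (hα : FormDiffAt (𝓡 3) α p.1) (u : EuclideanSpace ℝ (Fin 3) × EuclideanSpace ℝ (Fin 3)) :
    ∃ T : EuclideanSpace ℝ (Fin 3) × EuclideanSpace ℝ (Fin 3) →L[ℝ] Mat2,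
      HasFDerivAt (fun y => chartForm bundleModel (liftForm α) p y ![u]) T
        (extChartAt bundleModel p p) ∧
      ∀ t, T t = (fderiv ℝ (groupChart p.2) (extChartAt (𝓡 3) p.2 p.2) t.2)ᴴ *
          (chartForm (𝓡 3) α p.1 (extChartAt (𝓡 3) p.1 p.1) ![u.1] * su2Matrix p.2) +
        (su2Matrix p.2)ᴴ *
          (fderiv ℝ (fun z => chartForm (𝓡 3) α p.1 z ![u.1]) (extChartAt (𝓡 3) p.1 p.1) t.1 *
            su2Matrix p.2) +
        (su2Matrix p.2)ᴴ * (chartForm (𝓡 3) α p.1 (extChartAt (𝓡 3) p.1 p.1) ![u.1] *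
          fderiv ℝ (groupChart p.2) (extChartAt (𝓡 3) p.2 p.2) t.2) := by
  have hG := hasFDerivAt_groupChart_comp p
  have hG' := conjTransposeCLM.hasFDerivAt.comp _ hG
  have ha : HasFDerivAt (fun y : EuclideanSpace ℝ (Fin 3) × EuclideanSpace ℝ (Fin 3) =>
      chartForm (𝓡 3) α p.1 y.1 ![u.1])
      (fderiv ℝ (fun z => chartForm (𝓡 3) α p.1 z ![u.1]) (extChartAt (𝓡 3) p.1 p.1) ∘L
        ContinuousLinearMap.fst ℝ _ _) (extChartAt bundleModel p p) := by
    rw [extChartAt_bundle_self]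
    exact HasFDerivAt.comp (g := fun z => chartForm (𝓡 3) α p.1 z ![u.1]) (f := Prod.fst)
      (extChartAt (𝓡 3) p.1 p.1, extChartAt (𝓡 3) p.2 p.2)
      (differentiableAt_form_iff.1 hα ![u.1]).hasFDerivAt hasFDerivAt_fst
  have h1 := hG'.mul' (ha.mul' hG)
  refine ⟨_, h1.congr_of_eventuallyEq ?_, fun t => ?_⟩
  · filter_upwards [extChartAt_target_mem_nhds (I := bundleModel) p] with y hy
    rw [chartForm_liftForm α p hy, vec_one_map]
    rfl
  · have h2 : groupChart p.2 (extChartAt bundleModel p p).2 = su2Matrix p.2 := by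
      rw [extChartAt_bundle_self, groupChart_self]
    have h3 : (extChartAt bundleModel p p).1 = extChartAt (𝓡 3) p.1 p.1 := by
      rw [extChartAt_bundle_self]
    simp only [add_apply, smul_apply,
      ContinuousLinearMap.comp_apply, conjTransposeCLM_apply, Function.comp_apply, Pi.mul_apply,
      ContinuousLinearMap.coe_fst', ContinuousLinearMap.coe_snd', MulOpposite.smul_eq_mul_unop,
      MulOpposite.unop_op, smul_eq_mul, h2, h3, mul_add]
    abel

theorem conj_chartForm_eq (α : DiffForm (𝓡 3) M 1 Mat2) (p : M × S3)
    (ξ : TangentSpace bundleModel p) :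
    (su2Matrix p.2)ᴴ * (chartForm (𝓡 3) α p.1 (extChartAt (𝓡 3) p.1 p.1)
      ![(tangentModel bundleModel p ξ).1] * su2Matrix p.2) = liftForm α p ![ξ] := by
  have : IsManifold (𝓡 3) 1 M := IsManifold.of_le (n := ∞) (by simp)
  rw [liftForm_apply_one, ← chartForm_self_one, LinearEquiv.apply_symm_apply]

/-- Since `dg = g m` and, `m` being antihermitian, `dgᴴ = -m gᴴ`, differentiating the conjugation by
`g` produces a commutator with `m`. -/
theorem fderiv_chartForm_liftForm {α : DiffForm (𝓡 3) M 1 Mat2} {p : M × S3}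
    (hα : FormDiffAt (𝓡 3) α p.1) (τ ξ : TangentSpace bundleModel p) :
    fderiv ℝ (fun y => chartForm bundleModel (liftForm α) p y ![tangentModel bundleModel p ξ])
        (extChartAt bundleModel p p) (tangentModel bundleModel p τ) =
      (su2Matrix p.2)ᴴ * (fderiv ℝ (fun z => chartForm (𝓡 3) α p.1 z
        ![(tangentModel bundleModel p ξ).1]) (extChartAt (𝓡 3) p.1 p.1)
          (tangentModel bundleModel p τ).1 * su2Matrix p.2) +
        (liftForm α p ![ξ] * maurerCartan M p ![τ] - maurerCartan M p ![τ] * liftForm α p ![ξ]) := by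
  obtain ⟨T, hT, hT'⟩ := hasFDerivAt_chartForm_liftForm hα (tangentModel bundleModel p ξ)
  rw [hT.fderiv, hT', fderiv_groupChart_self, ← conj_chartForm_eq, Matrix.conjTranspose_mul,
    (isSu2_maurerCartan p τ).1]
  noncomm_ring

theorem FormDiffAt.liftForm {α : DiffForm (𝓡 3) M 1 Mat2} {p : M × S3}
    (hα : FormDiffAt (𝓡 3) α p.1) : FormDiffAt bundleModel (liftForm α) p := by
  rw [FormDiffAt, differentiableAt_form_iff]
  intro u
  obtain ⟨T, hT, -⟩ := hasFDerivAt_chartForm_liftForm hα (u 0)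
  have hu : u = ![u 0] := by ext1 i; fin_cases i; rfl
  rw [hu]
  exact hT.differentiableAt

theorem extD_liftForm {α : DiffForm (𝓡 3) M 1 Mat2} {p : M × S3}
    (hα : FormDiffAt (𝓡 3) α p.1) (u : Fin 2 → TangentSpace bundleModel p) :
    extD bundleModel (liftForm α) p u = _root_.liftForm (extD (𝓡 3) α) p u +
      (liftForm α p ![u 1] * maurerCartan M p ![u 0] - maurerCartan M p ![u 0] * liftForm α p ![u 1])
      - (liftForm α p ![u 0] * maurerCartan M p ![u 1] -
        maurerCartan M p ![u 1] * liftForm α p ![u 0]) := by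
  have : IsManifold (𝓡 3) 1 M := IsManifold.of_le (n := ∞) (by simp)
  have h1 : ∀ i, tangentModel (𝓡 3) p.1 (mfderiv bundleModel (𝓡 3) (Prod.fst : M × S3 → M) p (u i))
      = (tangentModel bundleModel p (u i)).1 := fun i => by
    rw [mfderiv_fst_apply, LinearEquiv.apply_symm_apply]
  rw [extD_one_apply hα.liftForm, fderiv_chartForm_liftForm hα, fderiv_chartForm_liftForm hα,
    liftForm_apply (extD (𝓡 3) α), extD_one_apply hα, h1, h1]
  noncomm_ring

theorem hasFDerivAt_chartForm_maurerCartan (p : M × S3)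
    (u : EuclideanSpace ℝ (Fin 3) × EuclideanSpace ℝ (Fin 3)) :
    ∃ T : EuclideanSpace ℝ (Fin 3) × EuclideanSpace ℝ (Fin 3) →L[ℝ] Mat2,
      HasFDerivAt (fun y => chartForm bundleModel (maurerCartan M) p y ![u]) T
        (extChartAt bundleModel p p) ∧
      ∀ t, T t = (fderiv ℝ (groupChart p.2) (extChartAt (𝓡 3) p.2 p.2) t.2)ᴴ *
          fderiv ℝ (groupChart p.2) (extChartAt (𝓡 3) p.2 p.2) u.2 +
        (su2Matrix p.2)ᴴ *
          fderiv ℝ (fderiv ℝ (groupChart p.2)) (extChartAt (𝓡 3) p.2 p.2) t.2 u.2 := by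
  have hG := hasFDerivAt_groupChart_comp p
  have hG' := conjTransposeCLM.hasFDerivAt.comp _ hG
  have hd : DifferentiableAt ℝ (fderiv ℝ (groupChart p.2)) (extChartAt (𝓡 3) p.2 p.2) :=
    ((contDiffAt_groupChart (mem_extChartAt_target p.2)).fderiv_right (m := 1)
      (WithTop.coe_le_coe.2 le_top)).differentiableAt (by simp)
  have ha : HasFDerivAt (fun y : EuclideanSpace ℝ (Fin 3) × EuclideanSpace ℝ (Fin 3) =>
      fderiv ℝ (groupChart p.2) y.2 u.2)
      ((ContinuousLinearMap.apply ℝ Mat2 u.2 ∘L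
        fderiv ℝ (fderiv ℝ (groupChart p.2)) (extChartAt (𝓡 3) p.2 p.2)) ∘L
          ContinuousLinearMap.snd ℝ _ _) (extChartAt bundleModel p p) := by
    rw [extChartAt_bundle_self]
    have h0 := (ContinuousLinearMap.apply ℝ Mat2 u.2).hasFDerivAt.comp
      (extChartAt (𝓡 3) p.2 p.2) hd.hasFDerivAt
    exact HasFDerivAt.comp (f := Prod.snd)
      (extChartAt (𝓡 3) p.1 p.1, extChartAt (𝓡 3) p.2 p.2) h0 hasFDerivAt_snd
  have h1 := hG'.mul' ha
  refine ⟨_, h1.congr_of_eventuallyEq ?_, fun t => ?_⟩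
  · filter_upwards [extChartAt_target_mem_nhds (I := bundleModel) p] with y hy
    rw [chartForm_maurerCartan p hy]
    rfl
  · have h3 : (extChartAt bundleModel p p).2 = extChartAt (𝓡 3) p.2 p.2 := by
      rw [extChartAt_bundle_self]
    simp only [add_apply, smul_apply,
      ContinuousLinearMap.comp_apply, conjTransposeCLM_apply, Function.comp_apply,
      ContinuousLinearMap.coe_snd', MulOpposite.smul_eq_mul_unop,
      MulOpposite.unop_op, smul_eq_mul, h3, groupChart_self, ContinuousLinearMap.apply_apply]
    abel

theorem formDiffAt_maurerCartan (p : M × S3) : FormDiffAt bundleModel (maurerCartan M) p := by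
  rw [FormDiffAt, differentiableAt_form_iff]
  intro u
  obtain ⟨T, hT, -⟩ := hasFDerivAt_chartForm_maurerCartan p (u 0)
  have hu : u = ![u 0] := by ext1 i; fin_cases i; rfl
  rw [hu]
  exact hT.differentiableAt

/-- The Maurer-Cartan equation `dm = -m ∧ m`. The second derivatives of `g` cancel by symmetry
(`hsym`). -/
theorem extD_maurerCartan (p : M × S3) (u : Fin 2 → TangentSpace bundleModel p) :
    extD bundleModel (maurerCartan M) p u = maurerCartan M p ![u 1] * maurerCartan M p ![u 0] -
      maurerCartan M p ![u 0] * maurerCartan M p ![u 1] := by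
  have : IsManifold (𝓡 3) 1 M := IsManifold.of_le (n := ∞) (by simp)
  have hsym := (contDiffAt_groupChart (mem_extChartAt_target p.2)).isSymmSndFDerivAt
    (by rw [minSmoothness_of_isRCLikeNormedField]; exact WithTop.coe_le_coe.2 le_top)
    (tangentModel bundleModel p (u 0)).2 (tangentModel bundleModel p (u 1)).2
  obtain ⟨T, hT, hT'⟩ := hasFDerivAt_chartForm_maurerCartan p (tangentModel bundleModel p (u 1))
  obtain ⟨S, hS, hS'⟩ := hasFDerivAt_chartForm_maurerCartan p (tangentModel bundleModel p (u 0))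
  rw [extD_one_apply (formDiffAt_maurerCartan p), hT.fderiv, hS.fderiv, hT', hS',
    fderiv_groupChart_self, fderiv_groupChart_self, hsym, Matrix.conjTranspose_mul,
    Matrix.conjTranspose_mul, (isSu2_maurerCartan p _).1, (isSu2_maurerCartan p _).1]
  have hg := conjTranspose_mul_su2Matrix p.2
  have h2 : ∀ X Y : Mat2, -X * (su2Matrix p.2)ᴴ * (su2Matrix p.2 * Y) = -(X * Y) := fun X Y => by
    rw [mul_assoc, ← mul_assoc _ _ Y, hg, one_mul, neg_mul]
  rw [h2, h2]
  abel

theorem FormDiffAt.liftConnection {w : DiffForm (𝓡 3) M 1 Mat2} {p : M × S3}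
    (hw : FormDiffAt (𝓡 3) w p.1) : FormDiffAt bundleModel (liftConnection w) p :=
  hw.liftForm.add (formDiffAt_maurerCartan p)

theorem extD_liftConnection {w : DiffForm (𝓡 3) M 1 Mat2} {p : M × S3}
    (hw : FormDiffAt (𝓡 3) w p.1) : extD bundleModel (liftConnection w) p =
      extD bundleModel (liftForm w) p + extD bundleModel (maurerCartan M) p := by
  have : IsManifold (𝓡 3) 1 M := IsManifold.of_le (n := ∞) (by simp)
  exact extD_add hw.liftForm (formDiffAt_maurerCartan p)

/-- The commutators with `m` in the derivative of the lift cancel those from the term `m` of W. This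
is gauge covariance. -/
theorem covDeriv_lift {w α : DiffForm (𝓡 3) M 1 Mat2} {p : M × S3}
    (hα : FormDiffAt (𝓡 3) α p.1) :
    covDeriv bundleModel (liftConnection w) (liftForm α) p = liftForm (covDeriv (𝓡 3) w α) p := by
  have h : liftForm (covDeriv (𝓡 3) w α) p = liftForm (extD (𝓡 3) α) p +
      liftForm w p ⋏ liftForm α p + liftForm α p ⋏ liftForm w p := by
    rw [← liftForm_wedge, ← liftForm_wedge, ← liftForm_add, ← liftForm_add]
    rfl
  rw [h, covDeriv]
  ext1 u
  simp only [ContinuousAlternatingMap.add_apply, wedge_one_one_apply, extD_liftForm hα,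
    liftConnection_apply]
  noncomm_ring

/-- The cross terms in `m` cancel as in `covDeriv_lift`, and `dm + m ∧ m = 0` removes the rest. -/
theorem curvature_lift {w : DiffForm (𝓡 3) M 1 Mat2} {p : M × S3}
    (hw : FormDiffAt (𝓡 3) w p.1) :
    curvature bundleModel (liftConnection w) p = liftForm (curvature (𝓡 3) w) p := by
  have h : liftForm (curvature (𝓡 3) w) p = liftForm (extD (𝓡 3) w) p +
      liftForm w p ⋏ liftForm w p := by
    rw [← liftForm_wedge, ← liftForm_add]
    rfl
  rw [h, curvature]
  ext1 u
  simp only [ContinuousAlternatingMap.add_apply, wedge_one_one_apply, extD_liftConnection hw,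
    extD_liftForm hw, extD_maurerCartan, liftConnection_apply]
  noncomm_ring

end LiftCalculus

/-! ### Connections w - f e and multiples f e, for a function f. -/

section ScalarMultiples

open Filter Topology

variable {E H N : Type*} [NormedAddCommGroup E] [NormedSpace ℝ E] [TopologicalSpace H]
  [TopologicalSpace N] [ChartedSpace H N] {F : Type*} [NormedAddCommGroup F] [NormedSpace ℝ F]
  {k : ℕ}

/-- Differentiability at `x` of the coordinate expression of a function in the chart at `x`. -/
def ChartDiffAt (I : ModelWithCorners ℝ E H) (f : N → F) (x : N) : Prop :=
  DifferentiableAt ℝ (f ∘ (extChartAt I x).symm) (extChartAt I x x)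

/-- The derivative at `x` of a function, computed in the chart at `x`. -/
noncomputable def chartDeriv (I : ModelWithCorners ℝ E H) (f : N → F) (x : N) :
    TangentSpace I x →ₗ[ℝ] F :=
  (fderiv ℝ (f ∘ (extChartAt I x).symm) (extChartAt I x x)).toLinearMap ∘ₗ
    (tangentModel I x).toLinearMap

theorem chartDeriv_apply (I : ModelWithCorners ℝ E H) (f : N → F) (x : N) (ξ : TangentSpace I x) :
    chartDeriv I f x ξ = fderiv ℝ (f ∘ (extChartAt I x).symm) (extChartAt I x x)
      (tangentModel I x ξ) := rfl

theorem mfderiv_eq_zero_iff_chartDeriv {I : ModelWithCorners ℝ E H} [I.Boundaryless]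
    [IsManifold I 1 N] {f : N → F} {x : N} (hf : ChartDiffAt I f x) :
    mfderiv I 𝓘(ℝ, F) f x = 0 ↔ ∀ ξ, chartDeriv I f x ξ = 0 := by
  have h := (mfderiv_eq_fderiv_chart I hf).2
  constructor
  · intro h0 ξ
    rw [chartDeriv_apply, ← h]
    exact congrArg (fun T : TangentSpace I x →L[ℝ] F => T ξ) h0
  · intro h0
    refine ContinuousLinearMap.ext fun ξ => ?_
    have h1 := h0 ξ
    rw [chartDeriv_apply, ← h] at h1
    exact h1

theorem chartDeriv_comp {G : Type*} [NormedAddCommGroup G] [NormedSpace ℝ G]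
    {I : ModelWithCorners ℝ E H} [I.Boundaryless] [IsManifold I 1 N] {f : N → F}
    {x : N} (hf : ChartDiffAt I f x) {g : F → G} {g' : F →L[ℝ] G} (hg : HasFDerivAt g g' (f x)) :
    ChartDiffAt I (fun z => g (f z)) x ∧
      ∀ ξ, chartDeriv I (fun z => g (f z)) x ξ = g' (chartDeriv I f x ξ) := by
  have hx : (f ∘ (extChartAt I x).symm) (extChartAt I x x) = f x := by
    rw [Function.comp_apply, extChartAt_to_inv]
  have h1 := HasFDerivAt.comp (g := g) (extChartAt I x x) (hx.symm ▸ hg) hf.hasFDerivAt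
  refine ⟨h1.differentiableAt, fun ξ => ?_⟩
  exact congrArg (fun T : E →L[ℝ] G => T (tangentModel I x ξ)) h1.fderiv

theorem covDeriv_sub_smul {K : Type*} [NormedField K] [NormedAlgebra K Mat2]
    {I : ModelWithCorners ℝ E H} (w e : DiffForm I N 1 Mat2) (f : N → K)
    (x : N) (u : Fin 2 → TangentSpace I x) :
    covDeriv I (fun x => w x - f x • e x) e x u =
      covDeriv I w e x u - (2 * f x) • (e x ⋏ e x) u := by
  simp only [covDeriv, ContinuousAlternatingMap.add_apply, wedge_one_one_apply,
    ContinuousAlternatingMap.sub_apply, ContinuousAlternatingMap.smul_apply, sub_mul, mul_sub,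
    smul_mul_assoc, mul_smul_comm, smul_sub]
  module

theorem extD_sub {I : ModelWithCorners ℝ E H} [I.Boundaryless] [IsManifold I 1 N]
    {α β : DiffForm I N k F} {x : N} (hα : FormDiffAt I α x) (hβ : FormDiffAt I β x) :
    extD I (fun x => α x - β x) x = extD I α x - extD I β x := by
  ext1 u
  rw [ContinuousAlternatingMap.sub_apply, extD_apply, extD_apply, extD_apply]
  have : chartForm I (fun x => α x - β x) x = chartForm I α x - chartForm I β x := rfl
  rw [this, extDeriv, fderiv_sub hα hβ]
  exact congrArg (fun η => η fun i => tangentModel I x (u i))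
    (map_sub (ContinuousAlternatingMap.alternatizeUncurryFinCLM ℝ E F) _ _)

section Scalars

variable {K : Type*} [NormedField K] [NormedAlgebra ℝ K] [NormedAlgebra K Mat2]
  [IsScalarTower ℝ K Mat2] {I : ModelWithCorners ℝ E H} {f : N → K} {x : N}

theorem hasFDerivAt_chartForm_smul {α : DiffForm I N k Mat2} (hf : ChartDiffAt I f x)
    [FiniteDimensional ℝ E] (hα : FormDiffAt I α x) (u : Fin k → E) :
    HasFDerivAt (fun y => chartForm I (fun x => f x • α x) x y u)
      (f ((extChartAt I x).symm (extChartAt I x x)) •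
          fderiv ℝ (fun y => chartForm I α x y u) (extChartAt I x x) +
        (fderiv ℝ (f ∘ (extChartAt I x).symm) (extChartAt I x x)).smulRight
          (chartForm I α x (extChartAt I x x) u)) (extChartAt I x x) :=
  hf.hasFDerivAt.smul (differentiableAt_form_iff.1 hα u).hasFDerivAt

variable [FiniteDimensional ℝ E]

theorem FormDiffAt.smul {α : DiffForm I N k Mat2} (hα : FormDiffAt I α x)
    (hf : ChartDiffAt I f x) : FormDiffAt I (fun x => f x • α x) x := by
  rw [FormDiffAt, differentiableAt_form_iff]
  exact fun u => (hasFDerivAt_chartForm_smul hf hα u).differentiableAt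

theorem FormDiffAt.sub_smul {α β : DiffForm I N k Mat2} (hα : FormDiffAt I α x)
    (hβ : FormDiffAt I β x) (hf : ChartDiffAt I f x) :
    FormDiffAt I (fun x => α x - f x • β x) x :=
  DifferentiableAt.sub hα (hβ.smul hf)

variable [I.Boundaryless] [IsManifold I 1 N]

theorem extD_smul {α : DiffForm I N 1 Mat2} (hα : FormDiffAt I α x)
    (hf : ChartDiffAt I f x) (u : Fin 2 → TangentSpace I x) :
    extD I (fun x => f x • α x) x u = f x • extD I α x u +
      (chartDeriv I f x (u 0) • α x ![u 1] - chartDeriv I f x (u 1) • α x ![u 0]) := by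
  rw [extD_one_apply (hα.smul hf), (hasFDerivAt_chartForm_smul hf hα _).fderiv,
    (hasFDerivAt_chartForm_smul hf hα _).fderiv, extD_one_apply hα, extChartAt_to_inv]
  simp only [add_apply, smul_apply, ContinuousLinearMap.smulRight_apply, chartForm_self_one,
    chartDeriv_apply, smul_sub]
  abel

theorem covDeriv_smul {w e : DiffForm I N 1 Mat2} (he : FormDiffAt I e x)
    (hf : ChartDiffAt I f x) (u : Fin 2 → TangentSpace I x) :
    covDeriv I w (fun x => f x • e x) x u = f x • covDeriv I w e x u +
      (chartDeriv I f x (u 0) • e x ![u 1] - chartDeriv I f x (u 1) • e x ![u 0]) := by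
  simp only [covDeriv, ContinuousAlternatingMap.add_apply, extD_smul he hf, wedge_one_one_apply,
    ContinuousAlternatingMap.smul_apply, smul_mul_assoc, mul_smul_comm, smul_add, smul_sub]
  abel

/-- `F(w - f e) = F(w) - f ∇e - df ∧ e + f² e ∧ e`. A real `f = ρ` gives the curvature of `w_J`, the
complex `f = ζ` that of `complexConnection`. -/
theorem curvature_sub_smul {w e : DiffForm I N 1 Mat2} (hw : FormDiffAt I w x)
    (he : FormDiffAt I e x) (hf : ChartDiffAt I f x) (u : Fin 2 → TangentSpace I x) :
    curvature I (fun x => w x - f x • e x) x u = curvature I w x u - f x • covDeriv I w e x u -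
      (chartDeriv I f x (u 0) • e x ![u 1] - chartDeriv I f x (u 1) • e x ![u 0]) +
      (f x ^ 2) • (e x ⋏ e x) u := by
  simp only [curvature, covDeriv, ContinuousAlternatingMap.add_apply, wedge_one_one_apply,
    extD_sub hw (he.smul hf), extD_smul he hf,
    ContinuousAlternatingMap.sub_apply, ContinuousAlternatingMap.smul_apply, sub_mul, mul_sub,
    smul_mul_assoc, mul_smul_comm, smul_sub, smul_add, pow_two, mul_smul]
  abel

end Scalars

end ScalarMultiples

/-! ### The exterior derivative of Re(κ Tr(A[A,A])). -/

section CubicForm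

open Filter Topology

theorem trBracket_rotate (X Y Z : Mat2) : trBracket X Y Z = trBracket Y Z X := by
  simp only [trBracket, mul_sub, Matrix.trace_sub]
  rw [Matrix.trace_mul_comm X (Y * Z), Matrix.trace_mul_comm X (Z * Y), mul_assoc, mul_assoc,
    Matrix.trace_mul_comm Z (Y * X), mul_assoc]

theorem trBracket_swap (X Y Z : Mat2) : trBracket X Z Y = -trBracket X Y Z := by
  rw [trBracket, trBracket, ← Matrix.trace_neg, ← mul_neg, neg_sub]

theorem trBracket_add_left (X X' Y Z : Mat2) :
    trBracket (X + X') Y Z = trBracket X Y Z + trBracket X' Y Z := by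
  simp only [trBracket, add_mul, Matrix.trace_add]

theorem trBracket_sub_left (X X' Y Z : Mat2) :
    trBracket (X - X') Y Z = trBracket X Y Z - trBracket X' Y Z := by
  simp only [trBracket, sub_mul, Matrix.trace_sub]

theorem trBracket_smul_left (c : ℂ) (X Y Z : Mat2) :
    trBracket (c • X) Y Z = c * trBracket X Y Z := by
  simp only [trBracket, smul_mul_assoc, Matrix.trace_smul, smul_eq_mul]

/-- The alternating sum of `Tr([F ∧ [A, A]])` over the shuffles of four vectors. -/
noncomputable def trShuffle (F : Fin 4 → Fin 4 → Mat2) (a : Fin 4 → Mat2) : ℂ :=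
  trBracket (F 0 1) (a 2) (a 3) - trBracket (F 0 2) (a 1) (a 3) + trBracket (F 0 3) (a 1) (a 2) +
    trBracket (F 1 2) (a 0) (a 3) - trBracket (F 1 3) (a 0) (a 2) + trBracket (F 2 3) (a 0) (a 1)

/-- This is `Tr(A⁴) = 0`: moving a one-form cyclically past three others costs a sign. Hence dA can
be replaced by dA + A ∧ A. -/
theorem trShuffle_bracket (a : Fin 4 → Mat2) :
    trShuffle (fun i j => a i * a j - a j * a i) a = 0 := by
  simp [trShuffle, trBracket, Matrix.trace_fin_two, Matrix.mul_apply, Fin.sum_univ_two]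
  ring

theorem trShuffle_add (F F' : Fin 4 → Fin 4 → Mat2) (a : Fin 4 → Mat2) :
    trShuffle (fun i j => F i j + F' i j) a = trShuffle F a + trShuffle F' a := by
  simp only [trShuffle, trBracket_add_left]
  ring

/-- `D i j` stands for the derivative along the `i`-th vector of A on the `j`-th. Cyclicity and
antisymmetry of the trace bring the differentiated factor to the front, where the terms pair up into
dA. -/
theorem sum_derivatives_eq_trShuffle (D : Fin 4 → Fin 4 → Mat2) (a : Fin 4 → Mat2) :
    (trBracket (D 0 1) (a 2) (a 3) + trBracket (a 1) (D 0 2) (a 3) + trBracket (a 1) (a 2) (D 0 3))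
    - (trBracket (D 1 0) (a 2) (a 3) + trBracket (a 0) (D 1 2) (a 3) + trBracket (a 0) (a 2) (D 1 3))
    + (trBracket (D 2 0) (a 1) (a 3) + trBracket (a 0) (D 2 1) (a 3) + trBracket (a 0) (a 1) (D 2 3))
    - (trBracket (D 3 0) (a 1) (a 2) + trBracket (a 0) (D 3 1) (a 2) + trBracket (a 0) (a 1) (D 3 2))
    = trShuffle (fun i j => D i j - D j i) a := by
  have h2 : ∀ X Y Z, trBracket X Y Z = -trBracket Y X Z := fun X Y Z => by
    rw [trBracket_rotate, trBracket_swap]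
  have h3 : ∀ X Y Z, trBracket X Y Z = trBracket Z X Y := fun X Y Z => by
    rw [trBracket_rotate Z]
  simp only [trShuffle, trBracket_sub_left]
  rw [h2 (a 1) (D 0 2), h3 (a 1) (a 2) (D 0 3), h2 (a 0) (D 1 2), h3 (a 0) (a 2) (D 1 3),
    h2 (a 0) (D 2 1), h3 (a 0) (a 1) (D 2 3), h2 (a 0) (D 3 1), h3 (a 0) (a 1) (D 3 2)]
  ring

variable {G : Type*} [NormedAddCommGroup G] [NormedSpace ℝ G]

/-- Leibniz rule, then `trShuffle_bracket` completes dA to the curvature. The formula for `Θ` is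
only required near `y`, since the sign in Ω̂ is known to be constant only locally. -/
theorem extDeriv_cubic [FiniteDimensional ℝ G] {A : G → G [⋀^Fin 1]→L[ℝ] Mat2} {κ : G → ℂ} {κ' : G →L[ℝ] ℂ}
    {Θ : G → G [⋀^Fin 3]→L[ℝ] ℝ} {y : G} (hA : DifferentiableAt ℝ A y)
    (hκ : HasFDerivAt κ κ' y)
    (hΘ : ∀ᶠ z in 𝓝 y, ∀ u, Θ z u =
      (κ z * trBracket (A z ![u 0]) (A z ![u 1]) (A z ![u 2])).re) (u : Fin 4 → G) :
    extDeriv Θ y u =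
      (κ' (u 0) * trBracket (A y ![u 1]) (A y ![u 2]) (A y ![u 3])
        - κ' (u 1) * trBracket (A y ![u 0]) (A y ![u 2]) (A y ![u 3])
        + κ' (u 2) * trBracket (A y ![u 0]) (A y ![u 1]) (A y ![u 3])
        - κ' (u 3) * trBracket (A y ![u 0]) (A y ![u 1]) (A y ![u 2])
        + κ y * trShuffle (fun i j => extDeriv A y ![u i, u j] + (A y ⋏ A y) ![u i, u j])
            (fun i => A y ![u i])).re := by
  have hd : ∀ s, HasFDerivAt (fun z => A z ![s]) (fderiv ℝ (fun z => A z ![s]) y) y := fun s =>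
    (differentiableAt_form_iff.1 hA ![s]).hasFDerivAt
  have hT : ∀ s : Fin 3 → G, ∃ T : G →L[ℝ] ℝ, HasFDerivAt (fun z => Θ z s) T y ∧ ∀ t, T t =
      (κ' t * trBracket (A y ![s 0]) (A y ![s 1]) (A y ![s 2]) + κ y *
        (trBracket (fderiv ℝ (fun z => A z ![s 0]) y t) (A y ![s 1]) (A y ![s 2]) +
        trBracket (A y ![s 0]) (fderiv ℝ (fun z => A z ![s 1]) y t) (A y ![s 2]) +
        trBracket (A y ![s 0]) (A y ![s 1]) (fderiv ℝ (fun z => A z ![s 2]) y t))).re := by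
    intro s
    obtain ⟨T, hT, hT'⟩ := hasFDerivAt_trBracket (hd (s 0)) (hd (s 1)) (hd (s 2))
    have h1 := Complex.reCLM.hasFDerivAt.comp y (hκ.mul hT)
    refine ⟨_, h1.congr_of_eventuallyEq (hΘ.mono fun z hz => hz s), fun t => ?_⟩
    simp only [ContinuousLinearMap.comp_apply, add_apply, smul_apply, hT', Complex.reCLM_apply,
      smul_eq_mul]
    congr 1
    ring
  have hΘd : DifferentiableAt ℝ Θ y := differentiableAt_form_iff.2 fun s => by
    obtain ⟨T, hT, -⟩ := hT s
    exact hT.differentiableAt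
  have hF : ∀ i j, extDeriv A y ![u i, u j] + (A y ⋏ A y) ![u i, u j] =
      (fderiv ℝ (fun z => A z ![u j]) y (u i) - fderiv ℝ (fun z => A z ![u i]) y (u j)) +
      (A y ![u i] * A y ![u j] - A y ![u j] * A y ![u i]) := fun i j => by
    rw [extDeriv_one_apply hA, wedge_one_one_apply]
    rfl
  simp only [hF]
  rw [trShuffle_add (fun i j => fderiv ℝ (fun z => A z ![u j]) y (u i) -
    fderiv ℝ (fun z => A z ![u i]) y (u j)), trShuffle_bracket (fun i => A y ![u i]), add_zero,
    ← sum_derivatives_eq_trShuffle (fun i j => fderiv ℝ (fun z => A z ![u j]) y (u i))]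
  have hs : ∀ i : Fin 4, fderiv ℝ (fun z => Θ z (i.removeNth u)) y (u i) =
      (κ' (u i) * trBracket (A y ![i.removeNth u 0]) (A y ![i.removeNth u 1])
        (A y ![i.removeNth u 2]) + κ y *
        (trBracket (fderiv ℝ (fun z => A z ![i.removeNth u 0]) y (u i)) (A y ![i.removeNth u 1])
          (A y ![i.removeNth u 2]) +
        trBracket (A y ![i.removeNth u 0]) (fderiv ℝ (fun z => A z ![i.removeNth u 1]) y (u i))
          (A y ![i.removeNth u 2]) +
        trBracket (A y ![i.removeNth u 0]) (A y ![i.removeNth u 1])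
          (fderiv ℝ (fun z => A z ![i.removeNth u 2]) y (u i)))).re := fun i => by
    obtain ⟨T, hT, hT'⟩ := hT (i.removeNth u)
    rw [hT.fderiv, hT']
  rw [extDeriv_apply hΘd, Fin.sum_univ_four, hs, hs, hs, hs]
  have r0 : (Fin.removeNth 0 u : Fin 3 → G) = ![u 1, u 2, u 3] := by ext i; fin_cases i <;> rfl
  have r1 : (Fin.removeNth 1 u : Fin 3 → G) = ![u 0, u 2, u 3] := by ext i; fin_cases i <;> rfl
  have r2 : (Fin.removeNth 2 u : Fin 3 → G) = ![u 0, u 1, u 3] := by ext i; fin_cases i <;> rfl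
  have r3 : (Fin.removeNth 3 u : Fin 3 → G) = ![u 0, u 1, u 2] := by ext i; fin_cases i <;> rfl
  rw [r0, r1, r2, r3]
  simp only [Fin.val_zero, pow_zero, one_smul, Matrix.cons_val_zero, Matrix.cons_val_one,
    Matrix.cons_val, Complex.add_re, Complex.sub_re, Complex.mul_re, Complex.add_im,
    Complex.sub_im]
  norm_num
  ring

end CubicForm

/-! ### A local formula for Ω̂, and its exterior derivative. -/

section HatForm

open Filter Topology

theorem hasDerivAt_sqrt_one_sub_sq {r : ℝ} (hr : |r| < 1) :
    HasDerivAt (fun r : ℝ => Real.sqrt (1 - r ^ 2)) (-(r / Real.sqrt (1 - r ^ 2))) r := by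
  have hs := sqrt_one_sub_sq_pos hr
  have h1 : HasDerivAt (fun r : ℝ => 1 - r ^ 2) (-(2 * r)) r := by
    simpa using (hasDerivAt_pow 2 r).const_sub 1
  convert h1.sqrt (Real.sqrt_pos.1 hs).ne' using 1
  field_simp

/-- The imaginary part is the constant `-1`, so the derivative is real. It is also nonzero, which
lets dρ be read off from a real part. -/
theorem hasDerivAt_hatCoeff {r : ℝ} (hr : |r| < 1) :
    HasDerivAt hatCoeff (((Real.sqrt (1 - r ^ 2) ^ 3)⁻¹ : ℝ) : ℂ) r := by
  have hs := sqrt_one_sub_sq_pos hr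
  have h1 := ((hasDerivAt_id r).div (hasDerivAt_sqrt_one_sub_sq hr) hs.ne').ofReal_comp.sub_const
    Complex.I
  have h2 : hatCoeff = fun r => ((r / Real.sqrt (1 - r ^ 2) : ℝ) : ℂ) - Complex.I := by
    funext r
    apply Complex.ext <;> simp [hatCoeff, -Complex.ofReal_div]
  rw [h2]
  refine h1.congr_deriv ?_
  congr 1
  have h3 := sq_sqrt_one_sub_sq hr
  simp only [id]
  field_simp
  linear_combination h3

theorem hasDerivAt_unitRoot {r : ℝ} (hr : |r| < 1) :
    HasDerivAt unitRoot (1 - ((r / Real.sqrt (1 - r ^ 2) : ℝ) : ℂ) * Complex.I) r := by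
  have h1 := (hasDerivAt_id r).ofReal_comp.add
    ((hasDerivAt_sqrt_one_sub_sq hr).ofReal_comp.mul_const Complex.I)
  have h2 : unitRoot = fun r : ℝ => (r : ℂ) + ((Real.sqrt (1 - r ^ 2) : ℝ) : ℂ) * Complex.I := by
    funext r
    apply Complex.ext <;> simp [unitRoot]
  rw [h2]
  refine h1.congr_deriv ?_
  push_cast
  ring

variable {E H N : Type*} [NormedAddCommGroup E] [NormedSpace ℝ E] [TopologicalSpace H]
  [TopologicalSpace N] [ChartedSpace H N] {I : ModelWithCorners ℝ E H} [I.Boundaryless]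
  [IsManifold I 1 N]

theorem chartDeriv_comp_real {F : Type*} [NormedAddCommGroup F] [NormedSpace ℝ F] {ρ : N → ℝ}
    {x : N} (hρ : ChartDiffAt I ρ x) {g : ℝ → F} {g' : F} (hg : HasDerivAt g g' (ρ x)) :
    ChartDiffAt I (fun z => g (ρ z)) x ∧
      ∀ ξ, chartDeriv I (fun z => g (ρ z)) x ξ = chartDeriv I ρ x ξ • g' :=
  chartDeriv_comp hρ hg.hasFDerivAt

theorem coframeRatio_congr {V V' : Type*} [AddCommGroup V] [Module ℝ V] [TopologicalSpace V]
    [AddCommGroup V'] [Module ℝ V'] [TopologicalSpace V'] {v : V [⋀^Fin 6]→L[ℝ] ℝ}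
    {W E : V [⋀^Fin 1]→L[ℝ] Mat2} {v' : V' [⋀^Fin 6]→L[ℝ] ℝ} {W' E' : V' [⋀^Fin 1]→L[ℝ] Mat2}
    {b : Fin 6 → V} {b' : Fin 6 → V'} (hv : v b = v' b') (hW : ∀ i, W ![b i] = W' ![b' i])
    (hE : ∀ i, E ![b i] = E' ![b' i]) : coframeRatio v W E b = coframeRatio v' W' E' b' := by
  have h : ∀ j, coframeCoord W E (b j) = coframeCoord W' E' (b' j) := fun j => by
    ext i
    refine Fin.addCases (m := 3) (n := 3) (fun i => ?_) (fun i => ?_) i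
    · rw [coframeCoord_castAdd, coframeCoord_castAdd, hW]
    · rw [coframeCoord_natAdd, coframeCoord_natAdd, hE]
  simp only [coframeRatio, det6, hv, h]

/-- Continuity keeps the sign of the ratio constant near a point, so that it can be treated as a
constant when Ω̂ is differentiated. -/
theorem continuousAt_coframeRatio {G : Type*} [NormedAddCommGroup G] [NormedSpace ℝ G]
    {v : G → G [⋀^Fin 6]→L[ℝ] ℝ} {W E : G → G [⋀^Fin 1]→L[ℝ] Mat2} {y : G} {b : Fin 6 → G}
    (hv : ContinuousAt (fun z => v z b) y) (hW : ∀ t, ContinuousAt (fun z => W z ![t]) y)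
    (hE : ∀ t, ContinuousAt (fun z => E z ![t]) y) (h0 : v y b ≠ 0) :
    ContinuousAt (fun z => coframeRatio (v z) (W z) (E z) b) y := by
  have hc : Continuous su2Coord := su2Coord.continuous_of_finiteDimensional
  have h : ∀ i j, ContinuousAt (fun z => coframeCoord (W z) (E z) (b j) i) y := fun i j => by
    refine Fin.addCases (m := 3) (n := 3) (fun i => ?_) (fun i => ?_) i
    · simp only [coframeCoord_castAdd]
      exact ((continuous_apply i).comp hc).continuousAt.comp (hW _)
    · simp only [coframeCoord_natAdd]
      exact ((continuous_apply i).comp hc).continuousAt.comp (hE _)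
  refine ContinuousAt.mul continuousAt_const (ContinuousAt.div ?_ hv h0)
  simp only [det6_eq_sum]
  exact tendsto_finsetSum _ fun σ _ => (tendsto_finsetProd _ fun i _ => h _ _).const_smul _

section Bundle

variable {M : Type*} [TopologicalSpace M] [ChartedSpace (EuclideanSpace ℝ (Fin 3)) M]

/-- The derivative along the fibration of a function on the base. -/
theorem hasFDerivAt_comp_fst {F : Type*} [NormedAddCommGroup F] [NormedSpace ℝ F] {f : M → F}
    {p : M × S3} (hf : ChartDiffAt (𝓡 3) f p.1) :
    HasFDerivAt (fun y => f ((extChartAt bundleModel p).symm y).1)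
      (fderiv ℝ (f ∘ (extChartAt (𝓡 3) p.1).symm) (extChartAt (𝓡 3) p.1 p.1) ∘L
        ContinuousLinearMap.fst ℝ _ _) (extChartAt bundleModel p p) := by
  have h : (fun y => f ((extChartAt bundleModel p).symm y).1) =
      fun y => (f ∘ (extChartAt (𝓡 3) p.1).symm) y.1 := by
    funext y
    rw [extChartAt_bundle_symm_apply]; rfl
  rw [h, extChartAt_bundle_self]
  exact HasFDerivAt.comp (g := f ∘ (extChartAt (𝓡 3) p.1).symm) (f := Prod.fst)
    (extChartAt (𝓡 3) p.1 p.1, extChartAt (𝓡 3) p.2 p.2) hf.hasFDerivAt hasFDerivAt_fst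

/-- The complex connection `w - ζ e` with `ζ = ρ + i √(1 - ρ²)`. -/
noncomputable def complexConnection (w e : DiffForm (𝓡 3) M 1 Mat2) (ρ : M → ℝ) :
    DiffForm (𝓡 3) M 1 Mat2 := fun x => w x - unitRoot (ρ x) • e x

variable {w e : DiffForm (𝓡 3) M 1 Mat2} {ρ : M → ℝ} {v : DiffForm bundleModel (M × S3) 6 ℝ}

/-- The projection of a tangent vector of the bundle to the base. -/
noncomputable def baseVector (p : M × S3) (ξ : TangentSpace bundleModel p) : TangentSpace (𝓡 3) p.1 :=
  (tangentModel (𝓡 3) p.1).symm (tangentModel bundleModel p ξ).1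

theorem reducedForm_eq_pointForm (W E : DiffForm bundleModel (M × S3) 1 Mat2) (ρ : M → ℝ)
    (p : M × S3) : reducedForm W E ρ p = pointForm (W p) (E p) (ρ p.1) := rfl

variable [IsManifold (𝓡 3) ∞ M]

theorem hitchinHat_eventually (hwsu : IsSu2Valued (𝓡 3) w) (hesu : IsSu2Valued (𝓡 3) e)
    (hframe : ∀ x : M, frameVolume (e x) ≠ 0) (hw : IsSmoothForm (𝓡 3) w)
    (he : IsSmoothForm (𝓡 3) e) (hv : IsSmoothForm bundleModel v) (hv0 : ∀ p : M × S3, v p ≠ 0)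
    (hρ : ∀ x, |ρ x| < 1) (p : M × S3) :
    ∃ ε : ℝ, ε ^ 2 = 1 ∧ ∀ᶠ y in 𝓝 (extChartAt bundleModel p p), ∀ u,
      chartForm bundleModel
        (fun p => hitchinHat (v p) (reducedForm (liftConnection w) (liftForm e) ρ p)) p y u =
      ((ε * hatCoeff (ρ ((extChartAt bundleModel p).symm y).1)) * trBracket
        (chartForm bundleModel (liftConnection (complexConnection w e ρ)) p y ![u 0])
        (chartForm bundleModel (liftConnection (complexConnection w e ρ)) p y ![u 1])
        (chartForm bundleModel (liftConnection (complexConnection w e ρ)) p y ![u 2])).re := by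
  have : IsManifold (𝓡 3) 1 M := IsManifold.of_le (n := ∞) (by simp)
  obtain ⟨b, hb⟩ := exists_apply_ne_zero (hv0 p)
  set B : Fin 6 → EuclideanSpace ℝ (Fin 3) × EuclideanSpace ℝ (Fin 3) :=
    fun i => tangentModel bundleModel p (b i) with hB
  have hWd : FormDiffAt bundleModel (liftConnection w) p := (hw.formDiffAt p.1).liftConnection
  have hEd : FormDiffAt bundleModel (liftForm e) p := (he.formDiffAt p.1).liftForm
  have hv1 : chartForm bundleModel v p (extChartAt bundleModel p p) B = v p b :=
    chartForm_self bundleModel v p b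
  have hvd := (differentiableAt_form_iff.1 (hv.formDiffAt p) B).continuousAt
  have hq := continuousAt_coframeRatio (b := B) hvd
    (fun t => (differentiableAt_form_iff.1 hWd ![t]).continuousAt)
    (fun t => (differentiableAt_form_iff.1 hEd ![t]).continuousAt) (hv1.trans_ne hb)
  have hq0 : coframeRatio (chartForm bundleModel v p (extChartAt bundleModel p p))
      (chartForm bundleModel (liftConnection w) p (extChartAt bundleModel p p))
      (chartForm bundleModel (liftForm e) p (extChartAt bundleModel p p)) B ≠ 0 := by
    rw [coframeRatio_congr hv1 (fun i => chartForm_self_one _ _ _ _)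
      (fun i => chartForm_self_one _ _ _ _)]
    exact (isCoframe_lift hwsu hesu hframe p).coframeRatio_ne_zero hb
  -- `ε` is the sign of the ratio at `p`; the inequality is open and persists at nearby points.
  obtain ⟨ε, hε, hpos⟩ : ∃ ε : ℝ, ε ^ 2 = 1 ∧ 0 < ε *
      coframeRatio (chartForm bundleModel v p (extChartAt bundleModel p p))
      (chartForm bundleModel (liftConnection w) p (extChartAt bundleModel p p))
      (chartForm bundleModel (liftForm e) p (extChartAt bundleModel p p)) B := by
    rcases lt_or_gt_of_ne hq0 with h | h
    · exact ⟨-1, by norm_num, by linarith⟩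
    · exact ⟨1, by norm_num, by linarith⟩
  refine ⟨ε, hε, ?_⟩
  filter_upwards [(continuousAt_const.mul hq).eventually (lt_mem_nhds hpos),
    hvd.eventually_ne (hv1.trans_ne hb)] with y hy hvy u
  have hr := coframeRatio_congr (b := B) (b' := fun i => mfderiv 𝓘(ℝ,
      EuclideanSpace ℝ (Fin 3) × EuclideanSpace ℝ (Fin 3)) bundleModel
      (extChartAt bundleModel p).symm y (B i))
    (chartForm_apply bundleModel v p y B)
    (fun i => chartForm_apply_one bundleModel (liftConnection w) p y (B i))
    (fun i => chartForm_apply_one bundleModel (liftForm e) p y (B i))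
  rw [Pi.mul_apply, hr] at hy
  rw [chartForm_apply] at hvy
  have h1 := (isCoframe_lift hwsu hesu hframe
    ((extChartAt bundleModel p).symm y)).hitchinHat_apply
    (hρ ((extChartAt bundleModel p).symm y).1) hvy hε hy
    (fun i => mfderiv 𝓘(ℝ, EuclideanSpace ℝ (Fin 3) × EuclideanSpace ℝ (Fin 3)) bundleModel
      (extChartAt bundleModel p).symm y (u i))
  have h2 : ∀ t, chartForm bundleModel (liftConnection (complexConnection w e ρ)) p y ![t] =
      liftConnection w ((extChartAt bundleModel p).symm y) ![mfderiv 𝓘(ℝ,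
        EuclideanSpace ℝ (Fin 3) × EuclideanSpace ℝ (Fin 3)) bundleModel
        (extChartAt bundleModel p).symm y t] -
      unitRoot (ρ ((extChartAt bundleModel p).symm y).1) •
        liftForm e ((extChartAt bundleModel p).symm y) ![mfderiv 𝓘(ℝ,
        EuclideanSpace ℝ (Fin 3) × EuclideanSpace ℝ (Fin 3)) bundleModel
        (extChartAt bundleModel p).symm y t] := fun t => by
    rw [chartForm_apply_one]
    exact congrArg (fun α : DiffForm bundleModel (M × S3) 1 Mat2 =>
      α ((extChartAt bundleModel p).symm y) ![mfderiv 𝓘(ℝ,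
        EuclideanSpace ℝ (Fin 3) × EuclideanSpace ℝ (Fin 3)) bundleModel
        (extChartAt bundleModel p).symm y t])
      (liftConnection_sub_smul w e fun x => unitRoot (ρ x))
  rw [mul_assoc, Complex.re_ofReal_mul, h2 (u 0), h2 (u 1), h2 (u 2)]
  rw [← h1, ← reducedForm_eq_pointForm, chartForm_apply]

/-- `extDeriv_cubic` applied to the local formula, with A the lift of `complexConnection`. By
`curvature_lift` only dρ and a curvature on the base enter. -/
theorem exists_extD_hitchinHat (hwsu : IsSu2Valued (𝓡 3) w) (hesu : IsSu2Valued (𝓡 3) e)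
    (hframe : ∀ x : M, frameVolume (e x) ≠ 0) (hw : IsSmoothForm (𝓡 3) w)
    (he : IsSmoothForm (𝓡 3) e) (hv : IsSmoothForm bundleModel v) (hv0 : ∀ p : M × S3, v p ≠ 0)
    (hρ : ∀ x, |ρ x| < 1) (hρd : ∀ x, ChartDiffAt (𝓡 3) ρ x) (p : M × S3) :
    ∃ ε : ℝ, ε ^ 2 = 1 ∧ ∀ (u : Fin 4 → TangentSpace bundleModel p) (k : Fin 4 → ℂ)
      (a : Fin 4 → Mat2),
      (∀ i, k i = ((chartDeriv (𝓡 3) ρ p.1 (baseVector p (u i)) *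
        (Real.sqrt (1 - ρ p.1 ^ 2) ^ 3)⁻¹ : ℝ) : ℂ)) →
      (∀ i, a i = liftConnection (complexConnection w e ρ) p ![u i]) →
      extD bundleModel
        (fun p => hitchinHat (v p) (reducedForm (liftConnection w) (liftForm e) ρ p)) p u =
      ε * (k 0 * trBracket (a 1) (a 2) (a 3) - k 1 * trBracket (a 0) (a 2) (a 3) +
        k 2 * trBracket (a 0) (a 1) (a 3) - k 3 * trBracket (a 0) (a 1) (a 2) +
        hatCoeff (ρ p.1) * trShuffle (fun i j =>
          liftForm (curvature (𝓡 3) (complexConnection w e ρ)) p ![u i, u j]) a).re := by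
  have : IsManifold (𝓡 3) 1 M := IsManifold.of_le (n := ∞) (by simp)
  obtain ⟨ε, hε, hΘ⟩ := hitchinHat_eventually hwsu hesu hframe hw he hv hv0 hρ p
  refine ⟨ε, hε, fun u k a hk ha => ?_⟩
  have hA : FormDiffAt (𝓡 3) (complexConnection w e ρ) p.1 :=
    (hw.formDiffAt p.1).sub_smul (he.formDiffAt p.1)
      (chartDeriv_comp_real (hρd p.1) (hasDerivAt_unitRoot (hρ p.1))).1
  obtain ⟨h1, h2⟩ := chartDeriv_comp_real (hρd p.1) (hasDerivAt_hatCoeff (hρ p.1))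
  have hκ := (hasFDerivAt_comp_fst h1).const_mul (ε : ℂ)
  rw [extD_apply, extDeriv_cubic hA.liftConnection hκ hΘ]
  have h3 : ((extChartAt bundleModel p).symm (extChartAt bundleModel p p)).1 = p.1 := by
    rw [extChartAt_to_inv]
  have h4 : ∀ i, fderiv ℝ ((fun x => hatCoeff (ρ x)) ∘ (extChartAt (𝓡 3) p.1).symm)
      (extChartAt (𝓡 3) p.1 p.1) (tangentModel bundleModel p (u i)).1 = k i := fun i => by
    rw [hk, Complex.ofReal_mul, ← Complex.real_smul, ← h2]
    rfl
  have h5 : ∀ i j, extDeriv (chartForm bundleModel (liftConnection (complexConnection w e ρ)) p)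
        (extChartAt bundleModel p p) ![tangentModel bundleModel p (u i),
          tangentModel bundleModel p (u j)] +
      (chartForm bundleModel (liftConnection (complexConnection w e ρ)) p
          (extChartAt bundleModel p p) ⋏
        chartForm bundleModel (liftConnection (complexConnection w e ρ)) p
          (extChartAt bundleModel p p)) ![tangentModel bundleModel p (u i),
          tangentModel bundleModel p (u j)] =
      liftForm (curvature (𝓡 3) (complexConnection w e ρ)) p ![u i, u j] := fun i j => by
    have h6 : (fun l => tangentModel bundleModel p (![u i, u j] l)) =
        ![tangentModel bundleModel p (u i), tangentModel bundleModel p (u j)] := by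
      ext1 l; fin_cases l <;> rfl
    rw [← curvature_lift hA, curvature, ContinuousAlternatingMap.add_apply, extD_apply, h6,
      wedge_one_one_apply, wedge_one_one_apply]
    simp only [Matrix.cons_val_zero, Matrix.cons_val_one, chartForm_self_one]
  simp only [h5, chartForm_self_one, ← ha, h3, smul_apply, ContinuousLinearMap.comp_apply,
    ContinuousLinearMap.coe_fst', h4, smul_eq_mul]
  rw [← Complex.re_ofReal_mul]
  congr 1
  ring

end Bundle

end HatForm

/-! ### Derivatives and brackets stay in su(2), and the trace detects its elements. -/

section Su2Valued

theorem IsSu2.bracket {X Y : Mat2} (hX : IsSu2 X) (hY : IsSu2 Y) : IsSu2 (X * Y - Y * X) := by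
  constructor
  · rw [Matrix.conjTranspose_sub, Matrix.conjTranspose_mul, Matrix.conjTranspose_mul, hX.1, hY.1]
    noncomm_ring
  · rw [Matrix.trace_sub, Matrix.trace_mul_comm, sub_self]

/-- su(2) is the common kernel of two continuous linear maps, and these commute with
differentiation. -/
theorem IsSu2.fderiv {G : Type*} [NormedAddCommGroup G] [NormedSpace ℝ G] {f : G → Mat2} {y : G}
    (hf : DifferentiableAt ℝ f y) (h : ∀ z, IsSu2 (f z)) (t : G) : IsSu2 (fderiv ℝ f y t) := by
  have key : ∀ {F : Type} [NormedAddCommGroup F] [NormedSpace ℝ F] (L : Mat2 →L[ℝ] F),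
      (∀ X, IsSu2 X → L X = 0) → L (_root_.fderiv ℝ f y t) = 0 := by
    intro F _ _ L hL
    have h1 := L.hasFDerivAt.comp y hf.hasFDerivAt
    have h2 : L ∘ f = fun _ => 0 := funext fun z => hL _ (h z)
    rw [h2] at h1
    exact congrArg (fun T : G →L[ℝ] F => T t) (h1.unique (hasFDerivAt_const 0 y))
  constructor
  · rw [eq_neg_iff_add_eq_zero]
    refine key (conjTransposeCLM + ContinuousLinearMap.id ℝ Mat2) fun X hX => ?_
    rw [add_apply, conjTransposeCLM_apply, hX.1, ContinuousLinearMap.id_apply,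
      neg_add_cancel]
  · exact key traceCLM fun X hX => hX.2

theorem trBracket_basis : trBracket (su2OfCoord (Pi.single 0 1)) (su2OfCoord (Pi.single 1 1))
    (su2OfCoord (Pi.single 2 1)) = ((-(1 / 2) : ℝ) : ℂ) := by
  rw [trBracket_su2 (isSu2_su2OfCoord _) (isSu2_su2OfCoord _) (isSu2_su2OfCoord _)]
  simp [su2Coord_su2OfCoord, Matrix.det_fin_three]

/-- Brackets of basis elements are again basis elements up to sign, so suitable `X`, `Y` read off
each component of `S`. -/
theorem IsSu2.eq_zero_of_trBracket {S : Mat2} (hS : IsSu2 S)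
    (h : ∀ X Y, IsSu2 X → IsSu2 Y → (trBracket S X Y).re = 0) : S = 0 := by
  have h' : ∀ x y : Fin 3 → ℝ, (Matrix.of ![su2Coord S, x, y]).det = 0 := fun x y => by
    have h1 := h _ _ (isSu2_su2OfCoord x) (isSu2_su2OfCoord y)
    rw [trBracket_su2 hS (isSu2_su2OfCoord _) (isSu2_su2OfCoord _), Complex.ofReal_re,
      su2Coord_su2OfCoord, su2Coord_su2OfCoord] at h1
    linarith
  rw [hS.eq_iff isSu2_zero, map_zero]
  have h0 := h' (Pi.single 1 1) (Pi.single 2 1)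
  have h1 := h' (Pi.single 2 1) (Pi.single 0 1)
  have h2 := h' (Pi.single 0 1) (Pi.single 1 1)
  simp [Matrix.det_fin_three] at h0 h1 h2
  ext i
  fin_cases i
  · exact h0
  · exact h1
  · exact h2

variable {E H N : Type*} [NormedAddCommGroup E] [NormedSpace ℝ E] [FiniteDimensional ℝ E]
  [TopologicalSpace H]
  [TopologicalSpace N] [ChartedSpace H N] {I : ModelWithCorners ℝ E H} [I.Boundaryless]
  [IsManifold I 1 N]

theorem isSu2_extD {α : DiffForm I N 1 Mat2} (hsu : IsSu2Valued I α) {x : N}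
    (hα : FormDiffAt I α x) (u : Fin 2 → TangentSpace I x) : IsSu2 (extD I α x u) := by
  rw [extD_one_apply hα]
  have h : ∀ t z, IsSu2 (chartForm I α x z ![t]) := fun t z => by
    rw [chartForm_apply_one]
    exact hsu _ _
  exact (IsSu2.fderiv (differentiableAt_form_iff.1 hα _) (h _) _).sub
    (IsSu2.fderiv (differentiableAt_form_iff.1 hα _) (h _) _)

theorem isSu2_covDeriv {w α : DiffForm I N 1 Mat2} (hwsu : IsSu2Valued I w)
    (hsu : IsSu2Valued I α) {x : N} (hα : FormDiffAt I α x) (u : Fin 2 → TangentSpace I x) :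
    IsSu2 (covDeriv I w α x u) := by
  have h : covDeriv I w α x u = extD I α x u +
      (w x ![u 0] * α x ![u 1] - α x ![u 1] * w x ![u 0]) +
      (α x ![u 0] * w x ![u 1] - w x ![u 1] * α x ![u 0]) := by
    simp only [covDeriv, ContinuousAlternatingMap.add_apply, wedge_one_one_apply]
    abel
  rw [h]
  exact ((isSu2_extD hsu hα u).add (IsSu2.bracket (hwsu x _) (hsu x _))).add
    (IsSu2.bracket (hsu x _) (hwsu x _))

end Su2Valued

/-! ### Descent to M, and the curvature of w - ζ e. -/

section BaseIdentities

variable {M : Type*} [TopologicalSpace M] [ChartedSpace (EuclideanSpace ℝ (Fin 3)) M]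

theorem baseVector_eq_zero_iff (p : M × S3) (ξ : TangentSpace bundleModel p) :
    baseVector p ξ = 0 ↔ ξ ∈ verticalSpace p := by
  rw [baseVector, LinearEquiv.map_eq_zero_iff, mem_verticalSpace_iff]

theorem exists_baseVector_eq (p : M × S3) (ξ : TangentSpace (𝓡 3) p.1) :
    ∃ η : TangentSpace bundleModel p, baseVector p η = ξ := by
  refine ⟨(tangentModel bundleModel p).symm (tangentModel (𝓡 3) p.1 ξ, 0), ?_⟩
  rw [baseVector, LinearEquiv.apply_symm_apply]
  exact LinearEquiv.symm_apply_apply _ _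

theorem liftForm_apply_two (α : DiffForm (𝓡 3) M 2 Mat2) (p : M × S3)
    (ξ η : TangentSpace bundleModel p) : liftForm α p ![ξ, η] = (su2Matrix p.2)ᴴ *
      (α p.1 ![baseVector p ξ, baseVector p η] * su2Matrix p.2) := by
  have h : (fun i => mfderiv bundleModel (𝓡 3) (Prod.fst : M × S3 → M) p (![ξ, η] i)) =
      ![baseVector p ξ, baseVector p η] := by
    ext1 i
    fin_cases i
    · exact mfderiv_fst_apply p ξ
    · exact mfderiv_fst_apply p η
  rw [liftForm_apply, h]

theorem vec_two_eq {V : Type*} (u : Fin 2 → V) : ![u 0, u 1] = u := by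
  ext1 i; fin_cases i <;> rfl

theorem liftForm_eq_zero_iff_base {α : DiffForm (𝓡 3) M 2 Mat2} {p : M × S3} :
    liftForm α p = 0 ↔ α p.1 = 0 := by
  constructor
  · intro h
    ext1 u
    obtain ⟨ξ, hξ⟩ := exists_baseVector_eq p (u 0)
    obtain ⟨η, hη⟩ := exists_baseVector_eq p (u 1)
    have h0 : liftForm α p ![ξ, η] = 0 := by rw [h]; rfl
    rw [liftForm_apply_two, hξ, hη, vec_two_eq, conj_su2Matrix_eq_zero_iff] at h0
    exact h0
  · intro h
    ext1 u
    rw [liftForm_apply, h]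
    simp

/-- Two lifts agree everywhere if and only if the forms on the base agree. -/
theorem forall_liftForm_eq_iff {α β : DiffForm (𝓡 3) M 2 Mat2} :
    (∀ p, liftForm α p = liftForm β p) ↔ ∀ x, α x = β x := by
  have h1 : ∀ p, liftForm (fun x => α x - β x) p = liftForm α p - liftForm β p := fun p => by
    ext1 u
    simp only [ContinuousAlternatingMap.sub_apply, liftForm_apply, sub_mul, mul_sub]
  constructor
  · intro h x
    -- The point of the fibre where `g = 1`; any other would serve.
    have h2 := h1 (x, ⟨EuclideanSpace.single 0 1, by simp⟩)
    rw [h, sub_self, liftForm_eq_zero_iff_base] at h2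
    exact sub_eq_zero.1 h2
  · intro h p
    rw [← sub_eq_zero, ← h1, liftForm_eq_zero_iff_base]
    exact sub_eq_zero.2 (h p.1)

theorem forall_liftForm_eq_zero_iff {α : DiffForm (𝓡 3) M 2 Mat2} :
    (∀ p, liftForm α p = 0) ↔ ∀ x, α x = 0 :=
  ⟨fun h x => liftForm_eq_zero_iff_base.1 (h (x, ⟨EuclideanSpace.single 0 1, by simp⟩)),
    fun h p => liftForm_eq_zero_iff_base.2 (h p.1)⟩

/-- If `l ξ ≠ 0`, injectivity of `e` makes every vector a multiple of `ξ`, which is impossible in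
dimension three. -/
theorem eq_zero_of_wedge_frame_eq_zero {e : DiffForm (𝓡 3) M 1 Mat2} (hesu : IsSu2Valued (𝓡 3) e)
    {x : M} (hx : frameVolume (e x) ≠ 0) {l : TangentSpace (𝓡 3) x →ₗ[ℝ] ℝ}
    (h : ∀ ξ η, l ξ • e x ![η] - l η • e x ![ξ] = 0) (ξ : TangentSpace (𝓡 3) x) : l ξ = 0 := by
  by_contra hξ
  have h1 : ∀ η, ∃ c : ℝ, c • ξ = η := fun η => by
    refine ⟨(l ξ)⁻¹ * l η, ?_⟩
    have h2 : l ξ • η - l η • ξ = 0 := by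
      apply frame_injective hesu hx
      rw [← h ξ η, ← oneForm_map_smul, ← oneForm_map_smul]
      exact (oneFormLin (e x)).map_sub _ _
    rw [mul_smul, ← sub_eq_zero.1 h2, smul_smul, inv_mul_cancel₀ hξ, one_smul]
  have h3 := finrank_le_one ξ h1
  rw [finrank_tangentSpace_three] at h3
  omega

variable [IsManifold (𝓡 3) ∞ M] {w e : DiffForm (𝓡 3) M 1 Mat2} {ρ : M → ℝ} {x : M}

/-- `ζ` and its conjugate have sum `2 r` and product `1`, so `ζ` is a root of `z² - 2 r z + 1`. -/
theorem one_add_unitRoot_sq {r : ℝ} (hr : |r| < 1) :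
    1 + unitRoot r ^ 2 = 2 * r * unitRoot r := by
  have h := sq_sqrt_one_sub_sq hr
  unfold unitRoot
  generalize Real.sqrt (1 - r ^ 2) = s at h
  apply Complex.ext
  · simp [pow_two]
    linarith
  · simp [pow_two]
    ring

/-- `hatCoeff r` is `ζ̄ / s` and `|ζ| = 1`. That this product is real and nonzero is why the real
part of the curvature term still determines `∇e - 2ρ e ∧ e`. -/
theorem hatCoeff_mul_unitRoot {r : ℝ} (hr : |r| < 1) :
    hatCoeff r * unitRoot r = (((Real.sqrt (1 - r ^ 2))⁻¹ : ℝ) : ℂ) := by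
  have h := sq_sqrt_one_sub_sq hr
  have hs := sqrt_one_sub_sq_pos hr
  apply Complex.ext
  · simp only [unitRoot, hatCoeff, Complex.mul_re, Complex.ofReal_re]
    field_simp
    linarith
  · simp only [unitRoot, hatCoeff, Complex.mul_im, Complex.ofReal_im]
    field_simp
    ring

/-- For constant ζ the curvature is `(1 + ζ²) e ∧ e - ζ ∇e`, and `1 + ζ² = 2ρζ`. -/
theorem curvature_complexConnection (hw : FormDiffAt (𝓡 3) w x) (he : FormDiffAt (𝓡 3) e x)
    (hcurv : curvature (𝓡 3) w x = e x ⋏ e x) (hρ : |ρ x| < 1) (hρd : ChartDiffAt (𝓡 3) ρ x)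
    (hdρ : ∀ ξ, chartDeriv (𝓡 3) ρ x ξ = 0) (u : Fin 2 → TangentSpace (𝓡 3) x) :
    curvature (𝓡 3) (complexConnection w e ρ) x u =
      -unitRoot (ρ x) • (covDeriv (𝓡 3) w e x u - (2 * ρ x) • (e x ⋏ e x) u) := by
  have : IsManifold (𝓡 3) 1 M := IsManifold.of_le (n := ∞) (by simp)
  obtain ⟨h1, h2⟩ := chartDeriv_comp_real hρd (hasDerivAt_unitRoot hρ)
  have h3 := curvature_sub_smul hw he h1 u
  rw [h2, h2, hdρ, hdρ, hcurv, zero_smul, zero_smul, zero_smul, sub_self, sub_zero] at h3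
  refine h3.trans ?_
  have h4 : (2 * ρ x) • (e x ⋏ e x) u = (2 * (ρ x : ℂ)) • (e x ⋏ e x) u := by
    rw [← Complex.coe_smul]; push_cast; rfl
  have h5 := one_add_unitRoot_sq hρ
  rw [h4, ← sub_eq_zero]
  have h6 : (1 + unitRoot (ρ x) ^ 2 - 2 * ρ x * unitRoot (ρ x)) • (e x ⋏ e x) u = 0 := by
    rw [h5, sub_self, zero_smul]
  rw [← h6]
  module

end BaseIdentities

/-! ### dΩ̂ = 0 as equations on M. -/

section FieldEquations

variable {M : Type*} [TopologicalSpace M] [ChartedSpace (EuclideanSpace ℝ (Fin 3)) M]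
  [IsManifold (𝓡 3) ∞ M] {w e : DiffForm (𝓡 3) M 1 Mat2} {ρ : M → ℝ}
  {v : DiffForm bundleModel (M × S3) 6 ℝ}

/-- dΩ̂ is tested on quadruples with three, then two, vertical vectors. The lifted curvature kills
vertical vectors, so few terms survive. Conversely, dρ = 0 and the torsion equation make both dκ and
the curvature of `w - ζ e` vanish. -/
theorem extD_hitchinHat_eq_zero_iff (hwsu : IsSu2Valued (𝓡 3) w) (hesu : IsSu2Valued (𝓡 3) e)
    (hframe : ∀ x : M, frameVolume (e x) ≠ 0) (hw : IsSmoothForm (𝓡 3) w)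
    (he : IsSmoothForm (𝓡 3) e) (hcurv : ∀ x : M, curvature (𝓡 3) w x = e x ⋏ e x)
    (hv : IsSmoothForm bundleModel v) (hv0 : ∀ p : M × S3, v p ≠ 0)
    (hρ : ∀ x, |ρ x| < 1) (hρd : ∀ x, ChartDiffAt (𝓡 3) ρ x) :
    (∀ p, extD bundleModel
      (fun p => hitchinHat (v p) (reducedForm (liftConnection w) (liftForm e) ρ p)) p = 0) ↔
    (∀ x ξ, chartDeriv (𝓡 3) ρ x ξ = 0) ∧
      ∀ x, covDeriv (𝓡 3) w e x = (2 * ρ x) • (e x ⋏ e x) := by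
  constructor
  · intro h
    have hA : ∀ (p : M × S3) (ξ : TangentSpace bundleModel p), liftForm e p ![ξ] = 0 →
        liftConnection (complexConnection w e ρ) p ![ξ] = liftConnection w p ![ξ] := by
      intro p ξ hξ
      have h1 := congrArg (fun α : DiffForm bundleModel (M × S3) 1 Mat2 => α p ![ξ])
        (liftConnection_sub_smul w e fun x => unitRoot (ρ x))
      refine h1.trans ?_
      simp only [ContinuousAlternatingMap.sub_apply, ContinuousAlternatingMap.smul_apply, hξ,
        smul_zero, sub_zero]
    -- On vertical vectors A equals W, so every element of su(2) is the value of A on some vertical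
    -- vector.
    have hvert : ∀ (p : M × S3) (X : Mat2), IsSu2 X → ∃ ξ : TangentSpace bundleModel p,
        baseVector p ξ = 0 ∧ liftConnection (complexConnection w e ρ) p ![ξ] = X := by
      intro p X hX
      obtain ⟨ξ, h1, h2⟩ := (isCoframe_lift hwsu hesu hframe p).exists_apply_eq hX isSu2_zero
      refine ⟨ξ, ?_, (hA p ξ h2).trans h1⟩
      rwa [baseVector_eq_zero_iff, ← liftForm_eq_zero_iff hesu hframe]
    have hright : ∀ (α : DiffForm (𝓡 3) M 2 Mat2) (p : M × S3) (ξ η : TangentSpace bundleModel p),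
        baseVector p η = 0 → liftForm α p ![ξ, η] = 0 := by
      intro α p ξ η h0
      rw [liftForm_apply_two, h0, conj_su2Matrix_eq_zero_iff]
      exact (α p.1).map_coord_zero 1 rfl
    have hz : ∀ X Y, trBracket 0 X Y = 0 := fun X Y => by simp [trBracket]
    have hdρ : ∀ x ξ, chartDeriv (𝓡 3) ρ x ξ = 0 := by
      intro x ξ
      set p : M × S3 := (x, ⟨EuclideanSpace.single 0 1, by simp⟩)
      obtain ⟨t, ht⟩ := exists_baseVector_eq p ξ
      obtain ⟨a, ha, ha'⟩ := hvert p _ (isSu2_su2OfCoord (Pi.single 0 1))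
      obtain ⟨b, hb, hb'⟩ := hvert p _ (isSu2_su2OfCoord (Pi.single 1 1))
      obtain ⟨c, hc, hc'⟩ := hvert p _ (isSu2_su2OfCoord (Pi.single 2 1))
      obtain ⟨ε, hε, hd⟩ := exists_extD_hitchinHat hwsu hesu hframe hw he hv hv0 hρ hρd p
      -- With `a, b, c` vertical, each curvature term has a vertical argument. What is left is dκ on
      -- `t` times the trace of `trBracket_basis`.
      have h1 := hd ![t, a, b, c] _ _ (fun i => rfl) (fun i => rfl)
      rw [h p] at h1
      simp only [trShuffle, Matrix.cons_val_zero, Matrix.cons_val_one, Matrix.cons_val,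
        hright _ p t a ha, hright _ p t b hb, hright _ p t c hc, hright _ p a b hb,
        hright _ p a c hc, hright _ p b c hc, hz, ha, hb, hc, ht, ha', hb', hc', map_zero,
        trBracket_basis, zero_mul, Complex.ofReal_zero, sub_zero, add_zero, mul_zero,
        ← Complex.ofReal_mul, Complex.ofReal_re] at h1
      have h2 := sqrt_one_sub_sq_pos (hρ p.1)
      have h3 : ε ≠ 0 := fun h0 => by simp [h0] at hε
      have h4 : (0 : ℝ) = ε * (chartDeriv (𝓡 3) ρ p.1 ξ * (Real.sqrt (1 - ρ p.1 ^ 2) ^ 3)⁻¹ *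
        -(1 / 2)) := h1
      have h5 := (mul_eq_zero.1 h4.symm).resolve_left h3
      have h6 := (mul_eq_zero.1 h5).resolve_right (by norm_num)
      exact (mul_eq_zero.1 h6).resolve_right (by positivity)
    refine ⟨hdρ, fun x => ?_⟩
    ext1 u
    set p : M × S3 := (x, ⟨EuclideanSpace.single 0 1, by simp⟩)
    have hsu : IsSu2 (covDeriv (𝓡 3) w e x u - (2 * ρ x) • (e x ⋏ e x) u) := by
      have : IsManifold (𝓡 3) 1 M := IsManifold.of_le (n := ∞) (by simp)
      refine (isSu2_covDeriv hwsu hesu (he.formDiffAt x) u).sub (IsSu2.smul _ ?_)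
      rw [wedge_one_one_apply]
      exact IsSu2.bracket (hesu x _) (hesu x _)
    obtain ⟨ξ, hξ⟩ := exists_baseVector_eq p (u 0)
    obtain ⟨η, hη⟩ := exists_baseVector_eq p (u 1)
    have hcx := curvature_complexConnection (hw.formDiffAt x) (he.formDiffAt x) (hcurv x) (hρ x)
      (hρd x) (hdρ x) u
    refine sub_eq_zero.1 ((conj_su2Matrix_eq_zero_iff p.2).1
      ((hsu.conj p.2).eq_zero_of_trBracket fun X Y hX hY => ?_))
    obtain ⟨a, ha, ha'⟩ := hvert p X hX
    obtain ⟨b, hb, hb'⟩ := hvert p Y hY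
    obtain ⟨ε, hε, hd⟩ := exists_extD_hitchinHat hwsu hesu hframe hw he hv hv0 hρ hρd p
    -- With `a, b` vertical and dρ = 0, only the curvature on `(ξ, η)`, paired with the bracket of
    -- `X` and `Y`, is left.
    have h1 := hd ![ξ, η, a, b] _ _ (fun i => rfl) (fun i => rfl)
    have h0 : liftForm (curvature (𝓡 3) (complexConnection w e ρ)) p ![ξ, η] =
        -unitRoot (ρ x) • ((su2Matrix p.2)ᴴ *
          ((covDeriv (𝓡 3) w e x u - (2 * ρ x) • (e x ⋏ e x) u) * su2Matrix p.2)) := by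
      rw [liftForm_apply_two, hξ, hη, vec_two_eq]
      refine (congrArg (fun Z => (su2Matrix p.2)ᴴ * (Z * su2Matrix p.2)) hcx).trans ?_
      rw [smul_mul_assoc, mul_smul_comm]
    rw [h p] at h1
    simp only [trShuffle, Matrix.cons_val_zero, Matrix.cons_val_one, Matrix.cons_val,
        hright _ p ξ a ha, hright _ p ξ b hb, hright _ p η a ha, hright _ p η b hb,
        hright _ p a b hb, hz, hdρ, ha', hb', zero_mul, Complex.ofReal_zero, sub_zero, add_zero,
        h0, trBracket_smul_left, zero_add] at h1
    have h2 := sqrt_one_sub_sq_pos (hρ x)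
    have h3 : ε ≠ 0 := fun h0 => by simp [h0] at hε
    rw [← mul_assoc, mul_neg, hatCoeff_mul_unitRoot (hρ p.1), ← Complex.ofReal_neg,
      Complex.re_ofReal_mul] at h1
    have h4 := (mul_eq_zero.1 h1.symm).resolve_left h3
    exact (mul_eq_zero.1 h4).resolve_left (neg_ne_zero.2 (inv_ne_zero h2.ne'))
  · rintro ⟨hdρ, hS⟩ p
    obtain ⟨ε, -, hd⟩ := exists_extD_hitchinHat hwsu hesu hframe hw he hv hv0 hρ hρd p
    have h0 : liftForm (curvature (𝓡 3) (complexConnection w e ρ)) p = 0 := by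
      rw [liftForm_eq_zero_iff_base]
      ext1 u
      rw [curvature_complexConnection (hw.formDiffAt p.1) (he.formDiffAt p.1) (hcurv p.1)
        (hρ p.1) (hρd p.1) (hdρ p.1), hS, ContinuousAlternatingMap.smul_apply, sub_self, smul_zero]
      rfl
    have hz : ∀ X Y, trBracket 0 X Y = 0 := fun X Y => by simp [trBracket]
    ext1 u
    rw [hd u _ _ (fun i => rfl) (fun i => rfl), h0]
    have h1 : ∀ i j : Fin 4, (0 : TangentSpace bundleModel p [⋀^Fin 2]→L[ℝ] Mat2) ![u i, u j] = 0 :=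
      fun i j => rfl
    simp only [hdρ, zero_mul, Complex.ofReal_zero, trShuffle, h1, hz, sub_zero, add_zero, mul_zero,
      Complex.zero_re]
    rfl

end FieldEquations

/-! ### Torsion and curvature of w - ρ e. -/

section Gravity

variable {M : Type*} [TopologicalSpace M] [ChartedSpace (EuclideanSpace ℝ (Fin 3)) M]
  [IsManifold (𝓡 3) ∞ M] {w e wJ : DiffForm (𝓡 3) M 1 Mat2} {ρ : M → ℝ}

/-- Torsion and curvature of `w - ρ e`, and the torsion in terms of the frame `√(1 - ρ²) e`. -/
theorem gravity_identities (hw : ∀ x, FormDiffAt (𝓡 3) w x) (he : ∀ x, FormDiffAt (𝓡 3) e x)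
    (hcurv : ∀ x, curvature (𝓡 3) w x = e x ⋏ e x) (hρ : ∀ x, |ρ x| < 1)
    (hρd : ∀ x, ChartDiffAt (𝓡 3) ρ x) (hwJ : wJ = fun x => w x - ρ x • e x) :
    (∀ x, covDeriv (𝓡 3) wJ e x = covDeriv (𝓡 3) w e x - (2 * ρ x) • (e x ⋏ e x)) ∧
    (∀ x u, curvature (𝓡 3) wJ x u = ((1 - ρ x ^ 2) • (e x ⋏ e x)) u -
      ρ x • covDeriv (𝓡 3) wJ e x u -
      (chartDeriv (𝓡 3) ρ x (u 0) • e x ![u 1] - chartDeriv (𝓡 3) ρ x (u 1) • e x ![u 0])) ∧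
    ∀ x u, Real.sqrt (1 - ρ x ^ 2) •
        covDeriv (𝓡 3) wJ (fun x => Real.sqrt (1 - ρ x ^ 2) • e x) x u =
      (1 - ρ x ^ 2) • covDeriv (𝓡 3) wJ e x u - ρ x •
      (chartDeriv (𝓡 3) ρ x (u 0) • e x ![u 1] - chartDeriv (𝓡 3) ρ x (u 1) • e x ![u 0]) := by
  have : IsManifold (𝓡 3) 1 M := IsManifold.of_le (n := ∞) (by simp)
  have hS : ∀ x, covDeriv (𝓡 3) wJ e x = covDeriv (𝓡 3) w e x - (2 * ρ x) • (e x ⋏ e x) :=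
    fun x => by
      ext1 u
      rw [hwJ, covDeriv_sub_smul, ContinuousAlternatingMap.sub_apply,
        ContinuousAlternatingMap.smul_apply]
  refine ⟨hS, fun x u => ?_, fun x u => ?_⟩
  · rw [hS, hwJ, curvature_sub_smul (hw x) (he x) (hρd x), hcurv,
      ContinuousAlternatingMap.sub_apply, ContinuousAlternatingMap.smul_apply,
      ContinuousAlternatingMap.smul_apply]
    module
  · obtain ⟨h1, h2⟩ := chartDeriv_comp_real (hρd x) (hasDerivAt_sqrt_one_sub_sq (hρ x))
    have hs := sqrt_one_sub_sq_pos (hρ x)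
    have hs2 := sq_sqrt_one_sub_sq (hρ x)
    rw [covDeriv_smul (he x) h1, h2, h2]
    -- The derivative of `√(1 - ρ²)` is `-ρ / √(1 - ρ²)` times dρ; the extra root in the identity
    -- clears this denominator.
    have h3 : ∀ c : ℝ, Real.sqrt (1 - ρ x ^ 2) * (c • -(ρ x / Real.sqrt (1 - ρ x ^ 2))) =
        -(ρ x * c) := fun c => by
      rw [smul_eq_mul]
      field_simp
    rw [smul_add, smul_sub, smul_smul, smul_smul, smul_smul, h3, h3, ← pow_two, hs2]
    module

end Gravity
-- Assembly: bundle statements descend to M and are compared there.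
theorem mainTheorem5 {M : Type*} [TopologicalSpace M]
    [ChartedSpace (EuclideanSpace ℝ (Fin 3)) M] [IsManifold (𝓡 3) ∞ M]
    -- the connection `w` on `M`, and the frame `e` with `f(w) = e ∧ e`
    (w e : DiffForm (𝓡 3) M 1 Mat2)
    (hw : IsSmoothForm (𝓡 3) w) (hwsu : IsSu2Valued (𝓡 3) w)
    (he : IsSmoothForm (𝓡 3) e) (hesu : IsSu2Valued (𝓡 3) e)
    (hframe : ∀ x : M, frameVolume (e x) ≠ 0)
    (hcurv : ∀ x : M, curvature (𝓡 3) w x = e x ⋏ e x)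
    -- the `3`-form `h` (written `ω` in the text) and the `2`-form field `b` on `M`
    (h : DiffForm (𝓡 3) M 3 ℝ) (hh : IsSmoothForm (𝓡 3) h)
    (b : DiffForm (𝓡 3) M 2 ℝ) (hb : IsSmoothForm (𝓡 3) b)
    -- an orientation of `M × SU(2)`, given by a volume form
    (v : DiffForm bundleModel (M × S3) 6 ℝ) (hv : IsSmoothForm bundleModel v)
    (hv0 : ∀ p : M × S3, v p ≠ 0)
    -- the fields determined by these data
    (ρ : M → ℝ) (hρ : ρ = fieldStrength e h b)
    (W E : DiffForm bundleModel (M × S3) 1 Mat2)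
    (hW : W = liftConnection w) (hE : E = liftForm e)
    (Ω : DiffForm bundleModel (M × S3) 3 ℝ) (hΩ : Ω = reducedForm W E ρ)
    (J : ∀ p : M × S3, TangentSpace bundleModel p →ₗ[ℝ] TangentSpace bundleModel p)
    (hJ : J = fun p => hitchinJVec (v p) (Ω p))
    (Ωhat : DiffForm bundleModel (M × S3) 3 ℝ)
    (hΩhat : Ωhat = fun p => hitchinHat (v p) (Ω p))
    (WJ EJ : DiffForm bundleModel (M × S3) 1 Mat2)
    (hWJ : WJ = fun p => W p - ρ p.1 • E p)
    (hEJ : EJ = fun p => Real.sqrt (1 - ρ p.1 ^ 2) • E p)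
    (wJ : DiffForm (𝓡 3) M 1 Mat2) (hwJ : wJ = fun x => w x - ρ x • e x) :
    ((∀ p, IsNegativeType (v p) (Ω p)) ↔ ∀ x, |ρ x| < 1) ∧
    ((∀ p, IsNegativeType (v p) (Ω p)) →
      -- `d Ω̂ = 0` iff `dρ = 0` and `∇E = 2ρ E ∧ E`
      ((∀ p, extD bundleModel Ωhat p = 0) ↔
        (∀ x, mfderiv (𝓡 3) 𝓘(ℝ, ℝ) ρ x = 0) ∧
        ∀ p, covDeriv bundleModel W E p = (2 * ρ p.1) • (E p ⋏ E p)) ∧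
      -- the connection and the frame determined by `J_Ω`
      WJ = liftConnection wJ ∧ DeterminesConnection J WJ ∧ DeterminesFrame J EJ ∧
      -- equivalent forms of the field equations
      List.TFAE [
        ∀ p, extD bundleModel Ωhat p = 0,
        -- `dρ = 0` and `W_J` is torsion-free
        (∀ x, mfderiv (𝓡 3) 𝓘(ℝ, ℝ) ρ x = 0) ∧ ∀ p, covDeriv bundleModel WJ E p = 0,
        -- `W_J` is torsion-free, with curvature `(1 - ρ²) E ∧ E`
        (∀ p, covDeriv bundleModel WJ E p = 0) ∧
          ∀ p, curvature bundleModel WJ p = (1 - ρ p.1 ^ 2) • (E p ⋏ E p),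
        -- the same in terms of the frame `E_J`
        (∀ p, covDeriv bundleModel WJ EJ p = 0) ∧
          ∀ p, curvature bundleModel WJ p = EJ p ⋏ EJ p,
        -- the equations on `M` of gravity coupled to the `2`-form field
        (∀ x, mfderiv (𝓡 3) 𝓘(ℝ, ℝ) ρ x = 0) ∧ (∀ x, covDeriv (𝓡 3) wJ e x = 0) ∧
          ∀ x, curvature (𝓡 3) wJ x = (1 - ρ x ^ 2) • (e x ⋏ e x)]) := by
  have : IsManifold (𝓡 3) 1 M := IsManifold.of_le (n := ∞) (by simp)
  have hρd : ∀ x, ChartDiffAt (𝓡 3) ρ x := fun x => by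
    rw [hρ]
    exact differentiableAt_fieldStrength he hframe hh hb x
  have hneg : (∀ p, IsNegativeType (v p) (Ω p)) ↔ ∀ x, |ρ x| < 1 := by
    subst hΩ hW hE
    constructor
    · intro h x
      have h1 := h (x, ⟨EuclideanSpace.single 0 1, by simp⟩)
      rw [reducedForm_eq_pointForm] at h1
      exact ((isCoframe_lift hwsu hesu hframe _).isNegativeType_iff _ (hv0 _)).1 h1
    · intro h p
      rw [reducedForm_eq_pointForm]
      exact ((isCoframe_lift hwsu hesu hframe _).isNegativeType_iff _ (hv0 _)).2 (h p.1)
  refine ⟨hneg, fun hΩneg => ?_⟩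
  have hlt := hneg.1 hΩneg
  have hd : (∀ p, extD bundleModel Ωhat p = 0) ↔
      (∀ x, mfderiv (𝓡 3) 𝓘(ℝ, ℝ) ρ x = 0) ∧
        ∀ x, covDeriv (𝓡 3) w e x = (2 * ρ x) • (e x ⋏ e x) := by
    rw [hΩhat, hΩ, hW, hE, extD_hitchinHat_eq_zero_iff hwsu hesu hframe hw he hcurv hv hv0 hlt hρd]
    simp only [mfderiv_eq_zero_iff_chartDeriv (hρd _)]
  have hWJ' : WJ = liftConnection wJ := by
    rw [hWJ, hwJ, hW, hE, liftConnection_sub_smul]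
  have hEJ' : EJ = liftForm (fun x => Real.sqrt (1 - ρ x ^ 2) • e x) := by
    rw [hEJ, hE, liftForm_smul]
  have hcov : (∀ p, covDeriv bundleModel W E p = (2 * ρ p.1) • (E p ⋏ E p)) ↔
      ∀ x, covDeriv (𝓡 3) w e x = (2 * ρ x) • (e x ⋏ e x) := by
    rw [hW, hE, ← forall_liftForm_eq_iff]
    refine forall_congr' fun p => ?_
    rw [covDeriv_lift (he.formDiffAt p.1), ← liftForm_wedge,
      liftForm_smul (fun x => 2 * ρ x)]
  have htors : (∀ p, covDeriv bundleModel WJ E p = 0) ↔ ∀ x, covDeriv (𝓡 3) wJ e x = 0 := by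
    rw [hWJ', hE, ← forall_liftForm_eq_zero_iff]
    refine forall_congr' fun p => ?_
    rw [covDeriv_lift (he.formDiffAt p.1)]
  have hwJd : ∀ x, FormDiffAt (𝓡 3) wJ x := fun x => by
    rw [hwJ]
    exact (hw.formDiffAt x).sub_smul (he.formDiffAt x) (hρd x)
  have hcurvJ : (∀ p, curvature bundleModel WJ p = (1 - ρ p.1 ^ 2) • (E p ⋏ E p)) ↔
      ∀ x, curvature (𝓡 3) wJ x = (1 - ρ x ^ 2) • (e x ⋏ e x) := by
    rw [hWJ', hE, ← forall_liftForm_eq_iff]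
    refine forall_congr' fun p => ?_
    rw [curvature_lift (hwJd p.1), ← liftForm_wedge, liftForm_smul (fun x => 1 - ρ x ^ 2)]
  have hEJwedge : ∀ p, EJ p ⋏ EJ p = (1 - ρ p.1 ^ 2) • (E p ⋏ E p) := fun p => by
    rw [hEJ]
    ext1 u
    simp only [wedge_one_one_apply, ContinuousAlternatingMap.smul_apply, smul_mul_smul_comm,
      ← pow_two, sq_sqrt_one_sub_sq (hlt p.1), smul_sub]
  obtain ⟨hS, hF, hT⟩ := gravity_identities (fun x => hw.formDiffAt x) (fun x => he.formDiffAt x)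
    hcurv hlt hρd hwJ
  have hwedge := fun x => eq_zero_of_wedge_frame_eq_zero hesu (hframe x)
    (l := chartDeriv (𝓡 3) ρ x)
  have h12 : (∀ x, covDeriv (𝓡 3) w e x = (2 * ρ x) • (e x ⋏ e x)) ↔
      ∀ x, covDeriv (𝓡 3) wJ e x = 0 := by
    simp only [hS, sub_eq_zero]
  refine ⟨hd.trans (and_congr_right' hcov.symm), hWJ', ?_, ?_, ?_⟩
  · rw [hJ, hWJ, hΩ, hW, hE]
    exact determinesConnection_lift hwsu hesu hframe hv0 hlt
  · rw [hJ, hEJ, hΩ, hW, hE]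
    exact determinesFrame_lift hwsu hesu hframe hv0 hlt
  have htors' : (∀ p, covDeriv bundleModel WJ EJ p = 0) ↔
      ∀ x, covDeriv (𝓡 3) wJ (fun x => Real.sqrt (1 - ρ x ^ 2) • e x) x = 0 := by
    rw [hWJ', hEJ', ← forall_liftForm_eq_zero_iff]
    refine forall_congr' fun p => ?_
    rw [covDeriv_lift ((he.formDiffAt p.1).smul
      (chartDeriv_comp_real (hρd p.1) (hasDerivAt_sqrt_one_sub_sq (hlt p.1))).1)]
  have hvec : ∀ {x : M} (ξ η : TangentSpace (𝓡 3) x), ![ξ, η] 0 = ξ ∧ ![ξ, η] 1 = η :=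
    fun ξ η => ⟨rfl, rfl⟩
  simp only [hd, h12, hcurvJ, htors, htors', hEJwedge,
    fun x => mfderiv_eq_zero_iff_chartDeriv (hρd x)]
  -- The preceding rewriting by `hd` and `h12` has made the first two items identical.
  tfae_have 1 ↔ 2 := Iff.rfl
  tfae_have 2 → 5 := by
    rintro ⟨h1, h2⟩
    refine ⟨h1, h2, fun x => ?_⟩
    ext1 u
    rw [hF, h2, h1, h1, zero_smul, zero_smul, sub_self, sub_zero]
    exact (congrArg _ (smul_zero _)).trans (sub_zero _)
  tfae_have 5 → 3 := fun h => h.2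
  -- In `hF` the torsion and both curvature terms drop out, leaving dρ ∧ e = 0, so `hwedge` gives dρ
  -- = 0.
  tfae_have 3 → 2 := by
    rintro ⟨h2, h3⟩
    refine ⟨fun x => hwedge x fun ξ η => ?_, h2⟩
    have h4 := hF x ![ξ, η]
    rw [h3, h2] at h4
    have h5 : ρ x • (0 : TangentSpace (𝓡 3) x [⋀^Fin 2]→L[ℝ] Mat2) ![ξ, η] = 0 := smul_zero _
    rw [h5, sub_zero, (hvec ξ η).1, (hvec ξ η).2, eq_comm, sub_eq_self] at h4
    exact h4
  tfae_have 5 → 4 := by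
    rintro ⟨h1, h2, h3⟩
    refine ⟨fun x => ?_, h3⟩
    ext1 u
    have h4 := hT x u
    have h5 : (1 - ρ x ^ 2) • (0 : TangentSpace (𝓡 3) x [⋀^Fin 2]→L[ℝ] Mat2) u = 0 := smul_zero _
    rw [h2, h1, h1, zero_smul, zero_smul, sub_self, smul_zero, h5, sub_zero] at h4
    exact (smul_eq_zero.1 h4).resolve_left (sqrt_one_sub_sq_pos (hlt x)).ne'
  -- With T the torsion of `e` and D = dρ ∧ e, `hT` gives (1 - ρ²) T - ρ D = 0 and `hF` gives ρ T +
  -- D = 0. The first plus ρ times the second is T = 0.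
  tfae_have 4 → 3 := by
    rintro ⟨h1, h3⟩
    refine ⟨fun x => ?_, h3⟩
    ext1 u
    have h4 := hT x u
    have h5 := hF x u
    have h6 : Real.sqrt (1 - ρ x ^ 2) •
      (0 : TangentSpace (𝓡 3) x [⋀^Fin 2]→L[ℝ] Mat2) u = 0 := smul_zero _
    rw [h1, h6] at h4
    rw [h3, sub_sub, eq_comm, sub_eq_self] at h5
    have h7 : covDeriv (𝓡 3) wJ e x u = (1 - ρ x ^ 2) • covDeriv (𝓡 3) wJ e x u - ρ x •
        (chartDeriv (𝓡 3) ρ x (u 0) • e x ![u 1] - chartDeriv (𝓡 3) ρ x (u 1) • e x ![u 0]) +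
        ρ x • (ρ x • covDeriv (𝓡 3) wJ e x u +
        (chartDeriv (𝓡 3) ρ x (u 0) • e x ![u 1] - chartDeriv (𝓡 3) ρ x (u 1) • e x ![u 0])) := by
      module
    rw [h7, ← h4, h5, smul_zero, add_zero]
    rfl
  tfae_finish
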